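/- Let $(\Gamma,d_0)$ be a compact metric space with $d_0\le 1$, let $\mu$ be a Borel probability measure on $\Gamma$, and let $a>0$, $0\le b<1$, $\beta\ge 0$. Let $\mathcal H$ be the set of finite integer-valued measures (configurations) $\xi=\sum_{i=1}^n\delta_{x_i}$ on $\Gamma$, with total mass $|\xi|=n$ and the $\sigma$-algebra generated by the maps $\xi\mapsto\xi(C)$, $C\subset\Gamma$ Borel. Let $\pi$ be the invariant distribution of the birth-death process on $\{0,1,2,\dots\}$ with birth rates $\alpha_k=a+bk$ and death rates $\beta_k=k+\beta k(k-1)$, that is, $\pi(\{k\})\propto\prod_{i=0}^{k-1}\alpha_i/\beta_{i+1}$. Let $\boldsymbol\pi$ be the law of the polynomial birth-death point process $\sum_{i=1}^{Z}\delta_{U_i}$, where $Z\sim\pi$ is independent of the i.i.d. $\mu$-distributed $U_1,U_2,\dots$. For $\xi\in\mathcal H$ let $(\mathbf Z_\xi(t))_{t\ge 0}$ be the pure jump Markov process on $\mathcal H$ started at $\xi$ with generator $$\mathcal A h(\xi)=(a+b|\xi|)\int_\Gamma\big(h(\xi+\delta_x)-h(\xi)\big)\,\mu(dx)+\big(1+\beta(|\xi|-1)\big)\int_\Gamma\big(h(\xi-\delta_x)-h(\xi)\big)\,\xi(dx).$$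 For $\xi,\eta\in\mathcal H$ put $d_1(\xi,\eta)=1$ if $|\xi|\ne|\eta|$, $d_1(\xi,\eta)=0$ if $|\xi|=|\eta|=0$, and $d_1(\xi,\eta)=\frac1{|\xi|}\sup_u\left|\int u\,d\xi-\int u\,d\eta\right|$ if $|\xi|=|\eta|\neq0$, the supremum being over all $u:\Gamma\to\mathbb R$ with $|u(x)-u(y)|\le d_0(x,y)$ for all $x,y$. Let $\mathcal F$ be the set of $f:\mathcal H\to\mathbb R$ with $|f(\xi)-f(\eta)|\le d_1(\xi,\eta)$ for all $\xi,\eta\in\mathcal H$. For $f\in\mathcal F$ and $\xi,x,y$ in the respective spaces put $$h_f(\xi)=-\int_0^\infty\big(\mathbb E f(\mathbf Z_\xi(t))-\boldsymbol\pi(f)\big)\,dt,$$ $$C_n=\sup\{|h_f(\xi+\delta_x)-h_f(\xi+\delta_y)|: f\in\mathcal F,\ \xi\in\mathcal H,\ |\xi|=n,\ x,y\in\Gamma\},$$ $$\Delta_2h(\xi)=\sup_{x,y\in\Gamma}|h(\xi+\delta_x+\delta_y)-h(\xi+\delta_x)-h(\xi+\delta_y)+h(\xi)|.$$ Then $\pi$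 is indeed a probability distribution that is invariant for the birth-death process, all the integrals defining $h_f(\xi)$ converge absolutely for every $f\in\mathcal F$ and $\xi\in\mathcal H$, and the following bounds hold. (i) For every integer $n\ge 0$, $$C_n\le\min\left\{1,\ \frac1{2(n+1)}+\frac1a,\ \frac1{(a\wedge b)(n+1)}\right\},$$ where $a\wedge b=\min\{a,b\}$ and the last term is read as $+\infty$ if $b=0$. (ii) For every $f\in\mathcal F$ and $\xi\in\mathcal H$, $$\Delta_2h_f(\xi)\le\frac2{|\xi|+1}+\frac5a.$$ -/

import Mathlib

open MeasureTheory
open scoped ENNReal NNReal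

namespace PBDP

noncomputable section

/-! ### Pure jump Markov processes -/

section Jump

variable {S : Type*} [MeasurableSpace S]

/-- For a pure jump Markov process on `S` with rate kernel `Q` (from `x` it jumps into `dy` at rate
`Q x (dy)`, so its generator is `h ↦ ∫ (h y - h x) Q x (dy)`), `jumpLawAux Q k t x` is the law at
time `t` of the process started at `x`, restricted to the event that exactly `k` jumps
occur in `[0, t]`.  The recursion conditions on the time `s` of the first jump and on the state
right after it. -/
def jumpLawAux (Q : S → Measure S) : ℕ → ℝ → S → Measure S
  | 0, t, x => ENNReal.ofReal (Real.exp (-((Q x).real Set.univ * t))) • Measure.dirac x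
  | k + 1, t, x =>
      (volume.restrict (Set.Icc 0 t)).bind fun s =>
        ENNReal.ofReal (Real.exp (-((Q x).real Set.univ * s))) •
          (Q x).bind (jumpLawAux Q k (t - s))

/-- The law at time `t` of the pure jump Markov process with rate kernel `Q` started at `x`. -/
def jumpLaw (Q : S → Measure S) (t : ℝ) (x : S) : Measure S :=
  Measure.sum fun k => jumpLawAux Q k t x

end Jump

/-! ### The birth-death process on the nonnegative integers and its invariant distribution -/

/-- The birth rates. -/
def birthRate (a b : ℝ) (k : ℕ) : ℝ := a + b * k

/-- The death rates. -/
def deathRate (β : ℝ) (k : ℕ) : ℝ := k + β * k * (k - 1)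

/-- The rate kernel of the birth-death process; the truncated `0 - 1` has rate `deathRate β 0 = 0`. -/
def bdRateKernel (a b β : ℝ) (k : ℕ) : Measure ℕ :=
  ENNReal.ofReal (birthRate a b k) • Measure.dirac (k + 1) +
    ENNReal.ofReal (deathRate β k) • Measure.dirac (k - 1)

/-- The law at time `t` of the birth-death process started at `k`. -/
def bdLaw (a b β t : ℝ) (k : ℕ) : Measure ℕ := jumpLaw (bdRateKernel a b β) t k

/-- `ν` is an invariant distribution of the birth-death process. -/
def IsInvariantDistribution (a b β : ℝ) (ν : Measure ℕ) : Prop :=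
  IsProbabilityMeasure ν ∧ ∀ t : ℝ, 0 ≤ t → ν.bind (bdLaw a b β t) = ν

/-- The unnormalised weights `∏_{i < k} α_i / β_{i+1}`. -/
def pbdWeight (a b β : ℝ) (k : ℕ) : ℝ :=
  ∏ i ∈ Finset.range k, birthRate a b i / deathRate β (i + 1)

/-- The polynomial birth-death distribution on the nonnegative integers. -/
def pbdDistribution (a b β : ℝ) : Measure ℕ :=
  Measure.sum fun k =>
    ENNReal.ofReal (pbdWeight a b β k / ∑' j, pbdWeight a b β j) • Measure.dirac k

/-! ### Configurations -/

/-- Configurations, i.e. finite integer-valued measures `∑ δ_{x_i}`, encoded as the finite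
collections of their points with repeats; `|ξ|` is `ξ.card` and `ξ + δ_x` is `x ::ₘ ξ`. -/
abbrev Config (Γ : Type*) : Type _ := Multiset Γ

section Config

variable {Γ : Type*} [MeasurableSpace Γ]

/-- The measure `∑ δ_{x_i}` of a configuration. -/
def Config.toMeasure (ξ : Config Γ) : Measure Γ := (ξ.map Measure.dirac).sum

/-- The smallest `σ`-algebra making `ξ ↦ ξ(C)` measurable for all measurable `C`. -/
instance Config.instMeasurableSpace : MeasurableSpace (Config Γ) :=
  ⨆ (C : Set Γ) (_ : MeasurableSet C),
    MeasurableSpace.comap (fun ξ : Config Γ => Config.toMeasure ξ C) inferInstance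

/-- The law of `∑_{i=1}^Z δ_{U_i}`, where `Z` has the polynomial birth-death distribution and is
independent of the independent `μ`-distributed `U_i`. -/
def pbdPointLaw (a b β : ℝ) (μ : Measure Γ) : Measure (Config Γ) :=
  (pbdDistribution a b β).bind fun n =>
    (Measure.pi fun _ : Fin n => μ).map fun u => Finset.univ.val.map u

open Classical in
/-- The rate kernel of the birth-death system: at rate `a + b |ξ|` a `μ`-distributed point is
added, and each point of `ξ` is removed at rate `1 + β (|ξ| - 1)`. -/
def systemRateKernel (a b β : ℝ) (μ : Measure Γ) (ξ : Config Γ) : Measure (Config Γ) :=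
  ENNReal.ofReal (a + b * ξ.card) • μ.map (fun x => x ::ₘ ξ) +
    ENNReal.ofReal (1 + β * ((ξ.card : ℝ) - 1)) •
      (ξ.map fun x => Measure.dirac (ξ.erase x)).sum

/-- The law at time `t` of the birth-death system started at `ξ`. -/
def systemLaw (a b β : ℝ) (μ : Measure Γ) (t : ℝ) (ξ : Config Γ) : Measure (Config Γ) :=
  jumpLaw (systemRateKernel a b β μ) t ξ

/-- `E f(Z_ξ(t)) - 𝛑(f)`, for the birth-death system started at `ξ` and the law `𝛑` of the
polynomial birth-death point process. -/
def steinIntegrand (a b β : ℝ) (μ : Measure Γ) (f : Config Γ → ℝ) (ξ : Config Γ) (t : ℝ) : ℝ :=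
  ∫ η, f η ∂systemLaw a b β μ t ξ - ∫ η, f η ∂pbdPointLaw a b β μ

/-- The Stein solution `h_f`. -/
def steinSolution (a b β : ℝ) (μ : Measure Γ) (f : Config Γ → ℝ) (ξ : Config Γ) : ℝ :=
  -∫ t in Set.Ioi (0 : ℝ), steinIntegrand a b β μ f ξ t

/-- The integrals that define `h_f(ξ)` all exist. -/
def SteinWellDefined (a b β : ℝ) (μ : Measure Γ) (f : Config Γ → ℝ) (ξ : Config Γ) : Prop :=
  Integrable f (pbdPointLaw a b β μ) ∧
    (∀ t : ℝ, 0 ≤ t → Integrable f (systemLaw a b β μ t ξ)) ∧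
    IntegrableOn (steinIntegrand a b β μ f ξ) (Set.Ioi 0)

end Config

/-! ### The metric `d₁`, the test functions and the Stein factors -/

section Metric

variable {Γ : Type*} [MetricSpace Γ] [MeasurableSpace Γ]

open Classical in
/-- The metric `d₁` on finite measures on `Γ`. -/
def d₁ (ρ₁ ρ₂ : Measure Γ) : ℝ :=
  if ρ₁ Set.univ = ρ₂ Set.univ then
    if ρ₁ Set.univ = 0 then 0
    else (ρ₁.real Set.univ)⁻¹ *
      ⨆ u : {u : Γ → ℝ // LipschitzWith 1 u}, |∫ x, u.1 x ∂ρ₁ - ∫ x, u.1 x ∂ρ₂|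
  else 1

/-- The functions on configurations that are `1`-Lipschitz with respect to `d₁`. -/
def testFunctions (Γ : Type*) [MetricSpace Γ] [MeasurableSpace Γ] : Set (Config Γ → ℝ) :=
  {f | ∀ ξ η : Config Γ, |f ξ - f η| ≤ d₁ (Config.toMeasure ξ) (Config.toMeasure η)}

/-- `C_n`, the supremum of `|h_f(ξ + δ_x) - h_f(ξ + δ_y)|`, with values in `[0, ∞]`. -/
def steinC (a b β : ℝ) (μ : Measure Γ) (n : ℕ) : ℝ≥0∞ :=
  ⨆ (f ∈ testFunctions Γ) (ξ : Config Γ) (_ : ξ.card = n) (x : Γ) (y : Γ),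
    ENNReal.ofReal |steinSolution a b β μ f (x ::ₘ ξ) - steinSolution a b β μ f (y ::ₘ ξ)|

/-- `Δ₂h(ξ; x, y)`. -/
def secondDiff (h : Config Γ → ℝ) (ξ : Config Γ) (x y : Γ) : ℝ :=
  h (x ::ₘ y ::ₘ ξ) - h (x ::ₘ ξ) - h (y ::ₘ ξ) + h ξ

/-- `Δ₂h(ξ)`, the supremum of `|Δ₂h(ξ; x, y)|`, with values in `[0, ∞]`. -/
def secondDiffSup (h : Config Γ → ℝ) (ξ : Config Γ) : ℝ≥0∞ :=
  ⨆ (x : Γ) (y : Γ), ENNReal.ofReal |secondDiff h ξ x y|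

end Metric

end

end PBDP

/-! The proof couples no processes. All difference bounds come from maximum principles for the
generator, in two forms: `nonpos_of_hasDerivAt_le` in time, and `nonpos_of_improving` over the
unbounded state space with a growing weight.

Well-definedness. The first-jump decomposition gives a semigroup `expect` with the backward
equation; total mass at most 1 is enough, so explosion is never discussed. Subtracting the generator
at `ξ` from that at `x ::ₘ ξ` gives an equation for first differences. The extra point dies at rate
1 + β|ξ|, against which stand b extra births and β|ξ| extra deaths of other points, leaving the net
rate 1 - b. So first differences of the semigroup decay like exp(-(1 - b)t)
(`abs_expect_cons_sub_le`). Detailed balance for the sizes, together with exchangeability of the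
i.i.d. positions, makes the point process law invariant (`pbdPointLaw_balance`). Averaging over it
gives exponential convergence, hence convergence of h_f and the Stein equation
(`generator_steinSolution`).

Part (i). In the Stein equation at `x ::ₘ ξ` minus that at `y ::ₘ ξ`, the right side is at most
1/(|ξ| + 1). Any supersolution A/(n + 1) + B of the resulting recursion bounds the difference
(`abs_cons_sub_cons_le`). The pairs (A, B) = (0, 1), (1/2, 1/a) and (1/(a ∧ b), 0) give the three
terms.

Part (ii). Let v be the bound of (i) at n = |ξ|, and α, δ the birth and death rates at size n + 1.
Up to errors controlled by v, the Stein equation at `x ::ₘ ξ` is one-dimensional: α times the next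
first difference minus δ times the present one equals f minus its mean. If δ < α the present
difference is bounded below by induction from the empty configuration (`neg_le_cons_sub`); otherwise
the next one is bounded above by a maximum principle on large sizes (`cons_sub_le`). In both cases
the second difference is at most 1/max(α, δ) + 4v ≤ 1/a + 4v (`secondDiff_le`), which for (A, B) =
(1/2, 1/a) is the claim. The opposite sign follows by applying this to -h. -/

open MeasureTheory
open scoped ENNReal NNReal

namespace PBDP

noncomputable section

/-! ### Transition laws of a pure jump process: measurability and first-jump decomposition. -/

section JumpTheory

variable {S : Type*} [MeasurableSpace S] {Q : S → Measure S}

/-- Integration against a measurable family of finite measures preserves measurability, even when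
the total masses are not bounded. -/
lemma measurable_lintegral_rate [∀ x, IsFiniteMeasure (Q x)] (hQ : Measurable Q)
    {T : Type*} [MeasurableSpace T] {r : T → S} (hr : Measurable r) {g : T → S → ℝ≥0∞}
    (hg : Measurable (Function.uncurry g)) :
    Measurable fun τ => ∫⁻ y, g τ y ∂Q (r τ) := by
  have hmass : Measurable fun τ => Q (r τ) Set.univ :=
    (Measure.measurable_coe MeasurableSet.univ).comp (hQ.comp hr)
  -- Normalising each measure to mass at most 1 makes the family a finite kernel; where the mass
  -- vanishes, ∞ • 0 = 0 does no harm.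
  let K : ProbabilityTheory.Kernel T S :=
    { toFun := fun τ => (Q (r τ) Set.univ)⁻¹ • Q (r τ)
      measurable' := by
        refine Measure.measurable_of_measurable_coe _ fun s hs => ?_
        simp only [Measure.smul_apply, smul_eq_mul]
        exact hmass.inv.mul ((Measure.measurable_coe hs).comp (hQ.comp hr)) }
  have hK : ∀ τ, K τ = (Q (r τ) Set.univ)⁻¹ • Q (r τ) := fun _ => rfl
  have : ProbabilityTheory.IsFiniteKernel K := by
    refine ⟨1, ENNReal.one_lt_top, fun τ => ?_⟩
    rw [hK, Measure.smul_apply, smul_eq_mul]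
    exact ENNReal.inv_mul_le_one _
  have key : (fun τ => ∫⁻ y, g τ y ∂Q (r τ)) =
      fun τ => Q (r τ) Set.univ * ∫⁻ y, g τ y ∂K τ := by
    funext τ
    rw [hK, lintegral_smul_measure, smul_eq_mul, ← mul_assoc]
    by_cases h0 : Q (r τ) Set.univ = 0
    · simp [Measure.measure_univ_eq_zero.1 h0]
    · rw [ENNReal.mul_inv_cancel h0 (measure_ne_top _ _), one_mul]
  rw [key]
  exact hmass.mul (Measurable.lintegral_kernel_prod_right hg)

lemma measurable_rate (hQ : Measurable Q) : Measurable fun x => (Q x).real Set.univ :=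
  ((Measure.measurable_coe MeasurableSet.univ).comp hQ).ennreal_toReal

lemma integrable_rate {ν : Measure S} (hQ : Measurable Q) (hfin : ∫⁻ x, Q x Set.univ ∂ν ≠ ∞) :
    Integrable (fun x => (Q x).real Set.univ) ν :=
  integrable_toReal_of_lintegral_ne_top
    (Measurable.aemeasurable ((Measure.measurable_coe MeasurableSet.univ).comp hQ)) hfin

lemma integrable_rate_mul (hQ : Measurable Q) {ν : Measure S}
    (hfin : ∫⁻ x, Q x Set.univ ∂ν ≠ ∞) {u : S → ℝ} (hu : Measurable u) (hu0 : ∀ x, 0 ≤ u x)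
    (hu1 : ∀ x, u x ≤ 1) : Integrable (fun x => (Q x).real Set.univ * u x) ν := by
  refine (integrable_rate hQ hfin).mono' ((measurable_rate hQ).mul hu).aestronglyMeasurable
    (Filter.Eventually.of_forall fun x => ?_)
  rw [Real.norm_of_nonneg (mul_nonneg measureReal_nonneg (hu0 x))]
  exact mul_le_of_le_one_right measureReal_nonneg (hu1 x)

lemma measurable_setLIntegral_Icc {T : Type*} [MeasurableSpace T] {r : T → ℝ} (hr : Measurable r)
    {g : T → ℝ → ℝ≥0∞} (hg : Measurable (Function.uncurry g)) :
    Measurable fun τ => ∫⁻ s in Set.Icc 0 (r τ), g τ s := by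
  have : (fun τ => ∫⁻ s in Set.Icc 0 (r τ), g τ s) =
      fun τ => ∫⁻ s, {p : T × ℝ | p.2 ∈ Set.Icc 0 (r p.1)}.indicator (Function.uncurry g) (τ, s) := by
    funext τ
    rw [← lintegral_indicator measurableSet_Icc]
    rfl
  rw [this]
  refine Measurable.lintegral_prod_right' (hg.indicator ?_)
  exact (measurableSet_le measurable_const measurable_snd).inter
    (measurableSet_le measurable_snd (hr.comp measurable_fst))

lemma measurable_jumpLawAux [∀ x, IsFiniteMeasure (Q x)] (hQ : Measurable Q) (k : ℕ) :
    Measurable fun p : ℝ × S => jumpLawAux Q k p.1 p.2 := by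
  have hq := measurable_rate hQ
  induction k with
  | zero =>
    refine Measure.measurable_of_measurable_coe _ fun s hs => ?_
    simp only [jumpLawAux, Measure.smul_apply, smul_eq_mul]
    refine Measurable.mul ?_ ((Measure.measurable_coe hs).comp
      (Measure.measurable_dirac.comp measurable_snd))
    exact ENNReal.measurable_ofReal.comp (Real.measurable_exp.comp
      ((hq.comp measurable_snd).mul measurable_fst).neg)
  | succ k ih =>
    have h1 : ∀ t, Measurable (jumpLawAux Q k t) := fun t => ih.comp measurable_prodMk_left
    have hin : ∀ A : Set S, MeasurableSet A → Measurable fun p : (ℝ × S) × ℝ =>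
        ENNReal.ofReal (Real.exp (-((Q p.1.2).real Set.univ * p.2))) *
          ∫⁻ y, jumpLawAux Q k (p.1.1 - p.2) y A ∂Q p.1.2 := by
      intro A hA
      refine Measurable.mul ?_ ?_
      · exact ENNReal.measurable_ofReal.comp (Real.measurable_exp.comp
          ((hq.comp (measurable_snd.comp measurable_fst)).mul measurable_snd).neg)
      · refine measurable_lintegral_rate hQ (r := fun p : (ℝ × S) × ℝ => p.1.2) (by fun_prop)
          (g := fun p y => jumpLawAux Q k (p.1.1 - p.2) y A) ?_
        exact (Measure.measurable_coe hA).comp (ih.comp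
          (f := fun z : ((ℝ × S) × ℝ) × S => (z.1.1.1 - z.1.2, z.2)) (by fun_prop))
    refine Measure.measurable_of_measurable_coe _ fun A hA => ?_
    have h2 : ∀ p : ℝ × S, Measurable fun s : ℝ =>
        ENNReal.ofReal (Real.exp (-((Q p.2).real Set.univ * s))) •
          (Q p.2).bind (jumpLawAux Q k (p.1 - s)) := by
      intro p
      refine Measure.measurable_of_measurable_coe _ fun A hA => ?_
      simp only [Measure.smul_apply, smul_eq_mul,
        Measure.bind_apply hA (h1 _).aemeasurable]
      exact (hin A hA).comp (g := fun z : (ℝ × S) × ℝ =>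
        ENNReal.ofReal (Real.exp (-((Q z.1.2).real Set.univ * z.2))) *
          ∫⁻ y, jumpLawAux Q k (z.1.1 - z.2) y A ∂Q z.1.2)
        (f := fun s : ℝ => (p, s)) measurable_prodMk_left
    have h3 : (fun p : ℝ × S => jumpLawAux Q (k + 1) p.1 p.2 A) = fun p : ℝ × S =>
        ∫⁻ s in Set.Icc 0 p.1, ENNReal.ofReal (Real.exp (-((Q p.2).real Set.univ * s))) *
          ∫⁻ y, jumpLawAux Q k (p.1 - s) y A ∂Q p.2 := by
      funext p
      rw [jumpLawAux, Measure.bind_apply hA (h2 p).aemeasurable]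
      simp only [Measure.smul_apply, smul_eq_mul, Measure.bind_apply hA (h1 _).aemeasurable]
    rw [h3]
    exact measurable_setLIntegral_Icc measurable_fst (hin A hA)

lemma lintegral_jumpLawAux_zero {g : S → ℝ≥0∞} (hg : Measurable g) (t : ℝ) (x : S) :
    ∫⁻ y, g y ∂jumpLawAux Q 0 t x =
      ENNReal.ofReal (Real.exp (-((Q x).real Set.univ * t))) * g x := by
  rw [jumpLawAux, lintegral_smul_measure, lintegral_dirac' _ hg, smul_eq_mul]

lemma lintegral_jumpLawAux_succ [∀ x, IsFiniteMeasure (Q x)] (hQ : Measurable Q)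
    {g : S → ℝ≥0∞} (hg : Measurable g) (k : ℕ) (t : ℝ) (x : S) :
    ∫⁻ y, g y ∂jumpLawAux Q (k + 1) t x =
      ∫⁻ s in Set.Icc 0 t, ENNReal.ofReal (Real.exp (-((Q x).real Set.univ * s))) *
        ∫⁻ y, ∫⁻ z, g z ∂jumpLawAux Q k (t - s) y ∂Q x := by
  have hm := measurable_jumpLawAux hQ k
  have h1 : ∀ t, Measurable (jumpLawAux Q k t) := fun t => hm.comp measurable_prodMk_left
  rw [jumpLawAux, Measure.lintegral_bind _ hg.aemeasurable]
  · simp only [lintegral_smul_measure, smul_eq_mul]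
    simp only [Measure.lintegral_bind (h1 _).aemeasurable hg.aemeasurable]
  · refine Measurable.aemeasurable (Measure.measurable_of_measurable_coe _ fun A hA => ?_)
    simp only [Measure.smul_apply, smul_eq_mul, Measure.bind_apply hA (h1 _).aemeasurable]
    refine Measurable.mul (by fun_prop) ?_
    refine measurable_lintegral_rate hQ (r := fun _ : ℝ => x) measurable_const
          (g := fun s y => jumpLawAux Q k (t - s) y A) ?_
    exact (Measure.measurable_coe hA).comp (hm.comp
          (f := fun z : ℝ × S => (t - z.1, z.2)) (by fun_prop))

lemma measurable_lintegral_jumpLawAux [∀ x, IsFiniteMeasure (Q x)] (hQ : Measurable Q)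
    {g : S → ℝ≥0∞} (hg : Measurable g) (k : ℕ) :
    Measurable fun p : ℝ × S => ∫⁻ y, g y ∂jumpLawAux Q k p.1 p.2 :=
  (Measure.measurable_lintegral hg).comp (measurable_jumpLawAux hQ k)

lemma lintegral_jumpLaw {g : S → ℝ≥0∞} (t : ℝ) (x : S) :
    ∫⁻ y, g y ∂jumpLaw Q t x = ∑' k, ∫⁻ y, g y ∂jumpLawAux Q k t x :=
  lintegral_sum_measure _ _

lemma measurable_lintegral_jumpLaw [∀ x, IsFiniteMeasure (Q x)] (hQ : Measurable Q)
    {g : S → ℝ≥0∞} (hg : Measurable g) :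
    Measurable fun p : ℝ × S => ∫⁻ y, g y ∂jumpLaw Q p.1 p.2 := by
  simp only [lintegral_jumpLaw]
  exact Measurable.tsum fun k => measurable_lintegral_jumpLawAux hQ hg k

lemma measurable_jumpLaw [∀ x, IsFiniteMeasure (Q x)] (hQ : Measurable Q) :
    Measurable fun p : ℝ × S => jumpLaw Q p.1 p.2 := by
  refine Measure.measurable_of_measurable_coe _ fun A hA => ?_
  simpa [lintegral_indicator_one hA] using
    measurable_lintegral_jumpLaw hQ (g := A.indicator 1) (measurable_one.indicator hA)

/-- The first-jump decomposition of the transition semigroup. -/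
lemma lintegral_jumpLaw_eq [∀ x, IsFiniteMeasure (Q x)] (hQ : Measurable Q)
    {g : S → ℝ≥0∞} (hg : Measurable g) (t : ℝ) (x : S) :
    ∫⁻ y, g y ∂jumpLaw Q t x =
      ENNReal.ofReal (Real.exp (-((Q x).real Set.univ * t))) * g x +
      ∫⁻ s in Set.Icc 0 t, ENNReal.ofReal (Real.exp (-((Q x).real Set.univ * s))) *
        ∫⁻ y, ∫⁻ z, g z ∂jumpLaw Q (t - s) y ∂Q x := by
  rw [lintegral_jumpLaw, tsum_eq_zero_add' ENNReal.summable, lintegral_jumpLawAux_zero hg]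
  congr 1
  simp only [lintegral_jumpLawAux_succ hQ hg, lintegral_jumpLaw]
  have hm : ∀ k, Measurable fun p : ℝ × S => ∫⁻ z, g z ∂jumpLawAux Q k (t - p.1) p.2 := fun k =>
    (measurable_lintegral_jumpLawAux hQ hg k).comp (f := fun z : ℝ × S => (t - z.1, z.2))
      (by fun_prop)
  rw [← lintegral_tsum]
  · refine lintegral_congr fun s => ?_
    rw [ENNReal.tsum_mul_left, lintegral_tsum]
    exact fun k => ((hm k).comp measurable_prodMk_left).aemeasurable
  · intro k
    refine Measurable.aemeasurable (Measurable.mul (by fun_prop) ?_)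
    exact measurable_lintegral_rate hQ (r := fun _ : ℝ => x) measurable_const (hm k)

/-- An exponential clock of rate c rings either after t or at some time in [0, t]. This closes the
induction in `jumpLaw_univ_le_one`. -/
lemma exp_add_setLIntegral_rate {c : ℝ} (hc : 0 ≤ c) {t : ℝ} (ht : 0 ≤ t) :
    ENNReal.ofReal (Real.exp (-(c * t))) +
      ∫⁻ s in Set.Icc 0 t, ENNReal.ofReal (Real.exp (-(c * s))) * ENNReal.ofReal c = 1 := by
  have hd : ∀ s ∈ Set.uIcc 0 t, HasDerivAt (fun s => -Real.exp (-(c * s)))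
      (Real.exp (-(c * s)) * c) s := by
    intro s _
    have h := (((hasDerivAt_id' s).const_mul c).fun_neg.exp).fun_neg
    simpa using h
  have hint : ∫ s in (0)..t, Real.exp (-(c * s)) * c = 1 - Real.exp (-(c * t)) := by
    rw [intervalIntegral.integral_eq_sub_of_hasDerivAt hd
      ((by fun_prop : Continuous fun s => Real.exp (-(c * s)) * c).intervalIntegrable _ _)]
    simp; ring
  have h1 : ∫⁻ s in Set.Icc 0 t, ENNReal.ofReal (Real.exp (-(c * s))) * ENNReal.ofReal c =
      ENNReal.ofReal (1 - Real.exp (-(c * t))) := by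
    rw [← hint, intervalIntegral.integral_of_le ht, ← integral_Icc_eq_integral_Ioc,
      ofReal_integral_eq_lintegral_ofReal]
    · simp only [ENNReal.ofReal_mul (Real.exp_pos _).le]
    · exact (by fun_prop : Continuous fun s => Real.exp (-(c * s)) * c).integrableOn_Icc
    · exact Filter.Eventually.of_forall fun s => mul_nonneg (Real.exp_pos _).le hc
  rw [h1, ← ENNReal.ofReal_add (Real.exp_pos _).le]
  · simp
  · have : Real.exp (-(c * t)) ≤ 1 := Real.exp_le_one_iff.2 (by nlinarith)
    linarith

/-- Induction on the number of jumps allowed before t, by conditioning on the first one. Equality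
would be non-explosion, which is not needed. -/
lemma jumpLaw_univ_le_one [∀ x, IsFiniteMeasure (Q x)] (hQ : Measurable Q) {t : ℝ} (ht : 0 ≤ t)
    (x : S) : jumpLaw Q t x Set.univ ≤ 1 := by
  have key : ∀ n : ℕ, ∀ t : ℝ, 0 ≤ t → ∀ x,
      ∑ k ∈ Finset.range n, jumpLawAux Q k t x Set.univ ≤ 1 := by
    intro n
    induction n with
    | zero => simp
    | succ n ih =>
      intro t ht x
      rw [Finset.sum_range_succ', ← exp_add_setLIntegral_rate (c := (Q x).real Set.univ)
        measureReal_nonneg ht, add_comm]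
      have hk : ∀ k t x, jumpLawAux Q k t x Set.univ = ∫⁻ _, 1 ∂jumpLawAux Q k t x := by
        simp
      have hm : ∀ k, Measurable fun p : ℝ × S => jumpLawAux Q k (t - p.1) p.2 Set.univ :=
        fun k => (Measure.measurable_coe MeasurableSet.univ).comp
          ((measurable_jumpLawAux hQ k).comp (f := fun z : ℝ × S => (t - z.1, z.2)) (by fun_prop))
      refine add_le_add ?_ ?_
      · rw [hk, lintegral_jumpLawAux_zero measurable_const]; simp
      · calc ∑ k ∈ Finset.range n, jumpLawAux Q (k + 1) t x Set.univ
            = ∑ k ∈ Finset.range n, ∫⁻ s in Set.Icc 0 t,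
                ENNReal.ofReal (Real.exp (-((Q x).real Set.univ * s))) *
                ∫⁻ y, jumpLawAux Q k (t - s) y Set.univ ∂Q x := by
              refine Finset.sum_congr rfl fun k _ => ?_
              rw [hk, lintegral_jumpLawAux_succ hQ measurable_const]
              simp
          _ = ∫⁻ s in Set.Icc 0 t, ENNReal.ofReal (Real.exp (-((Q x).real Set.univ * s))) *
                ∫⁻ y, ∑ k ∈ Finset.range n, jumpLawAux Q k (t - s) y Set.univ ∂Q x := by
              rw [← lintegral_finsetSum]
              · refine lintegral_congr fun s => ?_
                rw [← Finset.mul_sum, lintegral_finsetSum]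
                exact fun k _ => (hm k).comp measurable_prodMk_left
              · intro k _
                refine Measurable.mul (by fun_prop) ?_
                exact measurable_lintegral_rate hQ (r := fun _ : ℝ => x) measurable_const (hm k)
          _ ≤ _ := by
              refine setLIntegral_mono' measurableSet_Icc fun s hs => ?_
              gcongr
              calc ∫⁻ y, ∑ k ∈ Finset.range n, jumpLawAux Q k (t - s) y Set.univ ∂Q x
                  ≤ ∫⁻ _, 1 ∂Q x := lintegral_mono fun y => ih _ (sub_nonneg.2 hs.2) y
                _ = _ := by simp
  rw [jumpLaw, Measure.sum_apply _ MeasurableSet.univ]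
  exact ENNReal.tsum_le_of_sum_range_le fun n => key n t ht x

end JumpTheory

/-! ### The semigroup on bounded functions and the backward equation. -/

section Semigroup

variable {S : Type*} [MeasurableSpace S] {Q : S → Measure S}

/-- The expectation of `f` at time `max t 0` under the pure jump process started at `x`. -/
def expect (Q : S → Measure S) (f : S → ℝ) (t : ℝ) (x : S) : ℝ :=
  ∫ y, f y ∂jumpLaw Q (max t 0) x

lemma expect_of_nonneg (f : S → ℝ) {t : ℝ} (ht : 0 ≤ t) (x : S) :
    expect Q f t x = ∫ y, f y ∂jumpLaw Q t x := by rw [expect, max_eq_left ht]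

variable [∀ x, IsFiniteMeasure (Q x)]

lemma isFiniteMeasure_jumpLaw (hQ : Measurable Q) {t : ℝ} (ht : 0 ≤ t) (x : S) : IsFiniteMeasure
    (jumpLaw Q t x) :=
  ⟨(jumpLaw_univ_le_one hQ ht x).trans_lt ENNReal.one_lt_top⟩

lemma integrable_jumpLaw (hQ : Measurable Q) {f : S → ℝ} (hf : Measurable f) {B : ℝ}
    (hB : ∀ x, |f x| ≤ B)
    {t : ℝ} (ht : 0 ≤ t) (x : S) : Integrable f (jumpLaw Q t x) := by
  have := isFiniteMeasure_jumpLaw hQ ht x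
  exact Integrable.of_bound hf.aestronglyMeasurable B (Filter.Eventually.of_forall hB)

lemma measurable_expect (hQ : Measurable Q) {f : S → ℝ} (hf : Measurable f) :
    Measurable fun p : ℝ × S => expect Q f p.1 p.2 := by
  let K : ProbabilityTheory.Kernel (ℝ × S) S :=
    { toFun := fun p => jumpLaw Q (max p.1 0) p.2
      measurable' := (measurable_jumpLaw hQ).comp
        (f := fun p : ℝ × S => (max p.1 0, p.2)) (by fun_prop) }
  exact (StronglyMeasurable.integral_kernel (κ := K) hf.stronglyMeasurable).measurable

lemma abs_expect_le (hQ : Measurable Q) {f : S → ℝ} {B : ℝ} (hB0 : 0 ≤ B) (hB : ∀ x, |f x| ≤ B)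
    (t : ℝ) (x : S) : |expect Q f t x| ≤ B := by
  have := isFiniteMeasure_jumpLaw hQ (le_max_right t 0) x
  have h1 : (jumpLaw Q (max t 0) x).real Set.univ ≤ 1 :=
    ENNReal.toReal_mono ENNReal.one_ne_top (jumpLaw_univ_le_one hQ (le_max_right t 0) x)
  calc |expect Q f t x| ≤ B * (jumpLaw Q (max t 0) x).real Set.univ := by
        rw [← Real.norm_eq_abs]
        exact norm_integral_le_of_norm_le_const (Filter.Eventually.of_forall hB)
    _ ≤ B * 1 := by gcongr
    _ = B := mul_one B

lemma integrable_expect (hQ : Measurable Q) {f : S → ℝ} (hf : Measurable f) {B : ℝ} (hB0 : 0 ≤ B)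
    (hB : ∀ x, |f x| ≤ B) (t : ℝ) (ν : Measure S) [IsFiniteMeasure ν] :
    Integrable (expect Q f t) ν :=
  Integrable.of_bound ((measurable_expect hQ hf).comp measurable_prodMk_left).aestronglyMeasurable B
    (Filter.Eventually.of_forall (abs_expect_le hQ hB0 hB t))

lemma measurable_integral_expect (hQ : Measurable Q) {f : S → ℝ} (hf : Measurable f) (ν : Measure S)
    [IsFiniteMeasure ν] : Measurable fun t => ∫ y, expect Q f t y ∂ν :=
  (StronglyMeasurable.integral_prod_right
    (f := fun t y => expect Q f t y) (measurable_expect hQ hf).stronglyMeasurable).measurable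

lemma abs_integral_expect_le (hQ : Measurable Q) {f : S → ℝ} {B : ℝ} (hB0 : 0 ≤ B)
    (hB : ∀ x, |f x| ≤ B) (t : ℝ) (ν : Measure S) [IsFiniteMeasure ν] :
    |∫ y, expect Q f t y ∂ν| ≤ B * ν.real Set.univ := by
  rw [← Real.norm_eq_abs]
  exact norm_integral_le_of_norm_le_const (Filter.Eventually.of_forall (abs_expect_le hQ hB0 hB t))

/-- Reversing time in the first-jump decomposition moves t out of the integrand. The integral is
then a primitive, so measurability in t upgrades to continuity and continuity to differentiability.
-/
lemma expect_mild (hQ : Measurable Q) {g : S → ℝ} (hg : Measurable g) (hg0 : ∀ x, 0 ≤ g x)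
    (hg1 : ∀ x, g x ≤ 1)
    {t : ℝ} (ht : 0 ≤ t) (x : S) :
    expect Q g t x = Real.exp (-((Q x).real Set.univ * t)) *
      (g x + ∫ s in (0)..t, Real.exp ((Q x).real Set.univ * s) * ∫ y, expect Q g s y ∂Q x) := by
  set q := (Q x).real Set.univ with hq
  have hq0 : 0 ≤ q := measureReal_nonneg
  have habs : ∀ x, |g x| ≤ 1 := fun x => abs_le.2 ⟨by linarith [hg0 x], hg1 x⟩
  have hnn : ∀ t x, 0 ≤ expect Q g t x := fun t x => integral_nonneg hg0
  have hof : ∀ t, 0 ≤ t → ∀ x, ∫⁻ y, ENNReal.ofReal (g y) ∂jumpLaw Q t x =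
      ENNReal.ofReal (expect Q g t x) := by
    intro t ht x
    rw [expect_of_nonneg g ht, ofReal_integral_eq_lintegral_ofReal (integrable_jumpLaw hQ hg habs ht x)
      (Filter.Eventually.of_forall hg0)]
  set F : ℝ → ℝ := fun s => ∫ y, expect Q g s y ∂Q x with hF
  have hFm : Measurable F := measurable_integral_expect hQ hg (Q x)
  have hFnn : ∀ s, 0 ≤ F s := fun s => integral_nonneg (hnn s)
  have hFb : ∀ s, |F s| ≤ q := fun s => by
    simpa using abs_integral_expect_le hQ zero_le_one habs s (Q x)
  have hint : IntegrableOn (fun s => Real.exp (-(q * s)) * F (t - s)) (Set.Icc 0 t) := by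
    refine Integrable.of_bound (C := 1 * q) (by fun_prop) ?_
    filter_upwards [ae_restrict_mem measurableSet_Icc] with s hs
    rw [norm_mul]
    refine mul_le_mul ?_ (hFb _) (norm_nonneg _) zero_le_one
    rw [Real.norm_of_nonneg (Real.exp_pos _).le, Real.exp_le_one_iff]
    nlinarith [hs.1]
  have h1 := lintegral_jumpLaw_eq hQ (g := fun y => ENNReal.ofReal (g y))
    (ENNReal.measurable_ofReal.comp hg) t x
  have h2 : ∫⁻ s in Set.Icc 0 t, ENNReal.ofReal (Real.exp (-(q * s))) *
        ∫⁻ y, ∫⁻ z, ENNReal.ofReal (g z) ∂jumpLaw Q (t - s) y ∂Q x =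
      ENNReal.ofReal (∫ s in Set.Icc 0 t, Real.exp (-(q * s)) * F (t - s)) := by
    rw [ofReal_integral_eq_lintegral_ofReal hint
      (Filter.Eventually.of_forall fun s => mul_nonneg (Real.exp_pos _).le (hFnn _))]
    refine setLIntegral_congr_fun measurableSet_Icc fun s hs => ?_
    simp only [hof _ (sub_nonneg.2 hs.2)]
    rw [ENNReal.ofReal_mul (Real.exp_pos _).le, hF]
    simp only
    rw [ofReal_integral_eq_lintegral_ofReal
      (integrable_expect hQ hg zero_le_one habs _ (Q x))
      (Filter.Eventually.of_forall (hnn _))]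
  rw [h2, hof t ht, ← ENNReal.ofReal_mul (Real.exp_pos _).le, ← ENNReal.ofReal_add
    (mul_nonneg (Real.exp_pos _).le (hg0 x))
    (integral_nonneg fun s => mul_nonneg (Real.exp_pos _).le (hFnn _)),
    ENNReal.ofReal_eq_ofReal_iff (hnn _ _) (add_nonneg (mul_nonneg (Real.exp_pos _).le (hg0 x))
    (integral_nonneg fun s => mul_nonneg (Real.exp_pos _).le (hFnn _)))] at h1
  rw [h1, mul_add, integral_Icc_eq_integral_Ioc, ← intervalIntegral.integral_of_le ht]
  congr 1
  have h3 := intervalIntegral.integral_comp_sub_left (a := 0) (b := t)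
    (fun r => Real.exp (-(q * (t - r))) * F r) t
  simp only [sub_sub_cancel, sub_self, sub_zero] at h3
  rw [h3, ← intervalIntegral.integral_const_mul]
  refine intervalIntegral.integral_congr fun s _ => ?_
  rw [← mul_assoc, ← Real.exp_add]
  congr 2
  ring

lemma continuous_expect_of_unit (hQ : Measurable Q) {g : S → ℝ} (hg : Measurable g)
    (hg0 : ∀ x, 0 ≤ g x)
    (hg1 : ∀ x, g x ≤ 1) (x : S) : Continuous fun t => expect Q g t x := by
  set q := (Q x).real Set.univ with hq
  have habs : ∀ x, |g x| ≤ 1 := fun x => abs_le.2 ⟨by linarith [hg0 x], hg1 x⟩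
  set F : ℝ → ℝ := fun s => ∫ y, expect Q g s y ∂Q x with hF
  have hFm : Measurable F := measurable_integral_expect hQ hg (Q x)
  have hFb : ∀ s, |F s| ≤ q := fun s => by
    simpa using abs_integral_expect_le hQ zero_le_one habs s (Q x)
  have hii : ∀ a b, IntervalIntegrable (fun s => Real.exp (q * s) * F s) volume a b := by
    intro a b
    refine IntervalIntegrable.continuousOn_mul ?_ (by fun_prop)
    exact intervalIntegrable_const (c := q) |>.mono_fun (by fun_prop)
      (Filter.Eventually.of_forall fun s => by
        simpa using (hFb s).trans (le_abs_self q))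
  have hc : Continuous fun t => Real.exp (-(q * max t 0)) *
      (g x + ∫ s in (0)..(max t 0), Real.exp (q * s) * F s) := by
    have := (intervalIntegral.continuous_primitive hii 0).comp
      (continuous_id.max (continuous_const (y := (0 : ℝ))))
    refine Continuous.mul (by fun_prop) (continuous_const.add this)
  convert hc using 2 with t
  rw [← expect_mild hQ hg hg0 hg1 (le_max_right t 0), expect, expect, max_eq_left (le_max_right t 0)]

/-- Every bounded measurable function is an affine image of one with values in `[0, 1]`. -/
lemma exists_affine_unit {f : S → ℝ} (hf : Measurable f) {B : ℝ} (hB : ∀ x, |f x| ≤ B) :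
    ∃ (g : S → ℝ) (c d : ℝ), Measurable g ∧ (∀ x, 0 ≤ g x) ∧ (∀ x, g x ≤ 1) ∧
      f = fun x => c * g x - d * 1 := by
  rcases isEmpty_or_nonempty S with h | ⟨⟨x₀⟩⟩
  · exact ⟨f, 1, 0, hf, fun x => h.elim x, fun x => h.elim x, funext fun x => h.elim x⟩
  have hB0 : 0 ≤ B := (abs_nonneg _).trans (hB x₀)
  refine ⟨fun x => (f x + B) / (2 * B + 1), 2 * B + 1, B, by fun_prop, fun x => ?_, fun x => ?_, ?_⟩
  · exact div_nonneg (by linarith [(abs_le.1 (hB x)).1]) (by linarith)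
  · rw [div_le_one (by linarith)]; linarith [(abs_le.1 (hB x)).2]
  · funext x
    have : (2 * B + 1) ≠ 0 := by positivity
    field_simp
    ring

/-- The term `expect Q (fun _ => 1)` has to be carried along, since the total mass is only known to
be at most 1. -/
lemma expect_affine (hQ : Measurable Q) {g : S → ℝ} (hg : Measurable g) {B : ℝ}
    (hB : ∀ x, |g x| ≤ B) (c d : ℝ)
    (t : ℝ) (x : S) : expect Q (fun x => c * g x - d * 1) t x =
      c * expect Q g t x - d * expect Q (fun _ => 1) t x := by
  have hi := integrable_jumpLaw hQ hg hB (le_max_right t 0) x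
  have := isFiniteMeasure_jumpLaw hQ (le_max_right t 0) x
  rw [expect, integral_sub (hi.const_mul c) ((integrable_const 1).const_mul d),
    integral_const_mul, integral_const_mul]
  rfl

lemma continuous_expect (hQ : Measurable Q) {f : S → ℝ} (hf : Measurable f) {B : ℝ}
    (hB : ∀ x, |f x| ≤ B) (x : S) :
    Continuous fun t => expect Q f t x := by
  obtain ⟨g, c, d, hg, hg0, hg1, rfl⟩ := exists_affine_unit hf hB
  have habs : ∀ x, |g x| ≤ 1 := fun x => abs_le.2 ⟨by linarith [hg0 x], hg1 x⟩
  simp only [expect_affine hQ hg habs c d]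
  exact ((continuous_expect_of_unit hQ hg hg0 hg1 x).const_mul c).sub
    ((continuous_expect_of_unit hQ measurable_const (fun _ => zero_le_one) (fun _ => le_rfl)
      x).const_mul d)

lemma continuous_integral_expect (hQ : Measurable Q) {f : S → ℝ} (hf : Measurable f) {B : ℝ}
    (hB0 : 0 ≤ B)
    (hB : ∀ x, |f x| ≤ B) (ν : Measure S) [IsFiniteMeasure ν] :
    Continuous fun t => ∫ y, expect Q f t y ∂ν := by
  refine continuous_of_dominated (bound := fun _ => B) (fun t => ?_) (fun t => ?_)
    (integrable_const B) (Filter.Eventually.of_forall fun y => continuous_expect hQ hf hB y)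
  · exact ((measurable_expect hQ hf).comp measurable_prodMk_left).aestronglyMeasurable
  · exact Filter.Eventually.of_forall (abs_expect_le hQ hB0 hB t)

lemma hasDerivAt_expect_of_unit (hQ : Measurable Q) {g : S → ℝ} (hg : Measurable g)
    (hg0 : ∀ x, 0 ≤ g x)
    (hg1 : ∀ x, g x ≤ 1) (x : S) {t : ℝ} (ht : 0 < t) :
    HasDerivAt (fun t => expect Q g t x)
      ((∫ y, expect Q g t y ∂Q x) - (Q x).real Set.univ * expect Q g t x) t := by
  set q := (Q x).real Set.univ with hq
  have habs : ∀ x, |g x| ≤ 1 := fun x => abs_le.2 ⟨by linarith [hg0 x], hg1 x⟩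
  have hFc := continuous_integral_expect hQ hg zero_le_one habs (Q x)
  have hcont : Continuous fun s => Real.exp (q * s) * ∫ y, expect Q g s y ∂Q x := by fun_prop
  have hd : HasDerivAt (fun t => Real.exp (-(q * t)) *
      (g x + ∫ s in (0)..t, Real.exp (q * s) * ∫ y, expect Q g s y ∂Q x))
      (Real.exp (-(q * t)) * -(q * 1) *
        (g x + ∫ s in (0)..t, Real.exp (q * s) * ∫ y, expect Q g s y ∂Q x) +
        Real.exp (-(q * t)) * (Real.exp (q * t) * ∫ y, expect Q g t y ∂Q x)) t :=
    (((hasDerivAt_id' t).const_mul q).fun_neg.exp).mul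
      ((hcont.integral_hasStrictDerivAt 0 t).hasDerivAt.const_add _)
  have heq : (fun t => expect Q g t x) =ᶠ[nhds t] fun t => Real.exp (-(q * t)) *
      (g x + ∫ s in (0)..t, Real.exp (q * s) * ∫ y, expect Q g s y ∂Q x) := by
    filter_upwards [lt_mem_nhds ht] with s hs
    exact expect_mild hQ hg hg0 hg1 hs.le x
  refine (hd.congr_of_eventuallyEq heq).congr_deriv ?_
  have h1 : Real.exp (-(q * t)) * Real.exp (q * t) = 1 := by rw [← Real.exp_add]; simp
  rw [expect_mild hQ hg hg0 hg1 ht.le x, ← hq]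
  linear_combination (∫ y, expect Q g t y ∂Q x) * h1

/-- The backward equation. -/
lemma hasDerivAt_expect (hQ : Measurable Q) {f : S → ℝ} (hf : Measurable f) {B : ℝ}
    (hB : ∀ x, |f x| ≤ B) (x : S)
    {t : ℝ} (ht : 0 < t) :
    HasDerivAt (fun t => expect Q f t x)
      ((∫ y, expect Q f t y ∂Q x) - (Q x).real Set.univ * expect Q f t x) t := by
  obtain ⟨g, c, d, hg, hg0, hg1, rfl⟩ := exists_affine_unit hf hB
  have habs : ∀ x, |g x| ≤ 1 := fun x => abs_le.2 ⟨by linarith [hg0 x], hg1 x⟩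
  have h1 : ∀ x : S, |(fun _ : S => (1 : ℝ)) x| ≤ 1 := by simp
  simp only [expect_affine hQ hg habs c d]
  rw [integral_sub ((integrable_expect hQ hg zero_le_one habs t (Q x)).const_mul c)
    ((integrable_expect hQ measurable_const zero_le_one h1 t (Q x)).const_mul d),
    integral_const_mul, integral_const_mul]
  refine (((hasDerivAt_expect_of_unit hQ hg hg0 hg1 x ht).const_mul c).sub
    ((hasDerivAt_expect_of_unit hQ measurable_const (fun _ => zero_le_one) (fun _ => le_rfl)
      x ht).const_mul d)).congr_deriv ?_
  ring

lemma expect_zero (hQ : Measurable Q) {f : S → ℝ} (hf : Measurable f) {B : ℝ}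
    (hB : ∀ x, |f x| ≤ B) (x : S) :
    expect Q f 0 x = f x := by
  obtain ⟨g, c, d, hg, hg0, hg1, rfl⟩ := exists_affine_unit hf hB
  have habs : ∀ x, |g x| ≤ 1 := fun x => abs_le.2 ⟨by linarith [hg0 x], hg1 x⟩
  rw [expect_affine hQ hg habs c d, expect_mild hQ hg hg0 hg1 le_rfl,
    expect_mild hQ measurable_const (fun _ => zero_le_one) (fun _ => le_rfl) le_rfl]
  simp

end Semigroup

/-! ### Comparison principles -/

/-- A function that is bounded by `B`, and all of whose bounds by multiples `θ V` of a function
`V ≥ 1` improve by a factor that stays away from `1` where `V` is bounded, is nonpositive. -/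
lemma nonpos_of_improving {X : Type*} {ψ V γ : X → ℝ} {B : ℝ} (hB : ∀ z, ψ z ≤ B)
    (hV : ∀ z, 1 ≤ V z) (hγ : ∀ c, ∃ ρ < 1, ∀ z, V z ≤ c → γ z ≤ ρ)
    (himp : ∀ θ, 0 ≤ θ → (∀ z, ψ z ≤ θ * V z) → ∀ z, ψ z ≤ γ z * (θ * V z)) (z : X) :
    ψ z ≤ 0 := by
  have hVpos : ∀ z, 0 < V z := fun z => zero_lt_one.trans_le (hV z)
  by_contra! hz
  have hbdd : BddAbove (Set.range fun z => ψ z / V z) := by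
    refine ⟨max B 0, ?_⟩
    rintro _ ⟨w, rfl⟩
    rw [div_le_iff₀ (hVpos w)]
    exact (hB w).trans ((le_max_left B 0).trans
      (le_mul_of_one_le_right (le_max_right B 0) (hV w)))
  set θ := ⨆ z, ψ z / V z with hθ
  have hle : ∀ w, ψ w / V w ≤ θ := fun w => le_ciSup hbdd w
  have hθpos : 0 < θ := (div_pos hz (hVpos z)).trans_le (hle z)
  have hθle : ∀ w, ψ w ≤ θ * V w := fun w => (div_le_iff₀ (hVpos w)).1 (hle w)
  -- Above this threshold for V the uniform bound B already gives ψ ≤ θV/2; below it the improvement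
  -- factor is at most ρ < 1. Either way the optimal θ could be lowered.
  obtain ⟨ρ, hρ1, hρ⟩ := hγ (2 * max B 0 / θ)
  have key : ∀ w, ψ w / V w ≤ max (1 / 2) ρ * θ := by
    intro w
    rw [div_le_iff₀ (hVpos w)]
    by_cases hw : V w ≤ 2 * max B 0 / θ
    · refine (himp θ hθpos.le hθle w).trans ?_
      rw [mul_assoc]
      exact mul_le_mul_of_nonneg_right ((hρ w hw).trans (le_max_right _ _))
        (mul_pos hθpos (hVpos w)).le
    · rw [not_le, div_lt_iff₀ hθpos] at hw
      calc ψ w ≤ max B 0 := (hB w).trans (le_max_left _ _)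
        _ ≤ 1 / 2 * (θ * V w) := by linarith
        _ ≤ max (1 / 2) ρ * (θ * V w) :=
          mul_le_mul_of_nonneg_right (le_max_left _ _) (mul_pos hθpos (hVpos w)).le
        _ = _ := by ring
  have : Nonempty X := ⟨z⟩
  have h1 : θ ≤ max (1 / 2) ρ * θ := ciSup_le key
  have h2 : max (1 / 2) ρ < 1 := max_lt (by norm_num) hρ1
  nlinarith

/-- Grönwall: exp(rt) z(t) is antitone. -/
lemma nonpos_of_hasDerivAt_le {z z' : ℝ → ℝ} {r : ℝ} (hc : ContinuousOn z (Set.Ici 0))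
    (hd : ∀ t, 0 < t → HasDerivAt z (z' t) t) (hz' : ∀ t, 0 < t → z' t ≤ -(r * z t))
    (h0 : z 0 ≤ 0) {t : ℝ} (ht : 0 ≤ t) : z t ≤ 0 := by
  have hD : ∀ t, 0 < t → HasDerivAt (fun t => Real.exp (r * t) * z t)
      (Real.exp (r * t) * (r * 1) * z t + Real.exp (r * t) * z' t) t := fun t ht =>
    (((hasDerivAt_id' t).const_mul r).exp).mul (hd t ht)
  have hanti : AntitoneOn (fun t => Real.exp (r * t) * z t) (Set.Ici 0) := by
    refine antitoneOn_of_deriv_nonpos (convex_Ici 0) ?_ ?_ ?_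
    · exact (by fun_prop : Continuous fun t => Real.exp (r * t)).continuousOn.mul hc
    · rw [interior_Ici]
      exact fun t ht => (hD t ht).differentiableAt.differentiableWithinAt
    · rw [interior_Ici]
      intro t ht
      rw [(hD t ht).deriv]
      have := mul_le_mul_of_nonneg_left (hz' t ht) (Real.exp_pos (r * t)).le
      linarith
  have h1 := hanti (Set.self_mem_Ici) ht ht
  simp only [mul_zero, Real.exp_zero, one_mul] at h1
  by_contra! hcon
  nlinarith [Real.exp_pos (r * t), mul_pos (Real.exp_pos (r * t)) hcon]

/-! ### Invariance from balance, and the Poisson equation. -/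

section SemigroupProperties

variable {S : Type*} [MeasurableSpace S] {Q : S → Measure S} [∀ x, IsFiniteMeasure (Q x)]

lemma measurable_integral_rate (hQ : Measurable Q) {u : S → ℝ} (hu : Measurable u)
    (hu0 : ∀ x, 0 ≤ u x) : Measurable fun x => ∫ y, u y ∂Q x := by
  have : (fun x => ∫ y, u y ∂Q x) = fun x => (∫⁻ y, ENNReal.ofReal (u y) ∂Q x).toReal :=
    funext fun x => integral_eq_lintegral_of_nonneg_ae (Filter.Eventually.of_forall hu0)
      hu.aestronglyMeasurable
  rw [this]
  exact (measurable_lintegral_rate hQ measurable_id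
    (g := fun _ y => ENNReal.ofReal (u y)) (by fun_prop)).ennreal_toReal

lemma integrable_integral_rate (hQ : Measurable Q) {ν : Measure S}
    (hfin : ∫⁻ x, Q x Set.univ ∂ν ≠ ∞) {u : S → ℝ} (hu : Measurable u) (hu0 : ∀ x, 0 ≤ u x)
    (hu1 : ∀ x, u x ≤ 1) : Integrable (fun x => ∫ y, u y ∂Q x) ν := by
  refine (integrable_rate hQ hfin).mono'
    (measurable_integral_rate hQ hu hu0).aestronglyMeasurable
    (Filter.Eventually.of_forall fun x => ?_)
  refine (norm_integral_le_of_norm_le_const (C := 1) (Filter.Eventually.of_forall fun y => ?_)).trans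
    (one_mul _).le
  rw [Real.norm_of_nonneg (hu0 y)]
  exact hu1 y

lemma integral_generator_eq_zero (hQ : Measurable Q) {ν : Measure S}
    (hfin : ∫⁻ x, Q x Set.univ ∂ν ≠ ∞)
    (hbal : ∀ g : S → ℝ≥0∞, Measurable g →
      ∫⁻ x, ∫⁻ y, g y ∂Q x ∂ν = ∫⁻ x, Q x Set.univ * g x ∂ν)
    {u : S → ℝ} (hu : Measurable u) (hu0 : ∀ x, 0 ≤ u x) (hu1 : ∀ x, u x ≤ 1) :
    ∫ x, ((∫ y, u y ∂Q x) - (Q x).real Set.univ * u x) ∂ν = 0 := by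
  have hi1 := integrable_integral_rate hQ hfin hu hu0 hu1
  have hi2 := integrable_rate_mul hQ hfin hu hu0 hu1
  rw [integral_sub hi1 hi2, sub_eq_zero,
    integral_eq_lintegral_of_nonneg_ae
      (Filter.Eventually.of_forall fun x => integral_nonneg hu0) hi1.aestronglyMeasurable,
    integral_eq_lintegral_of_nonneg_ae
      (Filter.Eventually.of_forall fun x => mul_nonneg measureReal_nonneg (hu0 x))
      hi2.aestronglyMeasurable]
  congr 1
  calc ∫⁻ x, ENNReal.ofReal (∫ y, u y ∂Q x) ∂ν
      = ∫⁻ x, ∫⁻ y, ENNReal.ofReal (u y) ∂Q x ∂ν :=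
        lintegral_congr fun x => ofReal_integral_eq_lintegral_ofReal
          (Integrable.of_bound hu.aestronglyMeasurable 1 (Filter.Eventually.of_forall fun y => by
            rw [Real.norm_of_nonneg (hu0 y)]; exact hu1 y))
          (Filter.Eventually.of_forall hu0)
    _ = _ := hbal (fun x => ENNReal.ofReal (u x)) (ENNReal.measurable_ofReal.comp hu)
    _ = _ := lintegral_congr fun x => by
        rw [ENNReal.ofReal_mul measureReal_nonneg, ofReal_measureReal]

/-- A probability measure that integrates the rates and annihilates the generator is invariant. -/
lemma integral_expect_of_balance_unit (hQ : Measurable Q) {ν : Measure S} [IsProbabilityMeasure ν]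
    (hfin : ∫⁻ x, Q x Set.univ ∂ν ≠ ∞)
    (hbal : ∀ g : S → ℝ≥0∞, Measurable g →
      ∫⁻ x, ∫⁻ y, g y ∂Q x ∂ν = ∫⁻ x, Q x Set.univ * g x ∂ν)
    {f : S → ℝ} (hf : Measurable f) (hf0 : ∀ x, 0 ≤ f x) (hf1 : ∀ x, f x ≤ 1)
    {t : ℝ} (ht : 0 ≤ t) : ∫ x, expect Q f t x ∂ν = ∫ x, f x ∂ν := by
  have habs : ∀ x, |f x| ≤ 1 := fun x => abs_le.2 ⟨by linarith [hf0 x], hf1 x⟩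
  have hqi := integrable_rate hQ hfin
  have hnn : ∀ t x, 0 ≤ expect Q f t x := fun t x => integral_nonneg hf0
  have hle1 : ∀ t x, expect Q f t x ≤ 1 := fun t x =>
    (abs_le.1 (abs_expect_le hQ zero_le_one habs t x)).2
  have hm : ∀ t, Measurable (expect Q f t) := fun t =>
    (measurable_expect hQ hf).comp (f := fun y : S => (t, y)) measurable_prodMk_left
  have hi1 : ∀ t, Integrable (fun x => ∫ y, expect Q f t y ∂Q x) ν := fun t =>
    integrable_integral_rate hQ hfin (hm t) (hnn t) (hle1 t)
  have hi2 : ∀ t, Integrable (fun x => (Q x).real Set.univ * expect Q f t x) ν := fun t =>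
    integrable_rate_mul hQ hfin (hm t) (hnn t) (hle1 t)
  have hbd : ∀ t x, ‖(∫ y, expect Q f t y ∂Q x) - (Q x).real Set.univ * expect Q f t x‖ ≤
      (Q x).real Set.univ + (Q x).real Set.univ := by
    intro t x
    refine (norm_sub_le _ _).trans (add_le_add ?_ ?_)
    · simpa using abs_integral_expect_le hQ zero_le_one habs t (Q x)
    · rw [Real.norm_of_nonneg (mul_nonneg measureReal_nonneg (hnn t x))]
      exact mul_le_of_le_one_right measureReal_nonneg (hle1 t x)
  have hcont : Continuous fun t => ∫ x, expect Q f t x ∂ν :=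
    continuous_integral_expect hQ hf zero_le_one habs ν
  -- Differentiation under the integral is dominated by twice the total rate, integrable by `hfin`;
  -- the derivative is the integral of the generator, which balance annihilates.
  have hder : ∀ t, 0 < t → HasDerivAt (fun t => ∫ x, expect Q f t x ∂ν) 0 t := by
    intro t ht
    have := (hasDerivAt_integral_of_dominated_loc_of_deriv_le (μ := ν) (F := expect Q f)
      (F' := fun t x => (∫ y, expect Q f t y ∂Q x) - (Q x).real Set.univ * expect Q f t x)
      (x₀ := t) (s := Set.Ioi 0) (bound := fun x => (Q x).real Set.univ + (Q x).real Set.univ)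
      (Ioi_mem_nhds ht) (Filter.Eventually.of_forall fun t => (hm t).aestronglyMeasurable)
      (integrable_expect hQ hf zero_le_one habs t ν)
      ((hi1 t).sub (hi2 t)).aestronglyMeasurable
      (Filter.Eventually.of_forall fun x t _ => hbd t x) (hqi.add hqi)
      (Filter.Eventually.of_forall fun x t ht => hasDerivAt_expect hQ hf habs x ht)).2
    rwa [integral_generator_eq_zero hQ hfin hbal (hm t) (hnn t) (hle1 t)] at this
  have h0 : ∫ x, expect Q f 0 x ∂ν = ∫ x, f x ∂ν := by
    simp only [expect_zero hQ hf habs]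
  have hup := nonpos_of_hasDerivAt_le (r := 0) (z' := fun _ => 0)
    (z := fun t => (∫ x, expect Q f t x ∂ν) - ∫ x, f x ∂ν)
    (hcont.sub continuous_const).continuousOn (fun t ht => (hder t ht).sub_const _)
    (fun t _ => by simp) (by rw [h0, sub_self]) ht
  have hlow := nonpos_of_hasDerivAt_le (r := 0) (z' := fun _ => -0)
    (z := fun t => (∫ x, f x ∂ν) - ∫ x, expect Q f t x ∂ν)
    (continuous_const.sub hcont).continuousOn (fun t ht => (hder t ht).const_sub _)
    (fun t _ => by simp) (by rw [h0, sub_self]) ht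
  linarith

lemma bind_jumpLaw_of_balance (hQ : Measurable Q) {ν : Measure S} [IsProbabilityMeasure ν]
    (hfin : ∫⁻ x, Q x Set.univ ∂ν ≠ ∞)
    (hbal : ∀ g : S → ℝ≥0∞, Measurable g →
      ∫⁻ x, ∫⁻ y, g y ∂Q x ∂ν = ∫⁻ x, Q x Set.univ * g x ∂ν)
    {t : ℝ} (ht : 0 ≤ t) : ν.bind (jumpLaw Q t) = ν := by
  have hmt : Measurable (jumpLaw Q t) := 
    (measurable_jumpLaw hQ).comp (f := fun y : S => (t, y)) measurable_prodMk_left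
  have hfm : ∀ x, IsFiniteMeasure (jumpLaw Q t x) := isFiniteMeasure_jumpLaw hQ ht
  ext A hA
  rw [Measure.bind_apply hA hmt.aemeasurable]
  have h1 := integral_expect_of_balance_unit hQ hfin hbal (f := A.indicator 1)
    (measurable_one.indicator hA) (fun x => Set.indicator_nonneg (by simp) x)
    (fun x => Set.indicator_le_self' (by simp) x) ht
  simp only [expect_of_nonneg _ ht, integral_indicator_one hA] at h1
  have h2 : Integrable (fun x => (jumpLaw Q t x).real A) ν := by
    have hmA : Measurable fun x => jumpLaw Q t x A := (Measure.measurable_coe hA).comp hmt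
    refine Integrable.of_bound (C := 1) hmA.ennreal_toReal.aestronglyMeasurable
      (Filter.Eventually.of_forall fun x => ?_)
    rw [Real.norm_of_nonneg measureReal_nonneg]
    exact ENNReal.toReal_mono ENNReal.one_ne_top
      ((measure_mono (Set.subset_univ A)).trans (jumpLaw_univ_le_one hQ ht x))
  calc ∫⁻ x, jumpLaw Q t x A ∂ν = ∫⁻ x, ENNReal.ofReal ((jumpLaw Q t x).real A) ∂ν :=
        lintegral_congr fun x => (ofReal_measureReal).symm
    _ = ENNReal.ofReal (∫ x, (jumpLaw Q t x).real A ∂ν) :=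
        (ofReal_integral_eq_lintegral_ofReal h2
          (Filter.Eventually.of_forall fun x => measureReal_nonneg)).symm
    _ = ν A := by rw [h1, ofReal_measureReal]

lemma integral_expect_of_balance (hQ : Measurable Q) {ν : Measure S} [IsProbabilityMeasure ν]
    (hfin : ∫⁻ x, Q x Set.univ ∂ν ≠ ∞)
    (hbal : ∀ g : S → ℝ≥0∞, Measurable g →
      ∫⁻ x, ∫⁻ y, g y ∂Q x ∂ν = ∫⁻ x, Q x Set.univ * g x ∂ν)
    {f : S → ℝ} (hf : Measurable f) {B : ℝ} (hB : ∀ x, |f x| ≤ B)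
    {t : ℝ} (ht : 0 ≤ t) : ∫ x, expect Q f t x ∂ν = ∫ x, f x ∂ν := by
  obtain ⟨g, c, d, hg, hg0, hg1, rfl⟩ := exists_affine_unit hf hB
  have habs : ∀ x, |g x| ≤ 1 := fun x => abs_le.2 ⟨by linarith [hg0 x], hg1 x⟩
  have h1 : ∀ x : S, |(fun _ : S => (1 : ℝ)) x| ≤ 1 := by simp
  have hgi : Integrable g ν :=
    Integrable.of_bound hg.aestronglyMeasurable 1 (Filter.Eventually.of_forall habs)
  simp only [expect_affine hQ hg habs c d]
  rw [integral_sub ((integrable_expect hQ hg zero_le_one habs t ν).const_mul c)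
    ((integrable_expect hQ measurable_const zero_le_one h1 t ν).const_mul d),
    integral_sub (hgi.const_mul c) ((integrable_const 1).const_mul d),
    integral_const_mul, integral_const_mul, integral_const_mul, integral_const_mul,
    integral_expect_of_balance_unit hQ hfin hbal hg hg0 hg1 ht,
    integral_expect_of_balance_unit hQ hfin hbal measurable_const (fun _ => zero_le_one)
      (fun _ => le_rfl) ht]

/-- If the semigroup applied to `f` converges to `c` exponentially fast, then the integrated
deviation solves the Poisson equation. -/
lemma poisson_equation (hQ : Measurable Q) {f : S → ℝ} (hf : Measurable f) {B : ℝ} (hB0 : 0 ≤ B)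
    (hB : ∀ x, |f x| ≤ B) {c r : ℝ} (hr : 0 < r) {W : S → ℝ}
    (hW : ∀ t, 0 ≤ t → ∀ x, |expect Q f t x - c| ≤ Real.exp (-(r * t)) * W x)
    (x : S) (hWi : Integrable W (Q x)) :
    (∫ y, (∫ t in Set.Ioi (0 : ℝ), (expect Q f t y - c)) ∂Q x) -
      (Q x).real Set.univ * ∫ t in Set.Ioi (0 : ℝ), (expect Q f t x - c) = c - f x := by
  have hexp : IntegrableOn (fun t => Real.exp (-(r * t))) (Set.Ioi 0) := by
    simpa using integrableOn_exp_mul_Ioi (neg_lt_zero.2 hr) 0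
  have hexp' : IntegrableOn (fun t => Real.exp (-(r * max t 0))) (Set.Ioi 0) :=
    hexp.congr_fun (fun t ht => by simp only [max_eq_left (le_of_lt (Set.mem_Ioi.1 ht))])
      measurableSet_Ioi
  -- `expect` is frozen at its time-0 value for negative t, so the bound holds for every real t and
  -- dominates everywhere on the product space used for Fubini.
  have hW' : ∀ t x, |expect Q f t x - c| ≤ Real.exp (-(r * max t 0)) * W x := by
    intro t x
    have h1 := hW (max t 0) (le_max_right t 0) x
    rwa [expect, max_eq_left (le_max_right t 0)] at h1
  have hmeas : Measurable (Function.uncurry fun t y => expect Q f t y - c) :=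
    (measurable_expect hQ hf).sub_const c
  have hprod : Integrable (Function.uncurry fun t y => expect Q f t y - c)
      ((volume.restrict (Set.Ioi 0)).prod (Q x)) :=
    (hexp'.mul_prod hWi).mono' hmeas.aestronglyMeasurable
      (Filter.Eventually.of_forall fun p => hW' p.1 p.2)
  have hint : Integrable (fun t => expect Q f t x - c) (volume.restrict (Set.Ioi 0)) :=
    (hexp'.mul_const (W x)).mono' (hmeas.comp measurable_prodMk_right).aestronglyMeasurable
      (Filter.Eventually.of_forall fun t => hW' t x)
  have hsub : ∀ t, ∫ y, (expect Q f t y - c) ∂Q x =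
      (∫ y, expect Q f t y ∂Q x) - (Q x).real Set.univ * c := by
    intro t
    rw [integral_sub (integrable_expect hQ hf hB0 hB t (Q x)) (integrable_const c)]
    simp
  have hder : ∀ t ∈ Set.Ioi (0 : ℝ), HasDerivAt (fun t => expect Q f t x - c)
      ((∫ y, (expect Q f t y - c) ∂Q x) - (Q x).real Set.univ * (expect Q f t x - c)) t := by
    intro t ht
    refine ((hasDerivAt_expect hQ hf hB x ht).sub_const c).congr_deriv ?_
    rw [hsub]; ring
  have hi1 : IntegrableOn (fun t => ∫ y, (expect Q f t y - c) ∂Q x) (Set.Ioi 0) :=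
    hprod.integral_prod_left
  have hlim : Filter.Tendsto (fun t => expect Q f t x - c) Filter.atTop (nhds 0) := by
    refine squeeze_zero_norm' (a := fun t => Real.exp (-(r * t)) * W x) ?_ ?_
    · filter_upwards [Filter.eventually_ge_atTop 0] with t ht using hW t ht x
    · have h1 : Filter.Tendsto (fun t => Real.exp (-(r * t))) Filter.atTop (nhds 0) :=
        Real.tendsto_exp_neg_atTop_nhds_zero.comp (Filter.tendsto_id.const_mul_atTop hr)
      simpa using h1.mul_const (W x)
  have hcont : Continuous fun t => expect Q f t x - c :=
    (continuous_expect hQ hf hB x).sub continuous_const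
  have h1 := integral_Ioi_of_hasDerivAt_of_tendsto hcont.continuousWithinAt hder
    (hi1.sub (hint.const_mul _)) hlim
  rw [integral_sub hi1 (hint.const_mul _), integral_const_mul,
    expect_zero hQ hf hB] at h1
  rw [← integral_integral_swap hprod, h1]
  ring

end SemigroupProperties

/-! ### The scalar birth-death chain: summability and detailed balance. -/

section BirthDeath

variable {a b β : ℝ}

lemma birthRate_pos (ha : 0 < a) (hb₀ : 0 ≤ b) (k : ℕ) : 0 < birthRate a b k := by
  unfold birthRate; positivity

lemma deathRate_zero : deathRate β 0 = 0 := by simp [deathRate]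

lemma deathRate_succ (k : ℕ) : deathRate β (k + 1) = (k + 1) * (1 + β * k) := by
  simp only [deathRate]; push_cast; ring

lemma deathRate_succ_pos (hβ : 0 ≤ β) (k : ℕ) : 0 < deathRate β (k + 1) := by
  rw [deathRate_succ]; positivity

lemma deathRate_nonneg (hβ : 0 ≤ β) (k : ℕ) : 0 ≤ deathRate β k := by
  cases k with
  | zero => exact deathRate_zero.ge
  | succ k => exact (deathRate_succ_pos hβ k).le

lemma pbdWeight_pos (ha : 0 < a) (hb₀ : 0 ≤ b) (hβ : 0 ≤ β) (k : ℕ) : 0 < pbdWeight a b β k :=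
  Finset.prod_pos fun i _ => div_pos (birthRate_pos ha hb₀ i) (deathRate_succ_pos hβ i)

lemma pbdWeight_succ_mul (hβ : 0 ≤ β) (k : ℕ) :
    pbdWeight a b β (k + 1) * deathRate β (k + 1) = pbdWeight a b β k * birthRate a b k := by
  have := (deathRate_succ_pos hβ k).ne'
  rw [pbdWeight, Finset.prod_range_succ, ← pbdWeight]
  field_simp

/-- Ratio test: consecutive terms have ratio at most (a + bk)(k + 2)/(k + 1)², which tends to b < 1.
The factor k + 1 yields a finite mean and integrable birth rates. -/
lemma summable_succ_mul_pbdWeight (ha : 0 < a) (hb₀ : 0 ≤ b) (hb₁ : b < 1) (hβ : 0 ≤ β) :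
    Summable fun k : ℕ => ((k : ℝ) + 1) * pbdWeight a b β k := by
  have hpos : ∀ k : ℕ, 0 < ((k : ℝ) + 1) * pbdWeight a b β k := fun k =>
    mul_pos (by positivity) (pbdWeight_pos ha hb₀ hβ k)
  refine summable_of_ratio_norm_eventually_le (r := (1 + b) / 2) (by linarith) ?_
  -- From here on k ≥ 1, so the lower-order part ak + 2a + 2bk is at most (3a + 2b)k ≤ (1 - b)k²/2,
  -- the gap between the leading terms bk² and (1 + b)k²/2.
  filter_upwards [Filter.eventually_ge_atTop (⌈(3 * a + 2 * b) / ((1 - b) / 2)⌉₊ + 1)] with k hk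
  rw [Real.norm_of_nonneg (hpos _).le, Real.norm_of_nonneg (hpos _).le]
  have hk1 : (1 : ℝ) ≤ k := by exact_mod_cast (Nat.le_add_left 1 _).trans hk
  have hk2 : 3 * a + 2 * b ≤ (1 - b) / 2 * k := by
    have h1 : (3 * a + 2 * b) / ((1 - b) / 2) ≤ k :=
      (Nat.le_ceil _).trans (by exact_mod_cast (Nat.le_add_right _ 1).trans hk)
    rw [div_le_iff₀ (by linarith)] at h1
    linarith
  have hw := pbdWeight_pos (β := β) ha hb₀ hβ k
  have hs := pbdWeight_succ_mul (a := a) (b := b) hβ k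
  have hs' : pbdWeight a b β (k + 1) * ((k + 1) * (1 + β * k)) =
      pbdWeight a b β k * (a + b * k) := by rw [← deathRate_succ, hs, birthRate]
  have hle : pbdWeight a b β (k + 1) * (k + 1) ≤ pbdWeight a b β k * (a + b * k) := by
    have hw' := pbdWeight_pos (β := β) ha hb₀ hβ (k + 1)
    have : 0 ≤ pbdWeight a b β (k + 1) * (k + 1) * (β * k) := by positivity
    nlinarith
  have hpoly : (a + b * k) * (k + 2) ≤ (1 + b) / 2 * ((k + 1) * (k + 1)) := by nlinarith
  push_cast
  have h3 : ((k : ℝ) + 1 + 1) * pbdWeight a b β (k + 1) * (k + 1) ≤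
      (1 + b) / 2 * ((k + 1) * pbdWeight a b β k) * (k + 1) := by
    calc ((k : ℝ) + 1 + 1) * pbdWeight a b β (k + 1) * (k + 1)
        = (pbdWeight a b β (k + 1) * (k + 1)) * (k + 2) := by ring
      _ ≤ (pbdWeight a b β k * (a + b * k)) * (k + 2) := by gcongr
      _ = pbdWeight a b β k * ((a + b * k) * (k + 2)) := by ring
      _ ≤ pbdWeight a b β k * ((1 + b) / 2 * ((k + 1) * (k + 1))) := by gcongr
      _ = _ := by ring
  exact le_of_mul_le_mul_right h3 (by positivity)

lemma summable_pbdWeight (ha : 0 < a) (hb₀ : 0 ≤ b) (hb₁ : b < 1) (hβ : 0 ≤ β) :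
    Summable (pbdWeight a b β) :=
  (summable_succ_mul_pbdWeight ha hb₀ hb₁ hβ).of_nonneg_of_le
    (fun k => (pbdWeight_pos ha hb₀ hβ k).le) fun k =>
      le_mul_of_one_le_left (pbdWeight_pos ha hb₀ hβ k).le (by linarith [Nat.cast_nonneg (α := ℝ) k])

lemma tsum_pbdWeight_pos (ha : 0 < a) (hb₀ : 0 ≤ b) (hb₁ : b < 1) (hβ : 0 ≤ β) :
    0 < ∑' j, pbdWeight a b β j :=
  (summable_pbdWeight ha hb₀ hb₁ hβ).tsum_pos (fun k => (pbdWeight_pos ha hb₀ hβ k).le) 0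
    (pbdWeight_pos ha hb₀ hβ 0)

/-- The point masses of the polynomial birth-death distribution. -/
def pbdMass (a b β : ℝ) (k : ℕ) : ℝ≥0∞ :=
  ENNReal.ofReal (pbdWeight a b β k / ∑' j, pbdWeight a b β j)

lemma lintegral_pbdDistribution (g : ℕ → ℝ≥0∞) :
    ∫⁻ k, g k ∂pbdDistribution a b β = ∑' k, pbdMass a b β k * g k := by
  rw [pbdDistribution, lintegral_sum_measure]
  refine tsum_congr fun k => ?_
  rw [lintegral_smul_measure, lintegral_dirac, smul_eq_mul, pbdMass]

lemma isProbabilityMeasure_pbdDistribution (ha : 0 < a) (hb₀ : 0 ≤ b) (hb₁ : b < 1) (hβ : 0 ≤ β) :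
    IsProbabilityMeasure (pbdDistribution a b β) := by
  have hZ := tsum_pbdWeight_pos (β := β) ha hb₀ hb₁ hβ
  refine ⟨?_⟩
  have h1 := lintegral_pbdDistribution (a := a) (b := b) (β := β) fun _ => 1
  simp only [lintegral_const, one_mul, mul_one, pbdMass] at h1
  rw [h1, ← ENNReal.ofReal_tsum_of_nonneg
    (fun k => div_nonneg (pbdWeight_pos ha hb₀ hβ k).le hZ.le)
    ((summable_pbdWeight ha hb₀ hb₁ hβ).div_const _), tsum_div_const, div_self hZ.ne',
    ENNReal.ofReal_one]

lemma pbdMass_mul_birthRate (ha : 0 < a) (hb₀ : 0 ≤ b) (hb₁ : b < 1) (hβ : 0 ≤ β) (k : ℕ) :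
    pbdMass a b β k * ENNReal.ofReal (birthRate a b k) =
      pbdMass a b β (k + 1) * ENNReal.ofReal (deathRate β (k + 1)) := by
  have hZ := tsum_pbdWeight_pos (β := β) ha hb₀ hb₁ hβ
  rw [pbdMass, pbdMass, ← ENNReal.ofReal_mul (div_nonneg (pbdWeight_pos ha hb₀ hβ k).le hZ.le),
    ← ENNReal.ofReal_mul (div_nonneg (pbdWeight_pos ha hb₀ hβ (k + 1)).le hZ.le),
    div_mul_eq_mul_div, div_mul_eq_mul_div, pbdWeight_succ_mul hβ]

/-- Detailed balance, summed against a function. -/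
lemma tsum_pbdMass_balance (ha : 0 < a) (hb₀ : 0 ≤ b) (hb₁ : b < 1) (hβ : 0 ≤ β) (G : ℕ → ℝ≥0∞) :
    ∑' k, pbdMass a b β k * (ENNReal.ofReal (birthRate a b k) * G (k + 1) +
        ENNReal.ofReal (deathRate β k) * G (k - 1)) =
      ∑' k, pbdMass a b β k *
        ((ENNReal.ofReal (birthRate a b k) + ENNReal.ofReal (deathRate β k)) * G k) := by
  simp only [mul_add, add_mul, ← mul_assoc]
  rw [ENNReal.tsum_add, ENNReal.tsum_add, add_comm]
  congr 1
  · rw [tsum_eq_zero_add' ENNReal.summable, deathRate_zero]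
    simp only [ENNReal.ofReal_zero, mul_zero, zero_mul, zero_add, Nat.add_sub_cancel,
      pbdMass_mul_birthRate ha hb₀ hb₁ hβ]
  · conv_rhs => rw [tsum_eq_zero_add' ENNReal.summable, deathRate_zero]
    simp only [ENNReal.ofReal_zero, mul_zero, zero_mul, zero_add,
      pbdMass_mul_birthRate ha hb₀ hb₁ hβ]

lemma tsum_pbdMass_mul_succ_ne_top (ha : 0 < a) (hb₀ : 0 ≤ b) (hb₁ : b < 1) (hβ : 0 ≤ β) :
    ∑' k : ℕ, pbdMass a b β k * ENNReal.ofReal ((k : ℝ) + 1) ≠ ∞ := by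
  have hZ := tsum_pbdWeight_pos (β := β) ha hb₀ hb₁ hβ
  have h1 : ∀ k : ℕ, pbdMass a b β k * ENNReal.ofReal ((k : ℝ) + 1) =
      ENNReal.ofReal (((k : ℝ) + 1) * pbdWeight a b β k / ∑' j, pbdWeight a b β j) := by
    intro k
    rw [pbdMass, ← ENNReal.ofReal_mul (div_nonneg (pbdWeight_pos ha hb₀ hβ k).le hZ.le)]
    congr 1; ring
  simp only [h1]
  exact ((summable_succ_mul_pbdWeight ha hb₀ hb₁ hβ).div_const _).tsum_ofReal_ne_top

/-- Death rates may grow quadratically, but detailed balance turns their sum into that of the birth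
rates, so a first moment suffices. -/
lemma tsum_pbdMass_mul_rate_ne_top (ha : 0 < a) (hb₀ : 0 ≤ b) (hb₁ : b < 1) (hβ : 0 ≤ β) :
    ∑' k, pbdMass a b β k *
      (ENNReal.ofReal (birthRate a b k) + ENNReal.ofReal (deathRate β k)) ≠ ∞ := by
  have h1 : ∑' k, pbdMass a b β k * ENNReal.ofReal (birthRate a b k) ≠ ∞ := by
    have hfin := ENNReal.mul_ne_top (ENNReal.ofReal_ne_top (r := a + b))
      (tsum_pbdMass_mul_succ_ne_top (β := β) ha hb₀ hb₁ hβ)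
    refine ne_top_of_le_ne_top hfin ?_
    rw [← ENNReal.tsum_mul_left]
    refine ENNReal.tsum_le_tsum fun k => ?_
    rw [mul_left_comm, ← ENNReal.ofReal_mul (by positivity)]
    gcongr
    rw [birthRate]
    nlinarith [mul_nonneg ha.le (Nat.cast_nonneg (α := ℝ) k)]
  simp only [mul_add]
  rw [ENNReal.tsum_add]
  refine ENNReal.add_ne_top.2 ⟨h1, ?_⟩
  rw [tsum_eq_zero_add' ENNReal.summable, deathRate_zero]
  simpa only [ENNReal.ofReal_zero, mul_zero, zero_add, ← pbdMass_mul_birthRate ha hb₀ hb₁ hβ]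
    using h1

lemma lintegral_bdRateKernel (g : ℕ → ℝ≥0∞) (k : ℕ) :
    ∫⁻ j, g j ∂bdRateKernel a b β k = ENNReal.ofReal (birthRate a b k) * g (k + 1) +
      ENNReal.ofReal (deathRate β k) * g (k - 1) := by
  rw [bdRateKernel, lintegral_add_measure, lintegral_smul_measure, lintegral_smul_measure,
    lintegral_dirac, lintegral_dirac, smul_eq_mul, smul_eq_mul]

lemma bdRateKernel_univ (k : ℕ) : bdRateKernel a b β k Set.univ =
    ENNReal.ofReal (birthRate a b k) + ENNReal.ofReal (deathRate β k) := by
  simp [bdRateKernel]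

lemma isInvariantDistribution_pbdDistribution (ha : 0 < a) (hb₀ : 0 ≤ b) (hb₁ : b < 1)
    (hβ : 0 ≤ β) : IsInvariantDistribution a b β (pbdDistribution a b β) := by
  have hp := isProbabilityMeasure_pbdDistribution ha hb₀ hb₁ hβ
  refine ⟨hp, fun t ht => ?_⟩
  have hfin : ∀ k, IsFiniteMeasure (bdRateKernel a b β k) := fun k =>
    ⟨by rw [bdRateKernel_univ]; exact ENNReal.add_lt_top.2 ⟨ENNReal.ofReal_lt_top, ENNReal.ofReal_lt_top⟩⟩
  refine bind_jumpLaw_of_balance (Q := bdRateKernel a b β) measurable_from_top ?_ ?_ ht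
  · simp only [lintegral_pbdDistribution, bdRateKernel_univ]
    exact tsum_pbdMass_mul_rate_ne_top ha hb₀ hb₁ hβ
  · intro g _
    simp only [lintegral_pbdDistribution, bdRateKernel_univ, lintegral_bdRateKernel]
    exact tsum_pbdMass_balance ha hb₀ hb₁ hβ g

end BirthDeath

/-! ### The measurable structure of configurations. -/

section Sequences

variable {Γ : Type*}

/-- The configuration formed by the first `n` terms of a sequence. -/
def ofSeq (p : ℕ × (ℕ → Γ)) : Config Γ := (Finset.range p.1).val.map p.2

lemma surjective_ofSeq [Nonempty Γ] : Function.Surjective (ofSeq (Γ := Γ)) := by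
  intro ξ
  induction ξ using Quotient.inductionOn with
  | _ l =>
    refine ⟨(l.length, fun i => l.getD i (Classical.arbitrary Γ)), ?_⟩
    change (((List.range l.length).map fun i => l.getD i (Classical.arbitrary Γ) : List Γ) :
      Multiset Γ) = (l : Multiset Γ)
    congr 1
    refine List.ext_getElem (by simp) fun i h1 h2 => ?_
    simp [List.getElem?_eq_getElem h2]

end Sequences

section ConfigMeasurable

variable {Γ : Type*} [MeasurableSpace Γ]

lemma toMeasure_cons (x : Γ) (ξ : Config Γ) :
    Config.toMeasure (x ::ₘ ξ) = Measure.dirac x + Config.toMeasure ξ := by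
  simp [Config.toMeasure]

lemma toMeasure_zero : Config.toMeasure (0 : Config Γ) = 0 := by simp [Config.toMeasure]

lemma toMeasure_univ (ξ : Config Γ) : Config.toMeasure ξ Set.univ = ξ.card := by
  induction ξ using Multiset.induction with
  | empty => simp [toMeasure_zero]
  | cons x ξ ih => rw [toMeasure_cons, Measure.add_apply, ih]; simp [add_comm]

lemma toMeasure_map {ι : Type*} (s : Finset ι) (u : ι → Γ) {C : Set Γ} (hC : MeasurableSet C) :
    Config.toMeasure (s.val.map u) C = ∑ i ∈ s, C.indicator 1 (u i) := by
  classical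
  induction s using Finset.induction with
  | empty => simp [toMeasure_zero]
  | insert i s hi ih =>
    rw [Finset.insert_val_of_notMem hi, Multiset.map_cons, toMeasure_cons, Measure.add_apply, ih,
      Finset.sum_insert hi, Measure.dirac_apply' _ hC]

lemma measurable_toMeasure {C : Set Γ} (hC : MeasurableSet C) :
    Measurable fun ξ : Config Γ => Config.toMeasure ξ C := by
  refine Measurable.of_comap_le ?_
  exact le_iSup₂_of_le C hC le_rfl

lemma measurable_config_iff {T : Type*} [MeasurableSpace T] {F : T → Config Γ} :
    Measurable F ↔ ∀ C : Set Γ, MeasurableSet C → Measurable fun τ => Config.toMeasure (F τ) C := by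
  refine ⟨fun h C hC => (measurable_toMeasure hC).comp h, fun h => ?_⟩
  refine Measurable.of_le_map ?_
  refine iSup₂_le fun C hC => ?_
  rw [MeasurableSpace.comap_le_iff_le_map]
  exact h C hC

lemma measurable_cons : Measurable fun p : Γ × Config Γ => p.1 ::ₘ p.2 := by
  refine measurable_config_iff.2 fun C hC => ?_
  simp only [toMeasure_cons, Measure.add_apply, Measure.dirac_apply' _ hC]
  exact ((measurable_one.indicator hC).comp measurable_fst).add
    ((measurable_toMeasure hC).comp measurable_snd)

lemma measurable_map_finset {ι : Type*} (s : Finset ι) :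
    Measurable fun u : ι → Γ => (s.val.map u : Config Γ) := by
  refine measurable_config_iff.2 fun C hC => ?_
  simp only [toMeasure_map s _ hC]
  exact Finset.measurable_fun_sum s fun i _ =>
    (measurable_one.indicator hC).comp (measurable_pi_apply i)

lemma measurable_card : Measurable fun ξ : Config Γ => ξ.card := by
  have h := measurable_toMeasure (Γ := Γ) MeasurableSet.univ
  simp only [toMeasure_univ] at h
  have h2 : (fun ξ : Config Γ => ξ.card) = fun ξ : Config Γ => ⌊((ξ.card : ℝ≥0∞)).toReal⌋₊ := by
    funext ξ; simp
  rw [h2]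
  exact h.ennreal_toReal.nat_floor

lemma measurable_ofSeq : Measurable (ofSeq (Γ := Γ)) :=
  measurable_from_prod_countable_right fun n => measurable_map_finset (Finset.range n)

variable [TopologicalSpace Γ] [T1Space Γ] [SecondCountableTopology Γ] [BorelSpace Γ]

/-- Finitely many points are separated by the members of a countable base. -/
instance countablySeparated_config : MeasurableSpace.CountablySeparated (Config Γ) := by
  classical
  refine MeasurableSpace.countablySeparated_def.2 ⟨?_⟩
  refine ⟨Set.range fun p : TopologicalSpace.countableBasis Γ × ℕ =>
    {ξ : Config Γ | Config.toMeasure ξ p.1.1 = p.2}, Set.countable_range _, ?_, ?_⟩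
  · rintro _ ⟨⟨U, k⟩, rfl⟩
    have hU : MeasurableSet U.1 :=
      ((TopologicalSpace.isBasis_countableBasis Γ).isOpen U.2).measurableSet
    exact measurable_toMeasure hU (measurableSet_singleton _)
  · intro ξ _ η _ h
    by_contra hne
    obtain ⟨x, hx⟩ : ∃ x, ξ.count x ≠ η.count x := by
      by_contra! hall
      exact hne (Multiset.ext.2 hall)
    -- The finitely many points of the two configurations other than x. A basic open set around x
    -- that avoids them has as mass exactly the multiplicity of x.
    set F : Set Γ := {y | y ∈ (ξ + η).toFinset.erase x} with hF
    have hFo : IsOpen Fᶜ := (Finset.finite_toSet _).isClosed.isOpen_compl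
    have hxF : x ∈ Fᶜ := by simp [hF]
    obtain ⟨U, hU, hxU, hUF⟩ :=
      (TopologicalSpace.isBasis_countableBasis Γ).exists_subset_of_mem_open hxF hFo
    have hUm : MeasurableSet U :=
      ((TopologicalSpace.isBasis_countableBasis Γ).isOpen hU).measurableSet
    have hcount : ∀ ζ : Config Γ, (∀ y ∈ ζ, y ∈ U → y = x) →
        Config.toMeasure ζ U = (ζ.count x : ℕ) := by
      intro ζ
      induction ζ using Multiset.induction with
      | empty => simp [toMeasure_zero]
      | cons y ζ ih =>
        intro hζ
        rw [toMeasure_cons, Measure.add_apply, ih fun z hz => hζ z (Multiset.mem_cons_of_mem hz),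
          Measure.dirac_apply' _ hUm, Multiset.count_cons]
        by_cases hy : y ∈ U
        · have := hζ y (Multiset.mem_cons_self _ _) hy
          subst this
          simp [hy, add_comm]
        · have : x ≠ y := fun h => hy (h ▸ hxU)
          simp [hy, this]
    have hmem : ∀ y ∈ ξ + η, y ∈ U → y = x := by
      intro y hy hyU
      by_contra hyx
      exact hUF hyU (Finset.mem_erase.2 ⟨hyx, Multiset.mem_toFinset.2 hy⟩)
    have h1 := hcount ξ fun y hy => hmem y (Multiset.mem_add.2 (Or.inl hy))
    have h2 := hcount η fun y hy => hmem y (Multiset.mem_add.2 (Or.inr hy))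
    have h3 := (h _ ⟨(⟨U, hU⟩, ξ.count x), rfl⟩).1 h1
    have h4 : (η.count x : ℝ≥0∞) = ξ.count x := h2.symm.trans h3
    exact hx (by exact_mod_cast h4.symm)

end ConfigMeasurable

section ConfigPolish

variable {Γ : Type*} [MetricSpace Γ] [CompactSpace Γ] [MeasurableSpace Γ] [BorelSpace Γ]

/-- Measurability on configurations may be tested on finite sequences of points. -/
lemma measurable_of_comp_ofSeq [Nonempty Γ] {α : Type*} [MeasurableSpace α] {g : Config Γ → α}
    (h : ∀ n, Measurable fun u : ℕ → Γ => g ((Finset.range n).val.map u)) : Measurable g :=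
  -- The source is standard Borel and the target countably separated: a set with Borel preimage and
  -- its complement are both analytic, so the set is measurable by Lusin separation.
  (Measurable.measurable_comp_iff_of_surjective measurable_ofSeq surjective_ofSeq).1
    (measurable_from_prod_countable_right h)

end ConfigPolish

section SumDirac

variable {ι S : Type*} [MeasurableSpace S]

lemma lintegral_sum_dirac (s : Multiset ι) (φ : ι → S) {g : S → ℝ≥0∞} (hg : Measurable g) :
    ∫⁻ y, g y ∂(s.map fun i => Measure.dirac (φ i)).sum = (s.map fun i => g (φ i)).sum := by
  induction s using Multiset.induction with
  | empty => simp
  | cons i s ih => simp [lintegral_add_measure, ih, lintegral_dirac' _ hg]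

lemma integrable_sum_dirac (s : Multiset ι) (φ : ι → S) {g : S → ℝ} (hg : Measurable g) :
    Integrable g (s.map fun i => Measure.dirac (φ i)).sum := by
  induction s using Multiset.induction with
  | empty => simp
  | cons i s ih =>
    simp only [Multiset.map_cons, Multiset.sum_cons]
    exact (integrable_dirac' hg.stronglyMeasurable (by simp)).add_measure ih

lemma integral_sum_dirac (s : Multiset ι) (φ : ι → S) {g : S → ℝ} (hg : Measurable g) :
    ∫ y, g y ∂(s.map fun i => Measure.dirac (φ i)).sum = (s.map fun i => g (φ i)).sum := by
  induction s using Multiset.induction with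
  | empty => simp
  | cons i s ih =>
    simp only [Multiset.map_cons, Multiset.sum_cons]
    rw [integral_add_measure (integrable_dirac' hg.stronglyMeasurable (by simp))
      (integrable_sum_dirac s φ hg), ih, integral_dirac' _ _ hg.stronglyMeasurable]

lemma multiset_abs_sum_le (s : Multiset ι) {φ : ι → ℝ} {D : ℝ} (h : ∀ i ∈ s, |φ i| ≤ D) :
    |(s.map φ).sum| ≤ s.card * D := by
  induction s using Multiset.induction with
  | empty => simp
  | cons i s ih =>
    simp only [Multiset.map_cons, Multiset.sum_cons, Multiset.card_cons]
    refine (abs_add_le _ _).trans ?_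
    have h1 := h i (Multiset.mem_cons_self _ _)
    have h2 := ih fun j hj => h j (Multiset.mem_cons_of_mem hj)
    push_cast
    linarith

end SumDirac

/-! ### Test functions: transport bounds, boundedness, measurability. -/

section TestFunctions

variable {Γ : Type*} [MetricSpace Γ] [MeasurableSpace Γ] [BorelSpace Γ]

lemma d₁_le {ξ η : Config Γ} (hc : ξ.card = η.card) (h0 : ξ.card ≠ 0) {D : ℝ}
    (hD : ∀ u : Γ → ℝ, LipschitzWith 1 u → |(ξ.map u).sum - (η.map u).sum| ≤ D) :
    d₁ (Config.toMeasure ξ) (Config.toMeasure η) ≤ D / ξ.card := by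
  have hint : ∀ (ζ : Config Γ) (u : Γ → ℝ), LipschitzWith 1 u →
      ∫ x, u x ∂Config.toMeasure ζ = (ζ.map u).sum := fun ζ u hu =>
    integral_sum_dirac ζ id hu.continuous.measurable
  rw [d₁, if_pos (by rw [toMeasure_univ, toMeasure_univ, hc]),
    if_neg (by rw [toMeasure_univ]; exact_mod_cast h0), measureReal_def, toMeasure_univ,
    ENNReal.toReal_natCast, div_eq_inv_mul]
  refine mul_le_mul_of_nonneg_left ?_ (by positivity)
  have : Nonempty {u : Γ → ℝ // LipschitzWith 1 u} := ⟨⟨fun _ => 0, LipschitzWith.const' 0⟩⟩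
  refine ciSup_le fun u => ?_
  rw [hint ξ _ u.2, hint η _ u.2]
  exact hD u.1 u.2

/-- Matching equal indices is one admissible transport; it need not be optimal. -/
lemma d₁_map_le {ι : Type*} (s : Finset ι) (hs : s.card ≠ 0) (u v : ι → Γ) :
    d₁ (Config.toMeasure (s.val.map u)) (Config.toMeasure (s.val.map v)) ≤
      (∑ i ∈ s, dist (u i) (v i)) / s.card := by
  have h1 : Multiset.card (s.val.map u) = s.card := by simp
  have h2 : Multiset.card (s.val.map v) = s.card := by simp
  rw [← h1]
  refine d₁_le (by rw [h1, h2]) (by rwa [h1]) fun φ hφ => ?_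
  rw [Multiset.map_map, Multiset.map_map]
  change |∑ i ∈ s, φ (u i) - ∑ i ∈ s, φ (v i)| ≤ _
  rw [← Finset.sum_sub_distrib]
  refine (Finset.abs_sum_le_sum_abs _ _).trans (Finset.sum_le_sum fun i _ => ?_)
  simpa [Real.dist_eq] using hφ.dist_le_mul (u i) (v i)

lemma testFunctions_cons_cons (hΓ : ∀ x y : Γ, dist x y ≤ 1) {f : Config Γ → ℝ}
    (hf : f ∈ testFunctions Γ) (ξ : Config Γ) (x y : Γ) :
    |f (x ::ₘ ξ) - f (y ::ₘ ξ)| ≤ 1 / ((ξ.card : ℝ) + 1) := by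
  refine (hf _ _).trans ?_
  have h1 := d₁_le (ξ := x ::ₘ ξ) (η := y ::ₘ ξ) (by simp) (by simp) (D := 1) fun u hu => by
    simp only [Multiset.map_cons, Multiset.sum_cons, add_sub_add_right_eq_sub]
    have := hu.dist_le_mul x y
    rw [Real.dist_eq, NNReal.coe_one, one_mul] at this
    exact this.trans (hΓ x y)
  simpa using h1

lemma testFunctions_sub_le_one (hΓ : ∀ x y : Γ, dist x y ≤ 1) {f : Config Γ → ℝ}
    (hf : f ∈ testFunctions Γ) (ξ η : Config Γ) : |f ξ - f η| ≤ 1 := by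
  refine (hf _ _).trans ?_
  by_cases hc : ξ.card = η.card
  · by_cases h0 : ξ.card = 0
    · rw [d₁, if_pos (by rw [toMeasure_univ, toMeasure_univ, hc]),
        if_pos (by rw [toMeasure_univ, h0]; simp)]
      exact zero_le_one
    · have hne : Nonempty Γ := by
        obtain ⟨x, _⟩ := Multiset.card_pos_iff_exists_mem.1 (Nat.pos_of_ne_zero h0)
        exact ⟨x⟩
      obtain ⟨⟨n, u⟩, rfl⟩ := surjective_ofSeq ξ
      obtain ⟨⟨m, v⟩, rfl⟩ := surjective_ofSeq η
      have hnm : n = m := by simpa [ofSeq] using hc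
      subst hnm
      have hn : n ≠ 0 := by simpa [ofSeq] using h0
      refine (d₁_map_le (Finset.range n) (by simpa using hn) u v).trans ?_
      refine div_le_one_of_le₀ ?_ (by positivity)
      refine (Finset.sum_le_sum fun i _ => hΓ (u i) (v i)).trans ?_
      simp
  · rw [d₁, if_neg]
    rw [toMeasure_univ, toMeasure_univ]
    exact_mod_cast hc

/-- Test functions are not assumed measurable. Being d₁-Lipschitz they are continuous in the points
listed as a sequence, and this descends to the σ-algebra on configurations. -/
lemma measurable_testFunction [CompactSpace Γ] [Nonempty Γ] {f : Config Γ → ℝ}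
    (hf : f ∈ testFunctions Γ) : Measurable f := by
  refine measurable_of_comp_ofSeq fun n => Continuous.measurable ?_
  rcases Nat.eq_zero_or_pos n with rfl | hn
  · simpa using continuous_const
  refine continuous_iff_continuousAt.2 fun u => ?_
  rw [ContinuousAt, tendsto_iff_dist_tendsto_zero]
  refine squeeze_zero (g := fun v : ℕ → Γ =>
    (∑ i ∈ Finset.range n, dist (v i) (u i)) / (Finset.range n).card) (fun _ => dist_nonneg)
    (fun v => ?_) ?_
  · rw [Real.dist_eq]
    exact (hf _ _).trans (d₁_map_le (Finset.range n) (by simpa using hn.ne') v u)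
  · have hc : Continuous fun v : ℕ → Γ =>
      (∑ i ∈ Finset.range n, dist (v i) (u i)) / ((Finset.range n).card : ℝ) := by fun_prop
    simpa using hc.tendsto u

end TestFunctions

/-! ### The rate kernel of the birth-death system. -/

section ConfigAlgebra

open Classical

variable {Γ : Type*} {β : ℝ}

lemma one_add_mul_card_sub_one_nonneg (hβ : 0 ≤ β) {ξ : Config Γ} (h : ξ ≠ 0) :
    0 ≤ 1 + β * ((ξ.card : ℝ) - 1) := by
  have h1 : 1 ≤ ξ.card := Nat.one_le_iff_ne_zero.2 (by simpa using h)
  have h2 : (1 : ℝ) ≤ ξ.card := by exact_mod_cast h1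
  have := mul_nonneg hβ (sub_nonneg.2 h2)
  linarith

/-- For the empty configuration 1 - β may be negative and gets clipped, which the factor 0 makes
harmless. -/
lemma ofReal_mul_card_eq_deathRate (ξ : Config Γ) :
    ENNReal.ofReal (1 + β * ((ξ.card : ℝ) - 1)) * ξ.card = ENNReal.ofReal (deathRate β ξ.card) := by
  rw [← ENNReal.ofReal_natCast, ← ENNReal.ofReal_mul' (by positivity), deathRate]
  congr 1; ring

/-- Configurations forget order, so removing a value amounts to dropping an index. In this form
removal is visibly measurable in the points. -/
lemma map_erase_eq {ι : Type*} [DecidableEq ι] (s : Finset ι) (u : ι → Γ) {i : ι} (hi : i ∈ s) :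
    (s.val.map u).erase (u i) = (s.erase i).val.map u := by
  rw [← Finset.insert_erase hi, Finset.insert_val_of_notMem (Finset.notMem_erase i s),
    Multiset.map_cons, Multiset.erase_cons_head, Finset.erase_insert (Finset.notMem_erase i s)]

end ConfigAlgebra

section System

open Classical

variable {Γ : Type*} [MeasurableSpace Γ] {μ : Measure Γ} {a b β : ℝ}

lemma measurable_cons_left (ξ : Config Γ) : Measurable fun x : Γ => x ::ₘ ξ :=
  measurable_cons.comp (f := fun x : Γ => (x, ξ)) measurable_prodMk_right

lemma lintegral_systemRateKernel {g : Config Γ → ℝ≥0∞} (hg : Measurable g) (ξ : Config Γ) :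
    ∫⁻ η, g η ∂systemRateKernel a b β μ ξ =
      ENNReal.ofReal (a + b * ξ.card) * ∫⁻ x, g (x ::ₘ ξ) ∂μ +
        ENNReal.ofReal (1 + β * ((ξ.card : ℝ) - 1)) * (ξ.map fun x => g (ξ.erase x)).sum := by
  rw [systemRateKernel, lintegral_add_measure, lintegral_smul_measure, lintegral_smul_measure,
    lintegral_map hg (measurable_cons_left ξ), lintegral_sum_dirac ξ (fun x => ξ.erase x) hg,
    smul_eq_mul, smul_eq_mul]

lemma integrable_systemRateKernel {g : Config Γ → ℝ} (hg : Measurable g) {ξ : Config Γ}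
    (hi : Integrable (fun x => g (x ::ₘ ξ)) μ) : Integrable g (systemRateKernel a b β μ ξ) := by
  refine Integrable.add_measure (Integrable.smul_measure ?_ ENNReal.ofReal_ne_top)
    ((integrable_sum_dirac ξ (fun x => ξ.erase x) hg).smul_measure ENNReal.ofReal_ne_top)
  exact (integrable_map_measure hg.aestronglyMeasurable (measurable_cons_left ξ).aemeasurable).2 hi

lemma integral_systemRateKernel (ha : 0 < a) (hb₀ : 0 ≤ b) (hβ : 0 ≤ β) {g : Config Γ → ℝ}
    (hg : Measurable g) {ξ : Config Γ} (hi : Integrable (fun x => g (x ::ₘ ξ)) μ) :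
    ∫ η, g η ∂systemRateKernel a b β μ ξ = (a + b * ξ.card) * ∫ x, g (x ::ₘ ξ) ∂μ +
      (1 + β * ((ξ.card : ℝ) - 1)) * (ξ.map fun x => g (ξ.erase x)).sum := by
  have h1 : Integrable g (μ.map fun x => x ::ₘ ξ) :=
    (integrable_map_measure hg.aestronglyMeasurable (measurable_cons_left ξ).aemeasurable).2 hi
  rw [systemRateKernel, integral_add_measure (h1.smul_measure ENNReal.ofReal_ne_top)
    ((integrable_sum_dirac ξ (fun x => ξ.erase x) hg).smul_measure ENNReal.ofReal_ne_top),
    integral_smul_measure, integral_smul_measure,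
    integral_map (measurable_cons_left ξ).aemeasurable hg.aestronglyMeasurable,
    integral_sum_dirac ξ (fun x => ξ.erase x) hg, smul_eq_mul, smul_eq_mul,
    ENNReal.toReal_ofReal (by positivity)]
  congr 1
  rcases eq_or_ne ξ 0 with rfl | h
  · simp
  · rw [ENNReal.toReal_ofReal (one_add_mul_card_sub_one_nonneg hβ h)]

lemma systemRateKernel_univ [IsProbabilityMeasure μ] (ξ : Config Γ) :
    systemRateKernel a b β μ ξ Set.univ =
      ENNReal.ofReal (birthRate a b ξ.card) + ENNReal.ofReal (deathRate β ξ.card) := by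
  have h := lintegral_systemRateKernel (a := a) (b := b) (β := β) (μ := μ)
    (g := fun _ => 1) measurable_const ξ
  simp only [lintegral_const, one_mul, measure_univ, mul_one, Multiset.map_const',
    Multiset.sum_replicate, nsmul_eq_mul] at h
  rw [h, ofReal_mul_card_eq_deathRate, birthRate]

instance isFiniteMeasure_systemRateKernel [IsProbabilityMeasure μ] (ξ : Config Γ) :
    IsFiniteMeasure (systemRateKernel a b β μ ξ) :=
  ⟨by rw [systemRateKernel_univ]
      exact ENNReal.add_lt_top.2 ⟨ENNReal.ofReal_lt_top, ENNReal.ofReal_lt_top⟩⟩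

lemma systemRateKernel_real_univ [IsProbabilityMeasure μ] (ha : 0 < a) (hb₀ : 0 ≤ b) (hβ : 0 ≤ β)
    (ξ : Config Γ) : (systemRateKernel a b β μ ξ).real Set.univ =
      birthRate a b ξ.card + deathRate β ξ.card := by
  rw [measureReal_def, systemRateKernel_univ, ENNReal.toReal_add ENNReal.ofReal_ne_top
    ENNReal.ofReal_ne_top, ENNReal.toReal_ofReal (birthRate_pos ha hb₀ _).le,
    ENNReal.toReal_ofReal (deathRate_nonneg hβ _)]

end System

section SystemMeasurable

open Classical

variable {Γ : Type*} [MetricSpace Γ] [CompactSpace Γ] [MeasurableSpace Γ] [BorelSpace Γ]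
  {μ : Measure Γ} [IsProbabilityMeasure μ] {a b β : ℝ}

lemma measurable_systemRateKernel : Measurable (systemRateKernel a b β μ) := by
  have : Nonempty Γ := nonempty_of_isProbabilityMeasure μ
  refine measurable_of_comp_ofSeq fun n => Measure.measurable_of_measurable_coe _ fun A hA => ?_
  have hgm : Measurable (A.indicator (1 : Config Γ → ℝ≥0∞)) := measurable_one.indicator hA
  have h1 : ∀ ξ : Config Γ, systemRateKernel a b β μ ξ A =
      ∫⁻ η, A.indicator 1 η ∂systemRateKernel a b β μ ξ := fun ξ =>
    (lintegral_indicator_one hA).symm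
  simp only [h1, lintegral_systemRateKernel hgm, Multiset.card_map, Finset.card_val,
    Finset.card_range, Multiset.map_map, Function.comp_def]
  refine (Measurable.const_mul ?_ _).add (Measurable.const_mul ?_ _)
  · refine Measurable.lintegral_prod_right' (f := fun p : (ℕ → Γ) × Γ =>
      A.indicator 1 (p.2 ::ₘ (Finset.range n).val.map p.1)) (hgm.comp ?_)
    exact measurable_cons.comp (f := fun p : (ℕ → Γ) × Γ => (p.2, (Finset.range n).val.map p.1))
      (measurable_snd.prodMk ((measurable_map_finset (Finset.range n)).comp measurable_fst))
  · have h2 : (fun u : ℕ → Γ => ((Finset.range n).val.map fun i =>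
        A.indicator (1 : Config Γ → ℝ≥0∞) (((Finset.range n).val.map u).erase (u i))).sum) =
        fun u : ℕ → Γ => ∑ i ∈ Finset.range n,
          A.indicator (1 : Config Γ → ℝ≥0∞) (((Finset.range n).erase i).val.map u) := by
      funext u
      refine Finset.sum_congr rfl fun i hi => ?_
      rw [map_erase_eq _ u hi]
    rw [h2]
    exact Finset.measurable_fun_sum _ fun i _ => hgm.comp (measurable_map_finset _)

end SystemMeasurable

/-! ### Invariance of the point process law. -/

lemma univ_map_succAbove {Γ : Type*} {n : ℕ} (i : Fin (n + 1)) (v : Fin (n + 1) → Γ) :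
    (Finset.univ.val.map v : Config Γ) =
      v i ::ₘ Finset.univ.val.map fun j => v (i.succAbove j) := by
  rw [Fin.univ_succAbove n i]
  simp [Finset.map_val, Function.comp_def]

section PointLaw

open Classical

variable {Γ : Type*} [MeasurableSpace Γ] {μ : Measure Γ} {a b β : ℝ}

/-- The expectation of `g` over `n` independent `μ`-distributed points. -/
def iidMean (μ : Measure Γ) (g : Config Γ → ℝ≥0∞) (n : ℕ) : ℝ≥0∞ :=
  ∫⁻ u, g (Finset.univ.val.map u) ∂Measure.pi fun _ : Fin n => μ

lemma lintegral_pbdPointLaw {g : Config Γ → ℝ≥0∞} (hg : Measurable g) :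
    ∫⁻ ξ, g ξ ∂pbdPointLaw a b β μ = ∑' n, pbdMass a b β n * iidMean μ g n := by
  rw [pbdPointLaw, Measure.lintegral_bind measurable_from_top.aemeasurable hg.aemeasurable,
    lintegral_pbdDistribution]
  refine tsum_congr fun n => ?_
  rw [lintegral_map hg (measurable_map_finset _), iidMean]

lemma iidMean_of_card (F : ℕ → ℝ≥0∞) {g : Config Γ → ℝ≥0∞} (hg : Measurable g) (n : ℕ) :
    iidMean μ (fun ξ => F ξ.card * g ξ) n = F n * iidMean μ g n := by
  have hm : Measurable fun u : Fin n → Γ => g (Finset.univ.val.map u) :=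
    hg.comp (measurable_map_finset Finset.univ)
  simp only [iidMean, Multiset.card_map, Finset.card_val, Finset.card_univ, Fintype.card_fin]
  exact lintegral_const_mul _ hm

variable [IsProbabilityMeasure μ]

lemma isProbabilityMeasure_pbdPointLaw (ha : 0 < a) (hb₀ : 0 ≤ b) (hb₁ : b < 1) (hβ : 0 ≤ β) :
    IsProbabilityMeasure (pbdPointLaw a b β μ) := by
  have hp := isProbabilityMeasure_pbdDistribution ha hb₀ hb₁ hβ
  refine ⟨?_⟩
  have h := lintegral_pbdPointLaw (μ := μ) (a := a) (b := b) (β := β) (g := fun _ => 1)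
    measurable_const
  have h2 := lintegral_pbdDistribution (a := a) (b := b) (β := β) fun _ => 1
  simp only [iidMean, lintegral_const, one_mul, measure_univ, mul_one] at h h2
  rw [h, ← h2]

lemma lintegral_pi_succAbove {n : ℕ} (i : Fin (n + 1)) {F : Γ × (Fin n → Γ) → ℝ≥0∞}
    (hF : Measurable F) :
    ∫⁻ v, F (v i, fun j => v (i.succAbove j)) ∂Measure.pi (fun _ : Fin (n + 1) => μ) =
      ∫⁻ p, F p ∂μ.prod (Measure.pi fun _ : Fin n => μ) :=
  (measurePreserving_piFinSuccAbove (fun _ : Fin (n + 1) => μ) i).lintegral_comp hF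

lemma iidMean_cons {g : Config Γ → ℝ≥0∞} (hg : Measurable g) (n : ℕ) :
    ∫⁻ u, ∫⁻ x, g (x ::ₘ Finset.univ.val.map u) ∂μ ∂(Measure.pi fun _ : Fin n => μ) =
      iidMean μ g (n + 1) := by
  have hm : Measurable fun p : Γ × (Fin n → Γ) => g (p.1 ::ₘ Finset.univ.val.map p.2) :=
    hg.comp (measurable_cons.comp (f := fun p : Γ × (Fin n → Γ) =>
      (p.1, Finset.univ.val.map p.2))
      (measurable_fst.prodMk ((measurable_map_finset Finset.univ).comp measurable_snd)))
  rw [iidMean]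
  simp only [univ_map_succAbove (0 : Fin (n + 1))]
  rw [lintegral_pi_succAbove 0 (F := fun p => g (p.1 ::ₘ Finset.univ.val.map p.2)) hm,
    lintegral_prod_symm' _ hm]

/-- Dropping any one of n i.i.d. points leaves n - 1 i.i.d. points. The truncated `0 - 1` carries
the factor 0. -/
lemma iidMean_erase {g : Config Γ → ℝ≥0∞} (hg : Measurable g) (n : ℕ) :
    ∫⁻ u, ((Finset.univ.val.map u).map fun x => g ((Finset.univ.val.map u).erase x)).sum
      ∂(Measure.pi fun _ : Fin n => μ) = n * iidMean μ g (n - 1) := by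
  cases n with
  | zero => simp
  | succ n =>
    have h1 : ∀ u : Fin (n + 1) → Γ,
        ((Finset.univ.val.map u).map fun x => g ((Finset.univ.val.map u).erase x)).sum =
        ∑ i : Fin (n + 1), g (Finset.univ.val.map fun j => u (i.succAbove j)) := by
      intro u
      rw [Multiset.map_map]
      refine Finset.sum_congr rfl fun i _ => ?_
      simp only [Function.comp_apply]
      rw [univ_map_succAbove i u, Multiset.erase_cons_head]
    have hm : Measurable fun p : Γ × (Fin n → Γ) => g (Finset.univ.val.map p.2) :=
      hg.comp ((measurable_map_finset Finset.univ).comp measurable_snd)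
    simp only [h1]
    rw [lintegral_finsetSum]
    · have h2 : ∀ i : Fin (n + 1), ∫⁻ u, g (Finset.univ.val.map fun j => u (i.succAbove j))
          ∂(Measure.pi fun _ : Fin (n + 1) => μ) = iidMean μ g n := by
        intro i
        rw [lintegral_pi_succAbove i (F := fun p => g (Finset.univ.val.map p.2)) hm,
          lintegral_prod _ hm.aemeasurable]
        simp [iidMean]
      simp only [h2]
      simp
    · intro i _
      exact hg.comp ((measurable_map_finset Finset.univ).comp
        (f := fun (u : Fin (n + 1) → Γ) (j : Fin n) => u (i.succAbove j))
        (measurable_pi_lambda _ fun j => measurable_pi_apply _))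

/-- Averaging over i.i.d. positions collapses the spatial kernel to the scalar chain, so that
`tsum_pbdMass_balance` applies to the system. -/
lemma lintegral_systemRateKernel_iid {g : Config Γ → ℝ≥0∞} (hg : Measurable g) (n : ℕ) :
    iidMean μ (fun ξ => ∫⁻ η, g η ∂systemRateKernel a b β μ ξ) n =
      ENNReal.ofReal (birthRate a b n) * iidMean μ g (n + 1) +
        ENNReal.ofReal (deathRate β n) * iidMean μ g (n - 1) := by
  have hm : Measurable fun p : (Fin n → Γ) × Γ => g (p.2 ::ₘ Finset.univ.val.map p.1) :=
    hg.comp (measurable_cons.comp (f := fun p : (Fin n → Γ) × Γ =>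
      (p.2, Finset.univ.val.map p.1))
      (measurable_snd.prodMk ((measurable_map_finset Finset.univ).comp measurable_fst)))
  have hcard : ∀ u : Fin n → Γ, Multiset.card (Finset.univ.val.map u) = n := fun u => by simp
  rw [iidMean]
  simp only [lintegral_systemRateKernel hg, hcard]
  have hm1 : Measurable fun u : Fin n → Γ =>
      ∫⁻ x, g (x ::ₘ Finset.univ.val.map u) ∂μ := hm.lintegral_prod_right'
  rw [lintegral_add_left (hm1.const_mul _), lintegral_const_mul _ hm1,
    lintegral_const_mul' _ _ ENNReal.ofReal_ne_top, iidMean_cons hg, iidMean_erase hg, ← mul_assoc]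
  congr 2
  rw [← ENNReal.ofReal_natCast, ← ENNReal.ofReal_mul' (by positivity), deathRate]
  congr 1; ring

lemma integrable_card_pbdPointLaw (ha : 0 < a) (hb₀ : 0 ≤ b) (hb₁ : b < 1) (hβ : 0 ≤ β) :
    Integrable (fun ξ : Config Γ => (ξ.card : ℝ)) (pbdPointLaw a b β μ) := by
  have hm : Measurable fun ξ : Config Γ => (ξ.card : ℝ≥0∞) := measurable_from_top.comp measurable_card
  have h := integrable_toReal_of_lintegral_ne_top (μ := pbdPointLaw a b β μ)
    (f := fun ξ : Config Γ => (ξ.card : ℝ≥0∞)) hm.aemeasurable ?_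
  · simpa using h
  · rw [lintegral_pbdPointLaw hm]
    simp only [iidMean, Multiset.card_map, Finset.card_val, Finset.card_univ,
      Fintype.card_fin, lintegral_const, measure_univ, mul_one]
    refine ne_top_of_le_ne_top (tsum_pbdMass_mul_succ_ne_top (β := β) ha hb₀ hb₁ hβ)
      (ENNReal.tsum_le_tsum fun n => ?_)
    gcongr
    rw [← ENNReal.ofReal_natCast]
    exact ENNReal.ofReal_le_ofReal (by linarith)

end PointLaw

section PointLawInvariant

variable {Γ : Type*} [MetricSpace Γ] [CompactSpace Γ] [MeasurableSpace Γ] [BorelSpace Γ]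
  {μ : Measure Γ} [IsProbabilityMeasure μ] {a b β : ℝ}

lemma lintegral_rate_pbdPointLaw_ne_top (ha : 0 < a) (hb₀ : 0 ≤ b) (hb₁ : b < 1) (hβ : 0 ≤ β) :
    ∫⁻ ξ, systemRateKernel a b β μ ξ Set.univ ∂pbdPointLaw a b β μ ≠ ∞ := by
  have hm : Measurable fun ξ => systemRateKernel a b β μ ξ Set.univ :=
    (Measure.measurable_coe MeasurableSet.univ).comp measurable_systemRateKernel
  rw [lintegral_pbdPointLaw hm]
  simp only [systemRateKernel_univ, iidMean, Multiset.card_map, Finset.card_val, Finset.card_univ,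
    Fintype.card_fin, lintegral_const, measure_univ, mul_one]
  exact tsum_pbdMass_mul_rate_ne_top ha hb₀ hb₁ hβ

lemma pbdPointLaw_balance (ha : 0 < a) (hb₀ : 0 ≤ b) (hb₁ : b < 1) (hβ : 0 ≤ β)
    (g : Config Γ → ℝ≥0∞) (hg : Measurable g) :
    ∫⁻ ξ, ∫⁻ η, g η ∂systemRateKernel a b β μ ξ ∂pbdPointLaw a b β μ =
      ∫⁻ ξ, systemRateKernel a b β μ ξ Set.univ * g ξ ∂pbdPointLaw a b β μ := by
  have hm1 : Measurable fun ξ => ∫⁻ η, g η ∂systemRateKernel a b β μ ξ :=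
    (Measure.measurable_lintegral hg).comp measurable_systemRateKernel
  have hm2 : Measurable fun ξ => systemRateKernel a b β μ ξ Set.univ * g ξ :=
    ((Measure.measurable_coe MeasurableSet.univ).comp measurable_systemRateKernel).mul hg
  rw [lintegral_pbdPointLaw hm1, lintegral_pbdPointLaw hm2]
  simp only [lintegral_systemRateKernel_iid hg]
  rw [tsum_pbdMass_balance ha hb₀ hb₁ hβ]
  refine tsum_congr fun n => ?_
  congr 1
  simp only [systemRateKernel_univ]
  rw [iidMean_of_card (fun n => ENNReal.ofReal (birthRate a b n) + ENNReal.ofReal (deathRate β n))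
    hg]

lemma integral_expect_pbdPointLaw (ha : 0 < a) (hb₀ : 0 ≤ b) (hb₁ : b < 1) (hβ : 0 ≤ β)
    {f : Config Γ → ℝ} (hf : Measurable f) {B : ℝ} (hB : ∀ ξ, |f ξ| ≤ B) {t : ℝ} (ht : 0 ≤ t) :
    ∫ ξ, expect (systemRateKernel a b β μ) f t ξ ∂pbdPointLaw a b β μ =
      ∫ ξ, f ξ ∂pbdPointLaw a b β μ := by
  have := isProbabilityMeasure_pbdPointLaw (μ := μ) ha hb₀ hb₁ hβ
  exact integral_expect_of_balance measurable_systemRateKernel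
    (lintegral_rate_pbdPointLaw_ne_top ha hb₀ hb₁ hβ) (pbdPointLaw_balance ha hb₀ hb₁ hβ) hf hB ht

end PointLawInvariant

/-! ### The generator and its action on differences. -/

section ConfigSums

open Classical

variable {Γ : Type*}

lemma multiset_sum_map_sub_const (ξ : Config Γ) (φ : Γ → ℝ) (c : ℝ) :
    (ξ.map fun w => φ w - c).sum = (ξ.map φ).sum - ξ.card * c := by
  rw [Multiset.sum_map_sub]; simp

lemma cons_erase_of_mem {ξ : Config Γ} {w : Γ} (hw : w ∈ ξ) (x : Γ) :
    (x ::ₘ ξ).erase w = x ::ₘ ξ.erase w := by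
  by_cases h : x = w
  · subst h; rw [Multiset.erase_cons_head, Multiset.cons_erase hw]
  · rw [Multiset.erase_cons_tail _ h]

lemma sum_erase_cons (h : Config Γ → ℝ) (ξ : Config Γ) (x : Γ) :
    ((x ::ₘ ξ).map fun w => h ((x ::ₘ ξ).erase w) - h (x ::ₘ ξ)).sum =
      (h ξ - h (x ::ₘ ξ)) + (ξ.map fun w => h (x ::ₘ ξ.erase w)).sum - ξ.card * h (x ::ₘ ξ) := by
  rw [Multiset.map_cons, Multiset.sum_cons, Multiset.erase_cons_head, add_sub_assoc,
    ← multiset_sum_map_sub_const]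
  congr 2
  refine Multiset.map_congr rfl fun w hw => ?_
  rw [cons_erase_of_mem hw]

end ConfigSums

section Generator

open Classical

variable {Γ : Type*} [MeasurableSpace Γ] {μ : Measure Γ} {a b β : ℝ}

/-- The generator of the birth-death system. -/
def generator (a b β : ℝ) (μ : Measure Γ) (h : Config Γ → ℝ) (ξ : Config Γ) : ℝ :=
  (a + b * ξ.card) * ∫ x, (h (x ::ₘ ξ) - h ξ) ∂μ +
    (1 + β * ((ξ.card : ℝ) - 1)) * (ξ.map fun w => h (ξ.erase w) - h ξ).sum

variable [IsProbabilityMeasure μ]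

lemma integral_sub_rate_mul_eq_generator (ha : 0 < a) (hb₀ : 0 ≤ b) (hβ : 0 ≤ β)
    {h : Config Γ → ℝ} (hh : Measurable h) {ξ : Config Γ}
    (hi : Integrable (fun x => h (x ::ₘ ξ)) μ) :
    (∫ η, h η ∂systemRateKernel a b β μ ξ) - (systemRateKernel a b β μ ξ).real Set.univ * h ξ =
      generator a b β μ h ξ := by
  rw [integral_systemRateKernel ha hb₀ hβ hh hi, systemRateKernel_real_univ ha hb₀ hβ, generator,
    integral_sub hi (integrable_const _), multiset_sum_map_sub_const, birthRate, deathRate]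
  simp
  ring

lemma abs_integral_le_of_forall {φ : Γ → ℝ} {M : ℝ} (h : ∀ x, |φ x| ≤ M) : |∫ x, φ x ∂μ| ≤ M := by
  have := norm_integral_le_of_norm_le_const (μ := μ) (f := φ) (Filter.Eventually.of_forall h)
  simpa using this

/-- The effect of the generator on first differences. -/
lemma abs_generator_cons_sub_le (ha : 0 < a) (hb₀ : 0 ≤ b) (hβ : 0 ≤ β)
    {h : Config Γ → ℝ} (hi : ∀ ξ, Integrable (fun x => h (x ::ₘ ξ)) μ) (ξ : Config Γ) (x : Γ)
    {M₀ M₁ M₂ : ℝ} (h₀ : ∀ η : Config Γ, η.card + 1 = ξ.card → ∀ z, |h (z ::ₘ η) - h η| ≤ M₀)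
    (h₁ : ∀ η : Config Γ, η.card = ξ.card → ∀ z, |h (z ::ₘ η) - h η| ≤ M₁)
    (h₂ : ∀ η : Config Γ, η.card = ξ.card + 1 → ∀ z, |h (z ::ₘ η) - h η| ≤ M₂) :
    |generator a b β μ h (x ::ₘ ξ) - generator a b β μ h ξ +
        (a + b * ξ.card + (1 + β * ξ.card) + ξ.card * (1 + β * ((ξ.card : ℝ) - 1))) *
          (h (x ::ₘ ξ) - h ξ)| ≤
      (a + b * ξ.card + b) * M₂ + ξ.card * (1 + β * ((ξ.card : ℝ) - 1)) * M₀ +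
        β * ξ.card * M₁ := by
  set n : ℝ := (ξ.card : ℝ) with hn
  have hn0 : 0 ≤ n := Nat.cast_nonneg _
  have hcard : (Multiset.card (x ::ₘ ξ) : ℝ) = n + 1 := by simp [hn]
  have hbirth : ∫ z, (h (z ::ₘ x ::ₘ ξ) - h (x ::ₘ ξ)) ∂μ - ∫ z, (h (z ::ₘ ξ) - h ξ) ∂μ =
      (∫ z, (h (x ::ₘ z ::ₘ ξ) - h (z ::ₘ ξ)) ∂μ) - (h (x ::ₘ ξ) - h ξ) := by
    simp only [Multiset.cons_swap x]
    rw [integral_sub (hi _) (integrable_const _), integral_sub (hi _) (integrable_const _),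
      integral_sub (hi _) (hi _)]
    simp
    ring
  set I₁ := ∫ z, (h (x ::ₘ z ::ₘ ξ) - h (z ::ₘ ξ)) ∂μ with hI₁
  set I₂ := ∫ z, (h (z ::ₘ x ::ₘ ξ) - h (x ::ₘ ξ)) ∂μ with hI₂
  set S₁ := (ξ.map fun w => h (x ::ₘ ξ.erase w) - h (ξ.erase w)).sum with hS₁
  set S₂ := (ξ.map fun w => h (w ::ₘ x ::ₘ ξ.erase w) - h (x ::ₘ ξ.erase w)).sum with hS₂
  have hS₁' : (ξ.map fun w => h (x ::ₘ ξ.erase w)).sum =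
      S₁ + (ξ.map fun w => h (ξ.erase w)).sum := by rw [hS₁, Multiset.sum_map_sub]; ring
  have hS₂' : (ξ.map fun w => h (x ::ₘ ξ.erase w)).sum = n * h (x ::ₘ ξ) - S₂ := by
    have : S₂ = (ξ.map fun w => h (x ::ₘ ξ) - h (x ::ₘ ξ.erase w)).sum := by
      rw [hS₂]
      congr 1
      refine Multiset.map_congr rfl fun w hw => ?_
      rw [Multiset.cons_swap, Multiset.cons_erase hw]
    rw [this, Multiset.sum_map_sub]
    simp [hn]
  -- I₁ and S₁ collect the births and deaths common to both configurations, I₂ the b additional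
  -- births, and S₂ the additional deaths at rate β per point of ξ. The terms of S₂ are first
  -- differences at size n, since putting w back restores `x ::ₘ ξ`.
  have key : generator a b β μ h (x ::ₘ ξ) - generator a b β μ h ξ +
        (a + b * n + (1 + β * n) + n * (1 + β * (n - 1))) * (h (x ::ₘ ξ) - h ξ) =
      (a + b * n) * I₁ + b * I₂ + (1 + β * (n - 1)) * S₁ - β * S₂ := by
    rw [generator, generator, sum_erase_cons, hcard, multiset_sum_map_sub_const, ← hI₂, ← hn]
    have h5 : ∫ z, (h (z ::ₘ ξ) - h ξ) ∂μ = I₂ - I₁ + (h (x ::ₘ ξ) - h ξ) := by linarith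
    rw [h5]
    linear_combination (1 + β * (n - 1)) * hS₁' + β * hS₂'
  rw [key]
  have b1 : |I₁| ≤ M₂ := abs_integral_le_of_forall fun z => h₂ _ (by simp) x
  have b2 : |I₂| ≤ M₂ := abs_integral_le_of_forall fun z => h₂ _ (by simp) z
  have b3 : |S₁| ≤ n * M₀ := multiset_abs_sum_le _ fun w hw =>
    h₀ _ (Multiset.card_erase_add_one hw) x
  have b4 : |S₂| ≤ n * M₁ := multiset_abs_sum_le _ fun w hw =>
    h₁ _ (by rw [Multiset.card_cons, Multiset.card_erase_add_one hw]) w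
  have b5 : |(1 + β * (n - 1)) * S₁| ≤ (1 + β * (n - 1)) * (n * M₀) := by
    rcases eq_or_ne ξ 0 with h0 | h0
    · have : n = 0 := by simp [hn, h0]
      have : S₁ = 0 := by simp [hS₁, h0]
      simp [this, ‹n = 0›]
    · have := one_add_mul_card_sub_one_nonneg hβ h0
      rw [abs_mul, abs_of_nonneg this]
      exact mul_le_mul_of_nonneg_left b3 this
  have b6 : |(a + b * n) * I₁| ≤ (a + b * n) * M₂ := by
    rw [abs_mul, abs_of_nonneg (by positivity)]
    exact mul_le_mul_of_nonneg_left b1 (by positivity)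
  have b7 : |b * I₂| ≤ b * M₂ := by
    rw [abs_mul, abs_of_nonneg hb₀]; exact mul_le_mul_of_nonneg_left b2 hb₀
  have b8 : |β * S₂| ≤ β * (n * M₁) := by
    rw [abs_mul, abs_of_nonneg hβ]; exact mul_le_mul_of_nonneg_left b4 hβ
  calc _ ≤ |(a + b * n) * I₁| + |b * I₂| + |(1 + β * (n - 1)) * S₁| + |β * S₂| :=
        (abs_sub _ _).trans (add_le_add_left (abs_add_three _ _ _) _)
    _ ≤ _ := by nlinarith

/-- The effect of the generator on differences between configurations that differ in one point. -/
lemma abs_generator_cons_sub_cons_le (ha : 0 < a) (hb₀ : 0 ≤ b) (hβ : 0 ≤ β)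
    {h : Config Γ → ℝ} (hi : ∀ ξ, Integrable (fun x => h (x ::ₘ ξ)) μ) (ξ : Config Γ) (x y : Γ)
    {M₀ M₂ : ℝ}
    (h₀ : ∀ η : Config Γ, η.card + 1 = ξ.card → |h (x ::ₘ η) - h (y ::ₘ η)| ≤ M₀)
    (h₂ : ∀ η : Config Γ, η.card = ξ.card + 1 → |h (x ::ₘ η) - h (y ::ₘ η)| ≤ M₂) :
    |generator a b β μ h (x ::ₘ ξ) - generator a b β μ h (y ::ₘ ξ) +
        (a + b * (ξ.card + 1) + (1 + β * ξ.card) * (ξ.card + 1)) *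
          (h (x ::ₘ ξ) - h (y ::ₘ ξ))| ≤
      (a + b * (ξ.card + 1)) * M₂ + (1 + β * ξ.card) * (ξ.card * M₀) := by
  set n : ℝ := (ξ.card : ℝ) with hn
  have hn0 : 0 ≤ n := Nat.cast_nonneg _
  have hcard : ∀ x, (Multiset.card (x ::ₘ ξ) : ℝ) = n + 1 := by simp [hn]
  set I := ∫ z, (h (x ::ₘ z ::ₘ ξ) - h (y ::ₘ z ::ₘ ξ)) ∂μ with hI
  have hbirth : ∫ z, (h (z ::ₘ x ::ₘ ξ) - h (x ::ₘ ξ)) ∂μ -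
      ∫ z, (h (z ::ₘ y ::ₘ ξ) - h (y ::ₘ ξ)) ∂μ = I - (h (x ::ₘ ξ) - h (y ::ₘ ξ)) := by
    simp only [hI, Multiset.cons_swap x, Multiset.cons_swap y]
    rw [integral_sub (hi _) (integrable_const _), integral_sub (hi _) (integrable_const _),
      integral_sub (hi _) (hi _)]
    simp
    ring
  set S₁ := (ξ.map fun w => h (x ::ₘ ξ.erase w) - h (y ::ₘ ξ.erase w)).sum with hS₁
  have hS₁' : S₁ = (ξ.map fun w => h (x ::ₘ ξ.erase w)).sum -
      (ξ.map fun w => h (y ::ₘ ξ.erase w)).sum := by rw [hS₁, Multiset.sum_map_sub]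
  -- The two sizes agree, hence so do all rates. The deaths of x and of y both lead to ξ and cancel,
  -- leaving only the common births I and deaths S₁.
  have key : generator a b β μ h (x ::ₘ ξ) - generator a b β μ h (y ::ₘ ξ) +
        (a + b * (n + 1) + (1 + β * n) * (n + 1)) * (h (x ::ₘ ξ) - h (y ::ₘ ξ)) =
      (a + b * (n + 1)) * I + (1 + β * n) * S₁ := by
    rw [generator, generator, sum_erase_cons, sum_erase_cons, hcard, hcard, ← hn]
    linear_combination (a + b * (n + 1)) * hbirth - (1 + β * n) * hS₁'
  rw [key]
  have b1 : |I| ≤ M₂ := abs_integral_le_of_forall fun z => h₂ _ (by simp)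
  have b3 : |S₁| ≤ n * M₀ := multiset_abs_sum_le _ fun w hw =>
    h₀ _ (Multiset.card_erase_add_one hw)
  refine (abs_add_le _ _).trans ?_
  rw [abs_mul, abs_mul, abs_of_nonneg (by positivity : 0 ≤ a + b * (n + 1)),
    abs_of_nonneg (by positivity : 0 ≤ 1 + β * n)]
  gcongr

end Generator

/-! ### Exponential contraction of the semigroup. -/

section Contraction

variable {Γ : Type*} [MetricSpace Γ] [CompactSpace Γ] [MeasurableSpace Γ] [BorelSpace Γ]
  {μ : Measure Γ} [IsProbabilityMeasure μ] {a b β : ℝ}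

lemma integrable_expect_cons {f : Config Γ → ℝ} (hf : Measurable f) {B : ℝ} (hB0 : 0 ≤ B)
    (hB : ∀ ξ, |f ξ| ≤ B) (t : ℝ) (ξ : Config Γ) :
    Integrable (fun x => expect (systemRateKernel a b β μ) f t (x ::ₘ ξ)) μ := by
  have hm : Measurable fun η => expect (systemRateKernel a b β μ) f t η :=
    (measurable_expect measurable_systemRateKernel hf).comp
      (f := fun η : Config Γ => (t, η)) measurable_prodMk_left
  exact Integrable.of_bound (hm.comp (measurable_cons_left ξ)).aestronglyMeasurable B
    (Filter.Eventually.of_forall fun x => abs_expect_le measurable_systemRateKernel hB0 hB t _)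

lemma hasDerivAt_expect_system (ha : 0 < a) (hb₀ : 0 ≤ b) (hβ : 0 ≤ β)
    {f : Config Γ → ℝ} (hf : Measurable f) {B : ℝ} (hB0 : 0 ≤ B)
    (hB : ∀ ξ, |f ξ| ≤ B) {t : ℝ} (ht : 0 < t) (ξ : Config Γ) :
    HasDerivAt (fun t => expect (systemRateKernel a b β μ) f t ξ)
      (generator a b β μ (expect (systemRateKernel a b β μ) f t) ξ) t := by
  have hm : Measurable fun η => expect (systemRateKernel a b β μ) f t η :=
    (measurable_expect measurable_systemRateKernel hf).comp
      (f := fun η : Config Γ => (t, η)) measurable_prodMk_left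
  rw [← integral_sub_rate_mul_eq_generator ha hb₀ hβ hm (integrable_expect_cons hf hB0 hB t ξ)]
  exact hasDerivAt_expect measurable_systemRateKernel hf hB ξ ht

/-- The semigroup contracts first differences exponentially fast. -/
lemma abs_expect_cons_sub_le (ha : 0 < a) (hb₀ : 0 ≤ b) (hb₁ : b < 1) (hβ : 0 ≤ β)
    {f : Config Γ → ℝ} (hf : Measurable f) {B : ℝ} (hB0 : 0 ≤ B) (hB : ∀ ξ, |f ξ| ≤ B)
    (hf1 : ∀ (ξ : Config Γ) (x : Γ), |f (x ::ₘ ξ) - f ξ| ≤ 1) {t : ℝ} (ht : 0 ≤ t)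
    (ξ : Config Γ) (x : Γ) :
    |expect (systemRateKernel a b β μ) f t (x ::ₘ ξ) - expect (systemRateKernel a b β μ) f t ξ| ≤
      Real.exp (-((1 - b) * t)) := by
  set E := expect (systemRateKernel a b β μ) f with hE
  -- K makes half of the net rate 1 - b, applied to the weight |ξ| + K, absorb the upward drift a +
  -- b of that weight.
  set K : ℝ := 1 + 2 * (a + b) / (1 - b) with hK
  have hb1' : 0 < 1 - b := by linarith
  have hK1 : 1 ≤ K := by
    have : 0 ≤ 2 * (a + b) / (1 - b) := by positivity
    linarith
  have hKb : a + b ≤ (1 - b) / 2 * K := by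
    have : (1 - b) * (2 * (a + b) / (1 - b)) = 2 * (a + b) := by field_simp
    nlinarith
  set r : ℕ → ℝ := fun n => a + b * n + (1 + β * n) + n * (1 + β * ((n : ℝ) - 1)) with hr
  have hr1 : ∀ n, 1 ≤ r n := by
    intro n
    have h1 : (0 : ℝ) ≤ n := Nat.cast_nonneg n
    have h2 : r n = a + b * n + 1 + n + β * (n * n) := by simp only [hr]; ring
    rw [h2]
    have : 0 ≤ β * ((n : ℝ) * n) := by positivity
    have : 0 ≤ b * (n : ℝ) := by positivity
    linarith
  have hcont : ∀ ξ, Continuous fun t => E t ξ := fun ξ =>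
    continuous_expect measurable_systemRateKernel hf hB ξ
  have key := nonpos_of_improving (X := Set.Ici (0 : ℝ) × (Config Γ × Γ))
    (ψ := fun z => |E z.1 (z.2.2 ::ₘ z.2.1) - E z.1 z.2.1| - Real.exp (-((1 - b) * z.1)))
    (V := fun z => (z.2.1.card : ℝ) + K)
    (γ := fun z => 1 - (1 - b) / (2 * r z.2.1.card)) (B := B + B) ?_ ?_ ?_ ?_ (⟨t, ht⟩, (ξ, x))
  · simpa [sub_nonpos] using key
  · intro z
    have h1 := abs_expect_le (measurable_systemRateKernel (a := a) (b := b) (β := β) (μ := μ))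
      hB0 hB z.1 (z.2.2 ::ₘ z.2.1)
    have h2 := abs_expect_le (measurable_systemRateKernel (a := a) (b := b) (β := β) (μ := μ))
      hB0 hB z.1 z.2.1
    have h3 := abs_sub (E z.1 (z.2.2 ::ₘ z.2.1)) (E z.1 z.2.1)
    have h4 := Real.exp_pos (-((1 - b) * (z.1 : ℝ)))
    linarith
  · intro z
    have : (0 : ℝ) ≤ z.2.1.card := Nat.cast_nonneg _
    linarith
  · intro c
    set R := a + b * |c| + 1 + |c| + β * (|c| * |c|) with hR
    have hR1 : 0 < R := by positivity
    refine ⟨1 - (1 - b) / (2 * R), ?_, fun z hz => ?_⟩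
    · have : 0 < (1 - b) / (2 * R) := by positivity
      linarith
    · have hn : (z.2.1.card : ℝ) ≤ |c| := by linarith [le_abs_self c]
      have hn0 : (0 : ℝ) ≤ z.2.1.card := Nat.cast_nonneg _
      have h2 : r z.2.1.card ≤ R := by
        have h3 : r z.2.1.card = a + b * z.2.1.card + 1 + z.2.1.card +
          β * (z.2.1.card * z.2.1.card) := by simp only [hr]; ring
        rw [h3, hR]
        gcongr
      have h4 := hr1 z.2.1.card
      have : (1 - b) / (2 * R) ≤ (1 - b) / (2 * r z.2.1.card) := by gcongr
      linarith
  · rintro θ hθ hb ⟨⟨t, ht⟩, ξ, x⟩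
    simp only
    set n := ξ.card with hn
    have hn0 : (0 : ℝ) ≤ n := Nat.cast_nonneg _
    set γ := 1 - (1 - b) / (2 * r n) with hγ
    have hrn := hr1 n
    have hγr : r n * γ = r n - (1 - b) / 2 := by
      rw [hγ]; field_simp
    have hγ0 : 0 ≤ γ := by
      have : 0 ≤ r n * γ := by rw [hγr]; linarith
      exact nonneg_of_mul_nonneg_right this (by linarith)
    have hstep : ∀ t, 0 < t →
        |generator a b β μ (E t) (x ::ₘ ξ) - generator a b β μ (E t) ξ +
          r n * (E t (x ::ₘ ξ) - E t ξ)| ≤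
        (r n - (1 - b)) * Real.exp (-((1 - b) * t)) + r n * (γ * (θ * (n + K))) := by
      intro t ht
      have hbt : ∀ (η : Config Γ) (z : Γ), |E t (z ::ₘ η) - E t η| ≤
          Real.exp (-((1 - b) * t)) + θ * (η.card + K) := fun η z => by
        have := hb (⟨t, ht.le⟩, (η, z))
        simp only at this
        linarith
      refine (abs_generator_cons_sub_le ha hb₀ hβ
        (fun ξ => integrable_expect_cons hf hB0 hB t ξ) ξ x
        (M₀ := Real.exp (-((1 - b) * t)) + θ * (n - 1 + K))
        (M₁ := Real.exp (-((1 - b) * t)) + θ * (n + K))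
        (M₂ := Real.exp (-((1 - b) * t)) + θ * (n + 1 + K)) ?_ ?_ ?_).trans ?_
      · intro η hη z
        have h1 : (η.card : ℝ) = n - 1 := by rw [hn, ← hη]; push_cast; ring
        have := hbt η z
        rwa [h1] at this
      · intro η hη z
        have := hbt η z
        rwa [hη] at this
      · intro η hη z
        have h1 : (η.card : ℝ) = n + 1 := by rw [hη]; push_cast; ring
        have := hbt η z
        rwa [h1] at this
      · have h1 : r n * (γ * (θ * (n + K))) = θ * ((r n - (1 - b) / 2) * (n + K)) := by
          rw [← hγr]; ring
        rw [h1]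
        -- The weight is a strict supersolution of the difference equation, keeping half of the
        -- slack 1 - b; this is the source of the factor γ.
        have h2 : (a + b * n + b) * (n + 1 + K) + n * (1 + β * ((n : ℝ) - 1)) * (n - 1 + K) +
            β * n * (n + K) ≤ (r n - (1 - b) / 2) * (n + K) := by
          have h3 : (r n - (1 - b) / 2) * (n + K) - ((a + b * n + b) * (n + 1 + K) +
            n * (1 + β * ((n : ℝ) - 1)) * (n - 1 + K) + β * n * (n + K)) =
            (1 - b) / 2 * (n + K) - (a + b) + (1 - b) * n + β * (n * (n - 1)) := by
            simp only [hr]; ring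
          have h4 : 0 ≤ β * ((n : ℝ) * (n - 1)) := by
            refine mul_nonneg hβ ?_
            rcases Nat.eq_zero_or_pos n with h | h
            · simp [h]
            · have : (1 : ℝ) ≤ n := by exact_mod_cast h
              exact mul_nonneg hn0 (by linarith)
          have h5 : 0 ≤ (1 - b) / 2 * (n : ℝ) := by positivity
          have h6 : 0 ≤ (1 - b) * (n : ℝ) := by positivity
          nlinarith
        have h7 := mul_le_mul_of_nonneg_left h2 hθ
        have h8 : r n = a + b * n + (1 + β * n) + n * (1 + β * ((n : ℝ) - 1)) := rfl
        generalize Real.exp (-((1 - b) * t)) = e at *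
        have h9 : (a + b * n + b) * (e + θ * (n + 1 + K)) +
            n * (1 + β * ((n : ℝ) - 1)) * (e + θ * (n - 1 + K)) + β * n * (e + θ * (n + K)) =
            (r n - (1 - b)) * e + θ * ((a + b * n + b) * (n + 1 + K) +
              n * (1 + β * ((n : ℝ) - 1)) * (n - 1 + K) + β * n * (n + K)) := by
          rw [h8]; ring
        rw [h9]
        linarith
    have hexpd : ∀ t, HasDerivAt (fun t => Real.exp (-((1 - b) * t)))
        (Real.exp (-((1 - b) * t)) * -((1 - b) * 1)) t := fun t =>
      (((hasDerivAt_id' t).const_mul (1 - b)).fun_neg).exp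
    have hD : ∀ t, 0 < t → HasDerivAt (fun t => E t (x ::ₘ ξ) - E t ξ)
        (generator a b β μ (E t) (x ::ₘ ξ) - generator a b β μ (E t) ξ) t := fun t ht =>
      (hasDerivAt_expect_system ha hb₀ hβ hf hB0 hB ht _).sub
        (hasDerivAt_expect_system ha hb₀ hβ hf hB0 hB ht _)
    have hc1 : Continuous fun t => E t (x ::ₘ ξ) - E t ξ := (hcont _).sub (hcont _)
    have hnn : 0 ≤ γ * (θ * (n + K)) := by
      have : 0 ≤ (n : ℝ) + K := by linarith
      positivity
    have h0 := abs_le.1 (hf1 ξ x)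
    have hE0 : ∀ ξ, E 0 ξ = f ξ := expect_zero measurable_systemRateKernel hf hB
    -- With ξ and x fixed, neighbouring sizes enter only through the assumed bound θV. Grönwall with
    -- the total rate r n then replaces θV by γθV.
    have hup := nonpos_of_hasDerivAt_le (r := r n)
      (z := fun t => (E t (x ::ₘ ξ) - E t ξ) - Real.exp (-((1 - b) * t)) - γ * (θ * (n + K)))
      (z' := fun t => (generator a b β μ (E t) (x ::ₘ ξ) - generator a b β μ (E t) ξ) -
        Real.exp (-((1 - b) * t)) * -((1 - b) * 1))
      (by fun_prop) (fun t ht => ((hD t ht).sub (hexpd t)).sub_const _)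
      (fun t ht => by have := (abs_le.1 (hstep t ht)).2; linarith)
      (by simp only [hE0, mul_zero, neg_zero, Real.exp_zero]; linarith) ht
    have hlow := nonpos_of_hasDerivAt_le (r := r n)
      (z := fun t => -(E t (x ::ₘ ξ) - E t ξ) - Real.exp (-((1 - b) * t)) - γ * (θ * (n + K)))
      (z' := fun t => -(generator a b β μ (E t) (x ::ₘ ξ) - generator a b β μ (E t) ξ) -
        Real.exp (-((1 - b) * t)) * -((1 - b) * 1))
      (by fun_prop) (fun t ht => ((hD t ht).fun_neg.sub (hexpd t)).sub_const _)
      (fun t ht => by have := (abs_le.1 (hstep t ht)).1; linarith)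
      (by simp only [hE0, mul_zero, neg_zero, Real.exp_zero]; linarith) ht
    have : |E t (x ::ₘ ξ) - E t ξ| ≤ Real.exp (-((1 - b) * t)) + γ * (θ * (n + K)) :=
      abs_le.2 ⟨by linarith, by linarith⟩
    linarith

end Contraction

/-! ### Difference bounds for solutions of the Poisson equation. -/

section DifferenceBounds

open Classical

variable {Γ : Type*} [MeasurableSpace Γ] {μ : Measure Γ} {a b β : ℝ}

lemma generator_neg (h : Config Γ → ℝ) (ξ : Config Γ) :
    generator a b β μ (-h) ξ = -generator a b β μ h ξ := by
  simp only [generator, Pi.neg_apply, neg_sub_neg]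
  have h1 : ∫ x, (h ξ - h (x ::ₘ ξ)) ∂μ = -∫ x, (h (x ::ₘ ξ) - h ξ) ∂μ := by
    rw [← integral_neg]; simp
  have h2 : (ξ.map fun w => h ξ - h (ξ.erase w)).sum =
      -(ξ.map fun w => h (ξ.erase w) - h ξ).sum := by
    rw [← Multiset.sum_map_neg']; simp
  rw [h1, h2]; ring

/-- Solutions of the Poisson equation vary little when one point is moved. -/
lemma abs_cons_sub_cons_le [IsProbabilityMeasure μ] (ha : 0 < a) (hb₀ : 0 ≤ b) (hb₁ : b < 1)
    (hβ : 0 ≤ β)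
    {h φ : Config Γ → ℝ} (hi : ∀ ξ, Integrable (fun x => h (x ::ₘ ξ)) μ)
    {L : ℝ} (hL : ∀ (ξ : Config Γ) (x : Γ), |h (x ::ₘ ξ) - h ξ| ≤ L)
    (hgen : ∀ ξ, generator a b β μ h ξ = φ ξ)
    (hφ : ∀ (ξ : Config Γ) (x y : Γ), |φ (x ::ₘ ξ) - φ (y ::ₘ ξ)| ≤ 1 / ((ξ.card : ℝ) + 1))
    {A B : ℝ} (hA : 0 ≤ A) (hB : 0 ≤ B)
    (hAB : ∀ n : ℕ, 1 / ((n : ℝ) + 1) ≤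
      (a + b * ((n : ℝ) + 1)) * (A / (((n : ℝ) + 1) * ((n : ℝ) + 2))) + B)
    (ξ : Config Γ) (x y : Γ) :
    |h (x ::ₘ ξ) - h (y ::ₘ ξ)| ≤ A / ((ξ.card : ℝ) + 1) + B := by
  set K : ℝ := 1 + 2 * (a + b) with hK
  set r : ℕ → ℝ := fun n => a + b * (n + 1) + (1 + β * n) * (n + 1) with hr
  have hr1 : ∀ n, 1 ≤ r n := by
    intro n
    have h1 : (0 : ℝ) ≤ n := Nat.cast_nonneg n
    have h2 : 0 ≤ b * ((n : ℝ) + 1) := by positivity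
    have h3 : 0 ≤ β * (n : ℝ) * (n + 1) := by positivity
    simp only [hr]
    nlinarith
  have key := nonpos_of_improving (X := Config Γ × (Γ × Γ))
    (ψ := fun z => |h (z.2.1 ::ₘ z.1) - h (z.2.2 ::ₘ z.1)| - (A / ((z.1.card : ℝ) + 1) + B))
    (V := fun z => (z.1.card : ℝ) + K)
    (γ := fun z => 1 - 1 / (2 * r z.1.card)) (B := L + L) ?_ ?_ ?_ ?_ (ξ, (x, y))
  · simpa [sub_nonpos] using key
  · intro z
    have h1 := hL z.1 z.2.1
    have h2 := hL z.1 z.2.2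
    have h3 := abs_sub_le (h (z.2.1 ::ₘ z.1)) (h z.1) (h (z.2.2 ::ₘ z.1))
    rw [abs_sub_comm (h z.1)] at h3
    have h4 : 0 ≤ A / ((z.1.card : ℝ) + 1) := by positivity
    linarith
  · intro z
    have : (0 : ℝ) ≤ z.1.card := Nat.cast_nonneg _
    linarith
  · intro c
    set R := a + b * (|c| + 1) + (1 + β * |c|) * (|c| + 1) with hR
    have hR1 : 0 < R := by positivity
    refine ⟨1 - 1 / (2 * R), ?_, fun z hz => ?_⟩
    · have : 0 < 1 / (2 * R) := by positivity
      linarith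
    · have hn : (z.1.card : ℝ) ≤ |c| := by linarith [le_abs_self c]
      have h2 : r z.1.card ≤ R := by
        simp only [hr, hR]
        gcongr
      have h4 := hr1 z.1.card
      have : 1 / (2 * R) ≤ 1 / (2 * r z.1.card) := by gcongr
      linarith
  · rintro θ hθ hb ⟨ξ, x, y⟩
    simp only
    set n := ξ.card with hn
    have hn0 : (0 : ℝ) ≤ n := Nat.cast_nonneg _
    have hrn := hr1 n
    have hb' : ∀ (η : Config Γ), |h (x ::ₘ η) - h (y ::ₘ η)| ≤
        A / ((η.card : ℝ) + 1) + B + θ * (η.card + K) := fun η => by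
      have := hb (η, (x, y))
      simp only at this
      linarith
    have h1 := abs_generator_cons_sub_cons_le ha hb₀ hβ hi ξ x y
      (M₀ := A / n + B + θ * (n - 1 + K)) (M₂ := A / (n + 2) + B + θ * (n + 1 + K)) ?_ ?_
    · rw [← hn, hgen, hgen] at h1
      change |_ + r n * _| ≤ _ at h1
      have h2 := hφ ξ x y
      have h3 : r n * |h (x ::ₘ ξ) - h (y ::ₘ ξ)| ≤ 1 / ((n : ℝ) + 1) +
          ((a + b * (n + 1)) * (A / (n + 2) + B + θ * (n + 1 + K)) +
          (1 + β * n) * (n * (A / n + B + θ * (n - 1 + K)))) := by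
        rw [← abs_of_pos (by linarith : 0 < r n), ← abs_mul]
        rw [← hn] at h2
        have h1' := abs_le.1 h1
        have h2' := abs_le.1 h2
        exact abs_le.2 ⟨by linarith, by linarith⟩
      -- Only an inequality, because A / 0 = 0 at n = 0.
      have h4 : (n : ℝ) * (A / n) ≤ A := by
        rcases Nat.eq_zero_or_pos n with h | h
        · simp [h, hA]
        · have : (n : ℝ) ≠ 0 := by positivity
          rw [mul_div_cancel₀ _ this]
      have h5 : (1 + β * n) * (n * (A / n + B + θ * (n - 1 + K))) ≤
          (1 + β * n) * (A + n * B + θ * (n * (n - 1 + K))) := by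
        refine mul_le_mul_of_nonneg_left ?_ (by positivity)
        linarith
      have h6 := hAB n
      have h7 : A / ((n : ℝ) + 1) - A / (n + 2) = A / (((n : ℝ) + 1) * ((n : ℝ) + 2)) := by
        field_simp; ring
      have h8 : ((n : ℝ) + 1) * (A / (n + 1)) = A := mul_div_cancel₀ _ (by positivity)
      have h9 : r n * (1 - 1 / (2 * r n)) = r n - 1 / 2 := by field_simp
      -- The supersolution property of w(n) = A/(n + 1) + B. Births gain (a + b(n + 1))(w(n) - w(n +
      -- 1)), which is the A-term of `hAB`; deaths gain at least (1 + βn)B ≥ B, since (n + 1)w(n) =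
      -- A + (n + 1)B.
      have h10 : 1 / ((n : ℝ) + 1) + ((a + b * (n + 1)) * (A / (n + 2) + B) +
          (1 + β * n) * (A + n * B)) ≤ r n * (A / (n + 1) + B) := by
        rw [← h7] at h6
        have h11 : r n * (A / (n + 1) + B) = (a + b * (n + 1)) * (A / (n + 1) + B) +
          (1 + β * n) * (A + (n + 1) * B) := by
          simp only [hr]; linear_combination (1 + β * n) * h8
        rw [h11]
        have : 0 ≤ β * n * B := by positivity
        nlinarith
      have h12 : (a + b * (n + 1)) * (n + 1 + K) + (1 + β * n) * (n * (n - 1 + K)) ≤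
          (r n - 1 / 2) * (n + K) := by
        have h13 : (r n - 1 / 2) * (n + K) -
            ((a + b * (n + 1)) * (n + 1 + K) + (1 + β * n) * (n * (n - 1 + K))) =
            (n + K) / 2 + β * n * (n + K) + β * n * n + (1 - b) * n - (a + b) := by
          simp only [hr]; ring
        have h14 : 0 ≤ β * n * (n + K) := by positivity
        have h15 : 0 ≤ β * n * n := by positivity
        have h16 : 0 ≤ (1 - b) * (n : ℝ) := mul_nonneg (by linarith) hn0
        linarith
      have h17 := mul_le_mul_of_nonneg_left h12 hθ
      have h18 : r n * |h (x ::ₘ ξ) - h (y ::ₘ ξ)| ≤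
          r n * (A / (n + 1) + B + (1 - 1 / (2 * r n)) * (θ * (n + K))) := by
        have h19 : r n * (A / (n + 1) + B + (1 - 1 / (2 * r n)) * (θ * (n + K))) =
            r n * (A / (n + 1) + B) + θ * ((r n - 1 / 2) * (n + K)) := by
          rw [← h9]; ring
        rw [h19]
        linarith
      have := le_of_mul_le_mul_left h18 (by linarith)
      linarith
    · intro η hη
      have h1 : (η.card : ℝ) = n - 1 := by rw [hn, ← hη]; push_cast; ring
      have := hb' η
      rw [h1] at this
      simpa using this
    · intro η hη
      have h1 : (η.card : ℝ) = n + 1 := by rw [hη]; push_cast; ring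
      have := hb' η
      rw [h1] at this
      convert this using 4
      ring

/-- The Poisson equation at `x ::ₘ ξ` with the deaths of the points of `ξ` replaced by the death
of `x`. -/
lemma abs_birth_sub_death_le (hβ : 0 ≤ β) {h φ : Config Γ → ℝ}
    (hgen : ∀ ξ, generator a b β μ h ξ = φ ξ) {A B : ℝ} (hA : 0 ≤ A)
    (hv : ∀ (ξ : Config Γ) (x y : Γ), |h (x ::ₘ ξ) - h (y ::ₘ ξ)| ≤ A / ((ξ.card : ℝ) + 1) + B)
    (ξ : Config Γ) (x : Γ) :
    |(a + b * (ξ.card + 1)) * ∫ z, (h (z ::ₘ x ::ₘ ξ) - h (x ::ₘ ξ)) ∂μ -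
        (1 + β * ξ.card) * ((ξ.card + 1) * (h (x ::ₘ ξ) - h ξ)) - φ (x ::ₘ ξ)| ≤
      (1 + β * ξ.card) * (A + ξ.card * B) := by
  set n : ℝ := (ξ.card : ℝ) with hn
  have hn0 : 0 ≤ n := Nat.cast_nonneg _
  have hcard : (Multiset.card (x ::ₘ ξ) : ℝ) = n + 1 := by simp [hn]
  set T := (ξ.map fun w => h (x ::ₘ ξ.erase w) - h ξ).sum with hT
  have hT' : T = (ξ.map fun w => h (x ::ₘ ξ.erase w)).sum - n * h ξ :=
    multiset_sum_map_sub_const _ _ _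
  -- Writing ξ as `w ::ₘ ξ.erase w`, each term of T moves a single point, from w to x.
  have hTb : |T| ≤ n * (A / n + B) := by
    refine multiset_abs_sum_le _ fun w hw => ?_
    have h1 := hv (ξ.erase w) x w
    have h2 : (Multiset.card (ξ.erase w) : ℝ) + 1 = n := by
      rw [hn, ← Multiset.card_erase_add_one hw]; push_cast; ring
    rwa [h2, Multiset.cons_erase hw] at h1
  have h4 : n * (A / n) ≤ A := by
    rcases eq_or_ne n 0 with h | h
    · simp [h, hA]
    · rw [mul_div_cancel₀ _ h]
  have h1 := hgen (x ::ₘ ξ)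
  rw [generator, sum_erase_cons, hcard, ← hn] at h1
  have h2 : (a + b * (n + 1)) * ∫ z, (h (z ::ₘ x ::ₘ ξ) - h (x ::ₘ ξ)) ∂μ -
        (1 + β * n) * ((n + 1) * (h (x ::ₘ ξ) - h ξ)) - φ (x ::ₘ ξ) = -((1 + β * n) * T) := by
    rw [hT']
    linear_combination h1
  rw [h2, abs_neg, abs_mul, abs_of_nonneg (by positivity : 0 ≤ 1 + β * n)]
  refine mul_le_mul_of_nonneg_left ?_ (by positivity)
  linarith

variable [IsProbabilityMeasure μ]

/-- Adding x rather than a μ-random point z moves one point, so first differences are nearly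
independent of the added point. -/
lemma abs_sub_birth_le {h : Config Γ → ℝ} (hi : ∀ ξ, Integrable (fun x => h (x ::ₘ ξ)) μ)
    {A B : ℝ}
    (hv : ∀ (ξ : Config Γ) (x y : Γ), |h (x ::ₘ ξ) - h (y ::ₘ ξ)| ≤ A / ((ξ.card : ℝ) + 1) + B)
    (ξ : Config Γ) (x : Γ) :
    |(h (x ::ₘ ξ) - h ξ) - ∫ z, (h (z ::ₘ ξ) - h ξ) ∂μ| ≤ A / ((ξ.card : ℝ) + 1) + B := by
  have h1 : (h (x ::ₘ ξ) - h ξ) - ∫ z, (h (z ::ₘ ξ) - h ξ) ∂μ =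
      ∫ z, (h (x ::ₘ ξ) - h (z ::ₘ ξ)) ∂μ := by
    rw [integral_sub (hi ξ) (integrable_const _), integral_sub (integrable_const _) (hi ξ)]
    simp
  rw [h1]
  exact abs_integral_le_of_forall fun z => hv ξ x z

/-- A lower bound for first differences at sizes where births dominate deaths. -/
lemma neg_le_cons_sub (ha : 0 < a) (hb₀ : 0 ≤ b) (hb₁ : b < 1) (hβ : 0 ≤ β)
    {h φ : Config Γ → ℝ} (hi : ∀ ξ, Integrable (fun x => h (x ::ₘ ξ)) μ)
    (hgen : ∀ ξ, generator a b β μ h ξ = φ ξ) {l : ℝ} (hl0 : l ≤ 0) (hl : ∀ ξ, l ≤ φ ξ)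
    {A B : ℝ} (hA : 0 ≤ A) (hB : 0 ≤ B)
    (hv : ∀ (ξ : Config Γ) (x y : Γ), |h (x ::ₘ ξ) - h (y ::ₘ ξ)| ≤ A / ((ξ.card : ℝ) + 1) + B)
    {n : ℕ} (hn : 0 < a + b * n - n * (1 + β * ((n : ℝ) - 1))) :
    ∀ N : ℕ, N ≤ n → ∀ (ξ : Config Γ) (x : Γ), ξ.card = N →
      -(A / ((N : ℝ) + 1) + (A * (1 + β * n) + B * (a + b * n) - l) /
        (a + b * n - n * (1 + β * ((n : ℝ) - 1)))) ≤ h (x ::ₘ ξ) - h ξ := by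
  set g := a + b * n - n * (1 + β * ((n : ℝ) - 1)) with hg
  set J := (A * (1 + β * n) + B * (a + b * n) - l) / g with hJ
  have hn0 : (0 : ℝ) ≤ n := Nat.cast_nonneg _
  have hJg : J * g = A * (1 + β * n) + B * (a + b * n) - l := div_mul_cancel₀ _ hn.ne'
  have hJ0 : 0 ≤ J := by
    refine div_nonneg ?_ hn.le
    have : 0 ≤ A * (1 + β * n) := by positivity
    have : 0 ≤ B * (a + b * n) := by positivity
    linarith
  -- The excess of births over deaths does not increase with the integer size, so J, tuned to size
  -- n, serves all smaller sizes of the induction.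
  have hJN : ∀ N : ℕ, N ≤ n → A * (1 + β * n) + B * (a + b * N) - l ≤
      J * (a + b * N - N * (1 + β * ((N : ℝ) - 1))) := by
    intro N hN
    have hN' : (N : ℝ) ≤ n := by exact_mod_cast hN
    have h1 : g ≤ a + b * N - N * (1 + β * ((N : ℝ) - 1)) := by
      have h2 : 0 ≤ ((n : ℝ) - N) * (n + N - 1) := by
        rcases hN.eq_or_lt with h | h
        · simp [h]
        · have : (N : ℝ) + 1 ≤ n := by exact_mod_cast h
          have : (0 : ℝ) ≤ N := Nat.cast_nonneg _
          exact mul_nonneg (by linarith) (by linarith)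
      have h3 := mul_nonneg hβ h2
      have h4 : 0 ≤ (1 - b) * ((n : ℝ) - N) := mul_nonneg (by linarith) (by linarith)
      rw [hg]
      nlinarith
    have h5 := mul_le_mul_of_nonneg_left h1 hJ0
    have h6 : B * (a + b * N) ≤ B * (a + b * n) := by gcongr
    linarith
  intro N
  induction N with
  | zero =>
    intro hN ξ x hξ
    have hξ0 : ξ = 0 := Multiset.card_eq_zero.1 hξ
    subst hξ0
    have h1 := hgen 0
    simp only [generator, Multiset.card_zero, Nat.cast_zero, mul_zero, add_zero, Multiset.map_zero,
      Multiset.sum_zero] at h1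
    have h2 := (abs_le.1 (abs_sub_birth_le hi hv 0 x)).1
    have h3 := hJN 0 hN
    have h4 := hl 0
    have h5 : 0 ≤ A * (1 + β * n) := by positivity
    simp only [Multiset.card_zero, Nat.cast_zero, zero_add, div_one, mul_zero, add_zero,
      zero_mul, sub_zero] at h2 h3 ⊢
    set I := ∫ z, (h (z ::ₘ 0) - h 0) ∂μ
    have h6 : 0 ≤ a * (I + J - B) := by nlinarith
    have h7 := nonneg_of_mul_nonneg_right h6 ha
    linarith
  | succ N ih =>
    intro hN ξ x hξ
    have ih' := ih (Nat.le_of_succ_le hN)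
    have hN0 : (0 : ℝ) ≤ N := Nat.cast_nonneg _
    have h1 := hgen ξ
    rw [generator, hξ] at h1
    have h2 := (abs_le.1 (abs_sub_birth_le hi hv ξ x)).1
    rw [hξ] at h2
    have h3 := hJN (N + 1) hN
    have h4 := hl ξ
    set I := ∫ z, (h (z ::ₘ ξ) - h ξ) ∂μ
    have h5 : (ξ.map fun w => h (ξ.erase w) - h ξ).sum ≤
        (N + 1) * (A / (N + 1) + J) := by
      have h6 : ∀ w ∈ ξ, h (ξ.erase w) - h ξ ≤ A / (N + 1) + J := by
        intro w hw
        have h7 := ih' (ξ.erase w) w (by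
          have := Multiset.card_erase_add_one hw
          omega)
        rw [Multiset.cons_erase hw] at h7
        linarith
      have h8 := Multiset.sum_le_card_nsmul (ξ.map fun w => h (ξ.erase w) - h ξ)
        (A / (N + 1) + J) (by
          intro y hy
          obtain ⟨w, hw, rfl⟩ := Multiset.mem_map.1 hy
          exact h6 w hw)
      rw [Multiset.card_map, hξ, nsmul_eq_mul] at h8
      push_cast at h8
      exact h8
    have h9 : ((N : ℝ) + 1) * (A / (N + 1) + J) = A + (N + 1) * J := by field_simp
    rw [h9] at h5
    push_cast at h1 h2 h3 ⊢
    have h10 : 0 ≤ 1 + β * ((N : ℝ) + 1 - 1) := by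
      have : 0 ≤ β * (N : ℝ) := by positivity
      linarith
    have h11 := mul_le_mul_of_nonneg_left h5 h10
    have hNn : (N : ℝ) + 1 ≤ n := by exact_mod_cast hN
    have h12 : (1 + β * ((N : ℝ) + 1 - 1)) * A ≤ A * (1 + β * n) := by
      rw [mul_comm]
      refine mul_le_mul_of_nonneg_left ?_ hA
      have : β * ((N : ℝ) + 1 - 1) ≤ β * n := mul_le_mul_of_nonneg_left (by linarith) hβ
      linarith
    have hα : 0 < a + b * ((N : ℝ) + 1) := by positivity
    -- The Poisson equation at ξ, with death terms bounded by the induction hypothesis, bounds the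
    -- mean birth difference I below by B - J. Passing from I to the given x costs A/(N + 2) + B.
    have h13 : 0 ≤ (a + b * ((N : ℝ) + 1)) * (I + J - B) := by nlinarith
    have h14 := nonneg_of_mul_nonneg_right h13 hα
    linarith

/-- An upper bound for first differences at sizes where deaths dominate births. -/
lemma cons_sub_le (ha : 0 < a) (hb₀ : 0 ≤ b) (hb₁ : b < 1) (hβ : 0 ≤ β)
    {h φ : Config Γ → ℝ} {L : ℝ} (hL : ∀ (ξ : Config Γ) (x : Γ), |h (x ::ₘ ξ) - h ξ| ≤ L)
    (hi : ∀ ξ, Integrable (fun x => h (x ::ₘ ξ)) μ)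
    (hgen : ∀ ξ, generator a b β μ h ξ = φ ξ) {l : ℝ} (hl0 : l ≤ 0) (hl : ∀ ξ, l ≤ φ ξ)
    {A B : ℝ} (hA : 0 ≤ A)
    (hv : ∀ (ξ : Config Γ) (x y : Γ), |h (x ::ₘ ξ) - h (y ::ₘ ξ)| ≤ A / ((ξ.card : ℝ) + 1) + B)
    {m : ℕ} {v : ℝ} (hv0 : 0 ≤ v) (hvm : ∀ N : ℕ, m ≤ N → A + N * B ≤ (N + 1) * v)
    (hm : 0 < (m + 1) * (1 + β * m) - (a + b * ((m : ℝ) + 1)))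
    (ξ : Config Γ) (x : Γ) (hξ : m ≤ ξ.card) :
    h (x ::ₘ ξ) - h ξ ≤ (-l + (m + 1) * (1 + β * m) * v) /
      ((m + 1) * (1 + β * m) - (a + b * ((m : ℝ) + 1))) := by
  set g := (m + 1) * (1 + β * m) - (a + b * ((m : ℝ) + 1)) with hg
  set J := (-l + (m + 1) * (1 + β * m) * v) / g with hJ
  have hm0 : (0 : ℝ) ≤ m := Nat.cast_nonneg _
  have hJg : J * g = -l + (m + 1) * (1 + β * m) * v := div_mul_cancel₀ _ hm.ne'
  have hD : 0 < (m + 1) * (1 + β * m) := by positivity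
  -- The ratio of birth to death rate at size m + 1. It bounds the ratio at all larger sizes, so one
  -- factor ρ < 1 works throughout and the constant weight 1 suffices.
  set ρ := (a + b * ((m : ℝ) + 1)) / ((m + 1) * (1 + β * m)) with hρ
  have key := nonpos_of_improving (X := {η : Config Γ // m ≤ η.card} × Γ)
    (ψ := fun z => h (z.2 ::ₘ z.1.1) - h z.1.1 - J) (V := fun _ => 1) (γ := fun _ => ρ)
    (B := L - J) ?_ (fun _ => le_rfl) ?_ ?_ (⟨ξ, hξ⟩, x)
  · simpa [sub_nonpos] using key
  · intro z
    have := (abs_le.1 (hL z.1.1 z.2)).2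
    linarith
  · intro c
    exact ⟨ρ, by rw [hρ, div_lt_one hD]; linarith, fun _ _ => le_rfl⟩
  · rintro θ hθ hb ⟨⟨η, hη⟩, z⟩
    simp only [mul_one]
    set N : ℝ := (η.card : ℝ) with hN
    have hmN : (m : ℝ) ≤ N := by rw [hN]; exact_mod_cast hη
    have hN0 : 0 ≤ N := hm0.trans hmN
    have h1 := (abs_le.1 (abs_birth_sub_death_le hβ hgen hA hv η z)).1
    have h2 : ∫ y, (h (y ::ₘ z ::ₘ η) - h (z ::ₘ η)) ∂μ ≤ J + θ := by
      have h3 : ∀ y, h (y ::ₘ z ::ₘ η) - h (z ::ₘ η) ≤ J + θ := by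
        intro y
        have := hb (⟨z ::ₘ η, by rw [Multiset.card_cons]; omega⟩, y)
        simp only [mul_one] at this
        linarith
      have h4 := integral_mono ((hi (z ::ₘ η)).sub (integrable_const (h (z ::ₘ η))))
        (integrable_const (μ := μ) (J + θ)) h3
      simpa using h4
    have h5 := hl (z ::ₘ η)
    rw [← hN] at h1
    have hE : 0 < (N + 1) * (1 + β * N) := by positivity
    have h6 : (a + b * (N + 1)) * ((m + 1) * (1 + β * m)) ≤
        (a + b * ((m : ℝ) + 1)) * ((N + 1) * (1 + β * N)) := by
      have h7 : (a + b * (N + 1)) * (m + 1) ≤ (a + b * ((m : ℝ) + 1)) * (N + 1) := by nlinarith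
      have h8 : 1 + β * m ≤ 1 + β * N := by gcongr
      calc _ = ((a + b * (N + 1)) * (m + 1)) * (1 + β * m) := by ring
        _ ≤ ((a + b * ((m : ℝ) + 1)) * (N + 1)) * (1 + β * N) := by gcongr
        _ = _ := by ring
    have h9 : a + b * (N + 1) ≤ ρ * ((N + 1) * (1 + β * N)) := by
      rw [hρ, div_mul_eq_mul_div, le_div_iff₀ hD]
      exact h6
    have h10 : g ≤ (N + 1) * (1 + β * N) - (a + b * (N + 1)) := by
      have h11 : 0 ≤ (1 - b) * (N - m) := mul_nonneg (by linarith) (by linarith)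
      have h12 : 0 ≤ β * ((N - m) * (N + m + 1)) :=
        mul_nonneg hβ (mul_nonneg (by linarith) (by linarith))
      rw [hg]
      nlinarith
    -- J is sized at m and remains enough for N ≥ m: the gap between deaths and births grows, and
    -- the quotient of deaths by that gap shrinks.
    have h13 : -l + (N + 1) * (1 + β * N) * v ≤ J * ((N + 1) * (1 + β * N) - (a + b * (N + 1))) := by
      have h14 : J = -l / g + v * ((m + 1) * (1 + β * m) / g) := by rw [hJ]; ring
      have h15 : -l ≤ -l / g * ((N + 1) * (1 + β * N) - (a + b * (N + 1))) := by
        rw [div_mul_eq_mul_div, le_div_iff₀ hm]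
        exact mul_le_mul_of_nonneg_left h10 (by linarith)
      have h16 : (N + 1) * (1 + β * N) ≤ (m + 1) * (1 + β * m) / g *
          ((N + 1) * (1 + β * N) - (a + b * (N + 1))) := by
        rw [div_mul_eq_mul_div, le_div_iff₀ hm, hg]
        nlinarith
      have h17 := mul_le_mul_of_nonneg_left h16 hv0
      rw [h14]
      linarith
    have h18 : (1 + β * N) * (A + N * B) ≤ (1 + β * N) * ((N + 1) * v) := by
      refine mul_le_mul_of_nonneg_left ?_ (by positivity)
      rw [hN]; exact hvm _ hη
    have h19 := mul_le_mul_of_nonneg_left h2 (by positivity : 0 ≤ a + b * (N + 1))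
    have h20 := mul_le_mul_of_nonneg_right h9 hθ
    have h21 : (N + 1) * (1 + β * N) * (h (z ::ₘ η) - h η) ≤
        (N + 1) * (1 + β * N) * (J + ρ * θ) := by linarith
    have := le_of_mul_le_mul_left h21 hE
    linarith

set_option maxHeartbeats 400000 in
/-- One-sided bound on the second differences of a solution of the Poisson equation. -/
lemma secondDiff_le {Γ : Type*} [MetricSpace Γ] [MeasurableSpace Γ] {μ : Measure Γ}
    [IsProbabilityMeasure μ] (ha : 0 < a) (hb₀ : 0 ≤ b) (hb₁ : b < 1) (hβ : 0 ≤ β)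
    {h φ : Config Γ → ℝ} {L : ℝ} (hL : ∀ (ξ : Config Γ) (x : Γ), |h (x ::ₘ ξ) - h ξ| ≤ L)
    (hi : ∀ ξ, Integrable (fun x => h (x ::ₘ ξ)) μ)
    (hgen : ∀ ξ, generator a b β μ h ξ = φ ξ) {l : ℝ} (hl0 : l ≤ 0) (hl : ∀ ξ, l ≤ φ ξ)
    (hu : ∀ ξ, φ ξ ≤ l + 1) {A B : ℝ} (hA : 0 ≤ A) (hB : 0 ≤ B)
    (hv : ∀ (ξ : Config Γ) (x y : Γ), |h (x ::ₘ ξ) - h (y ::ₘ ξ)| ≤ A / ((ξ.card : ℝ) + 1) + B)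
    (ξ : Config Γ) (x y : Γ) :
    secondDiff h ξ x y ≤ 1 / a + 4 * (A / ((ξ.card : ℝ) + 1) + B) := by
  set n : ℝ := (ξ.card : ℝ) with hn
  have hn0 : 0 ≤ n := Nat.cast_nonneg _
  set v := A / (n + 1) + B with hvdef
  have hv0 : 0 ≤ v := by positivity
  have hvA : (n + 1) * v = A + (n + 1) * B := by rw [hvdef]; field_simp
  set α := a + b * (n + 1) with hα
  set δ := (n + 1) * (1 + β * n) with hδ
  have hαa : a ≤ α := by have : 0 ≤ b * (n + 1) := by positivity
                         linarith
  have hδ0 : 0 < δ := by positivity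
  set r := h (x ::ₘ ξ) - h ξ with hr
  set I := ∫ z, (h (z ::ₘ x ::ₘ ξ) - h (x ::ₘ ξ)) ∂μ with hI
  set P := h (y ::ₘ x ::ₘ ξ) - h (x ::ₘ ξ) with hP
  have h1 := abs_le.1 (abs_birth_sub_death_le hβ hgen hA hv ξ x)
  rw [← hn, ← hI, ← hr] at h1
  have herr : (1 + β * n) * (A + n * B) ≤ δ * v := by
    have : δ * v = (1 + β * n) * (A + (n + 1) * B) := by rw [hδ, ← hvA]; ring
    rw [this]
    gcongr
    linarith
  have h2 : P ≤ I + v := by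
    have h3 := (abs_le.1 (abs_sub_birth_le hi hv (x ::ₘ ξ) y)).2
    have h4 : A / ((Multiset.card (x ::ₘ ξ) : ℝ) + 1) ≤ A / (n + 1) := by
      rw [Multiset.card_cons, hn]; push_cast
      gcongr
      linarith
    linarith
  have h5 : secondDiff h ξ x y ≤ P - r + v := by
    have h6 := (abs_le.1 (hv ξ x y)).2
    rw [secondDiff, Multiset.cons_swap]
    linarith
  have h7 := hl (x ::ₘ ξ)
  have h8 := hu (x ::ₘ ξ)
  have hmain : δ * r = (1 + β * n) * ((n + 1) * r) := by rw [hδ]; ring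
  -- At size n + 1, eliminate I from the Poisson equation and multiply by the larger rate. What is
  -- left is (α - δ) times -r in the first case and (δ - α) times P in the second, so only one
  -- one-sided bound is needed.
  rcases lt_or_ge δ α with hlt | hge
  · have hgap : α - δ ≤ a + b * n - n * (1 + β * (n - 1)) := by
      have h9 : a + b * n - n * (1 + β * (n - 1)) - (α - δ) = 1 - b + 2 * β * n := by
        rw [hα, hδ]; ring
      have : 0 ≤ β * n := by positivity
      linarith
    have hpos : 0 < a + b * n - n * (1 + β * (n - 1)) := by linarith
    have h10 := neg_le_cons_sub ha hb₀ hb₁ hβ hi hgen hl0 hl hA hB hv (n := ξ.card) hpos ξ.card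
      le_rfl ξ x rfl
    rw [← hn, ← hr] at h10
    set g := a + b * n - n * (1 + β * (n - 1)) with hg
    set J := (A * (1 + β * n) + B * (a + b * n) - l) / g with hJ
    have hJg : J * g = A * (1 + β * n) + B * (a + b * n) - l := div_mul_cancel₀ _ hpos.ne'
    have hJ0 : 0 ≤ J := by
      refine div_nonneg ?_ hpos.le
      have : 0 ≤ A * (1 + β * n) := by positivity
      have : 0 ≤ B * (a + b * n) := by positivity
      linarith
    -- The term δA/(n + 1) = A(1 + βn) cancels exactly against the same term in Jg.
    have h11 : -((α - δ) * r) ≤ α * v - l := by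
      have h12 := mul_le_mul_of_nonneg_left h10 (by linarith : 0 ≤ α - δ)
      have h13 := mul_le_mul_of_nonneg_left hgap hJ0
      have h14 : δ * (A / (n + 1)) = A * (1 + β * n) := by rw [hδ]; field_simp
      have h15 : B * (a + b * n) ≤ B * α := by
        refine mul_le_mul_of_nonneg_left ?_ hB
        rw [hα]; linarith
      rw [hvdef]
      linarith
    have h16 : α * secondDiff h ξ x y ≤ 1 + α * (4 * v) := by
      have h17 := mul_le_mul_of_nonneg_left h5 (by linarith : 0 ≤ α)
      have h18 := mul_le_mul_of_nonneg_left h2 (by linarith : 0 ≤ α)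
      have h19 := mul_le_mul_of_nonneg_right hlt.le hv0
      linarith
    have h20 : secondDiff h ξ x y ≤ 1 / α + 4 * v := by
      have hα0 : 0 < α := by linarith
      refine le_of_mul_le_mul_left ?_ hα0
      have : α * (1 / α + 4 * v) = 1 + α * (4 * v) := by field_simp
      linarith
    have h21 : 1 / α ≤ 1 / a := by gcongr
    linarith
  · have hcast : ((ξ.card + 1 : ℕ) : ℝ) = n + 1 := by push_cast; rfl
    have hgap : δ - α ≤ (n + 1 + 1) * (1 + β * (n + 1)) - (a + b * (n + 1 + 1)) := by
      have h9 : (n + 1 + 1) * (1 + β * (n + 1)) - (a + b * (n + 1 + 1)) - (δ - α) =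
          1 - b + 2 * β * (n + 1) := by rw [hα, hδ]; ring
      have : 0 ≤ β * (n + 1) := by positivity
      linarith
    -- Going up one size gains at least 1 - b, so the gap is strictly positive even when δ = α.
    have hpos : 0 < (n + 1 + 1) * (1 + β * (n + 1)) - (a + b * (n + 1 + 1)) := by
      have h9 : (n + 1 + 1) * (1 + β * (n + 1)) - (a + b * (n + 1 + 1)) - (δ - α) =
          1 - b + 2 * β * (n + 1) := by rw [hα, hδ]; ring
      have : 0 ≤ β * (n + 1) := by positivity
      linarith
    have h10 := cons_sub_le ha hb₀ hb₁ hβ hL hi hgen hl0 hl hA hv (m := ξ.card + 1) (v := v) hv0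
      (by
        intro N hN
        have hN' : n + 1 ≤ N := by rw [← hcast]; exact_mod_cast hN
        have h11 : A ≤ (N + 1) * (A / (n + 1)) := by
          rw [mul_div_assoc', le_div_iff₀ (by positivity), mul_comm]
          exact mul_le_mul_of_nonneg_right (by linarith) hA
        rw [hvdef]
        linarith)
      (by rw [hcast]; exact hpos) (x ::ₘ ξ) y (by simp)
    rw [hcast, ← hP] at h10
    set D := (n + 1 + 1) * (1 + β * (n + 1)) with hD
    set g := D - (a + b * (n + 1 + 1)) with hg
    set J := (-l + D * v) / g with hJ
    have h11 : (δ - α) * P ≤ -l + δ * v := by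
      have h12 := mul_le_mul_of_nonneg_left h10 (sub_nonneg.2 hge)
      have h13 : J = -l / g + v * (D / g) := by rw [hJ]; ring
      have h14 : (δ - α) * (-l / g) ≤ -l := by
        rw [mul_div_assoc', div_le_iff₀ hpos, mul_comm]
        exact mul_le_mul_of_nonneg_left hgap (by linarith)
      have h15 : (δ - α) * (D / g) ≤ δ := by
        rw [mul_div_assoc', div_le_iff₀ hpos, hg]
        have h16 : (a + b * (n + 1 + 1)) * δ ≤ α * D := by
          have h17 : (a + b * (n + 1 + 1)) * (n + 1) ≤ α * (n + 1 + 1) := by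
            rw [hα]; linarith
          have h18 : 1 + β * n ≤ 1 + β * (n + 1) := by gcongr; linarith
          calc _ = ((a + b * (n + 1 + 1)) * (n + 1)) * (1 + β * n) := by rw [hδ]; ring
            _ ≤ (α * (n + 1 + 1)) * (1 + β * (n + 1)) := by gcongr
            _ = _ := by rw [hD]; ring
        linarith
      have h19 := mul_le_mul_of_nonneg_left h15 hv0
      rw [h13] at h12
      linarith
    have h16 : δ * secondDiff h ξ x y ≤ 1 + δ * (4 * v) := by
      have h17 := mul_le_mul_of_nonneg_left h5 hδ0.le
      have h18 := mul_le_mul_of_nonneg_left h2 (by linarith : 0 ≤ α)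
      have h19 := mul_le_mul_of_nonneg_right hge hv0
      linarith
    have h20 : secondDiff h ξ x y ≤ 1 / δ + 4 * v := by
      refine le_of_mul_le_mul_left ?_ hδ0
      have : δ * (1 / δ + 4 * v) = 1 + δ * (4 * v) := by field_simp
      linarith
    have h21 : 1 / δ ≤ 1 / a := by
      have : a ≤ δ := hαa.trans hge
      gcongr
    linarith

end DifferenceBounds

/-! ### The Stein solution and the final bounds. -/

section SteinSolutionEq

variable {Γ : Type*} [MeasurableSpace Γ] {μ : Measure Γ} {a b β : ℝ}

lemma steinIntegrand_eq (f : Config Γ → ℝ) (ξ : Config Γ) {t : ℝ} (ht : 0 ≤ t) :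
    steinIntegrand a b β μ f ξ t =
      expect (systemRateKernel a b β μ) f t ξ - ∫ η, f η ∂pbdPointLaw a b β μ := by
  rw [steinIntegrand, systemLaw, expect_of_nonneg f ht]

lemma steinSolution_eq (f : Config Γ → ℝ) (ξ : Config Γ) :
    steinSolution a b β μ f ξ = -∫ t in Set.Ioi (0 : ℝ),
      (expect (systemRateKernel a b β μ) f t ξ - ∫ η, f η ∂pbdPointLaw a b β μ) := by
  rw [steinSolution]
  congr 1
  exact setIntegral_congr_fun measurableSet_Ioi fun t ht => steinIntegrand_eq f ξ (le_of_lt ht)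

end SteinSolutionEq

lemma testFunctions_abs_le {Γ : Type*} [MetricSpace Γ] [MeasurableSpace Γ]
    [BorelSpace Γ] (hΓ : ∀ x y : Γ, dist x y ≤ 1) {f : Config Γ → ℝ}
    (hf : f ∈ testFunctions Γ) (ξ : Config Γ) : |f ξ| ≤ |f 0| + 1 := by
  have h1 := testFunctions_sub_le_one hΓ hf ξ 0
  have h2 := abs_sub_abs_le_abs_sub (f ξ) (f 0)
  linarith

section SteinSolution

variable {Γ : Type*} [MetricSpace Γ] [CompactSpace Γ] [MeasurableSpace Γ] [BorelSpace Γ]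
  {μ : Measure Γ} [IsProbabilityMeasure μ] {a b β : ℝ}

/-- Exponential ergodicity of the birth-death system. -/
lemma abs_expect_sub_integral_le (ha : 0 < a) (hb₀ : 0 ≤ b) (hb₁ : b < 1) (hβ : 0 ≤ β)
    {f : Config Γ → ℝ} (hf : Measurable f) {B : ℝ} (hB0 : 0 ≤ B) (hB : ∀ ξ, |f ξ| ≤ B)
    (hf1 : ∀ (ξ : Config Γ) (x : Γ), |f (x ::ₘ ξ) - f ξ| ≤ 1) {t : ℝ} (ht : 0 ≤ t)
    (ξ : Config Γ) :
    |expect (systemRateKernel a b β μ) f t ξ - ∫ η, f η ∂pbdPointLaw a b β μ| ≤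
      Real.exp (-((1 - b) * t)) * (ξ.card + ∫ η : Config Γ, (η.card : ℝ) ∂pbdPointLaw a b β μ) := by
  have := isProbabilityMeasure_pbdPointLaw (μ := μ) ha hb₀ hb₁ hβ
  set E := expect (systemRateKernel a b β μ) f t with hE
  set q := Real.exp (-((1 - b) * t)) with hq
  -- The contraction estimate is summed along a chain that adds the points of η one at a time.
  have h0 : ∀ η : Config Γ, |E η - E 0| ≤ q * η.card := by
    intro η
    induction η using Multiset.induction with
    | empty => simp
    | cons x η ih =>
      have h1 := abs_expect_cons_sub_le (μ := μ) ha hb₀ hb₁ hβ hf hB0 hB hf1 ht η x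
      have h2 := abs_sub_le (E (x ::ₘ η)) (E η) (E 0)
      rw [Multiset.card_cons]
      push_cast
      linarith
  have hEi : Integrable E (pbdPointLaw a b β μ) :=
    integrable_expect measurable_systemRateKernel hf hB0 hB t _
  have hci := integrable_card_pbdPointLaw (μ := μ) ha hb₀ hb₁ hβ
  rw [← integral_expect_pbdPointLaw ha hb₀ hb₁ hβ hf hB ht]
  have h3 : E ξ - ∫ η, E η ∂pbdPointLaw a b β μ = ∫ η, (E ξ - E η) ∂pbdPointLaw a b β μ := by
    rw [integral_sub (integrable_const _) hEi]; simp
  rw [h3]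
  have h4 : ∫ η : Config Γ, q * (ξ.card + (η.card : ℝ)) ∂pbdPointLaw a b β μ =
      q * (ξ.card + ∫ η : Config Γ, (η.card : ℝ) ∂pbdPointLaw a b β μ) := by
    rw [integral_const_mul, integral_add (integrable_const _) hci]; simp
  rw [← h4, ← Real.norm_eq_abs]
  refine norm_integral_le_of_norm_le (((integrable_const _).add hci).const_mul q)
    (Filter.Eventually.of_forall fun η => ?_)
  have h5 := abs_sub_le (E ξ) (E 0) (E η)
  rw [abs_sub_comm (E 0)] at h5
  have h6 := h0 ξ
  have h7 := h0 η
  rw [Real.norm_eq_abs]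
  linarith

lemma integrableOn_exp_neg_mul {r : ℝ} (hr : 0 < r) :
    IntegrableOn (fun t => Real.exp (-(r * t))) (Set.Ioi 0) := by
  simpa using integrableOn_exp_mul_Ioi (neg_lt_zero.2 hr) 0

lemma integrableOn_expect_sub_integral (ha : 0 < a) (hb₀ : 0 ≤ b) (hb₁ : b < 1) (hβ : 0 ≤ β)
    {f : Config Γ → ℝ} (hf : Measurable f) {B : ℝ} (hB0 : 0 ≤ B) (hB : ∀ ξ, |f ξ| ≤ B)
    (hf1 : ∀ (ξ : Config Γ) (x : Γ), |f (x ::ₘ ξ) - f ξ| ≤ 1) (ξ : Config Γ) :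
    IntegrableOn (fun t => expect (systemRateKernel a b β μ) f t ξ -
      ∫ η, f η ∂pbdPointLaw a b β μ) (Set.Ioi 0) := by
  refine ((integrableOn_exp_neg_mul (sub_pos.2 hb₁)).mul_const
    (ξ.card + ∫ η : Config Γ, (η.card : ℝ) ∂pbdPointLaw a b β μ)).mono' ?_ ?_
  · exact ((((measurable_expect measurable_systemRateKernel hf).comp
      measurable_prodMk_right)).sub_const _).aestronglyMeasurable
  · refine (ae_restrict_mem measurableSet_Ioi).mono fun t ht => ?_
    exact abs_expect_sub_integral_le ha hb₀ hb₁ hβ hf hB0 hB hf1 (le_of_lt ht) ξ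

lemma measurable_steinSolution {f : Config Γ → ℝ} (hf : Measurable f) :
    Measurable (steinSolution a b β μ f) := by
  have h1 : StronglyMeasurable (Function.uncurry fun (ξ : Config Γ) (t : ℝ) =>
      expect (systemRateKernel a b β μ) f t ξ - ∫ η, f η ∂pbdPointLaw a b β μ) :=
    (((measurable_expect measurable_systemRateKernel hf).comp measurable_swap).sub_const
      _).stronglyMeasurable
  have h2 := (h1.integral_prod_right (ν := volume.restrict (Set.Ioi (0 : ℝ)))).measurable.neg
  convert h2 using 1
  funext ξ
  exact steinSolution_eq f ξ

lemma abs_steinSolution_cons_sub_le (ha : 0 < a) (hb₀ : 0 ≤ b) (hb₁ : b < 1) (hβ : 0 ≤ β)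
    {f : Config Γ → ℝ} (hf : Measurable f) {B : ℝ} (hB0 : 0 ≤ B) (hB : ∀ ξ, |f ξ| ≤ B)
    (hf1 : ∀ (ξ : Config Γ) (x : Γ), |f (x ::ₘ ξ) - f ξ| ≤ 1) (ξ : Config Γ) (x : Γ) :
    |steinSolution a b β μ f (x ::ₘ ξ) - steinSolution a b β μ f ξ| ≤
      ∫ t in Set.Ioi (0 : ℝ), Real.exp (-((1 - b) * t)) := by
  have hi := integrableOn_expect_sub_integral (μ := μ) ha hb₀ hb₁ hβ hf hB0 hB hf1
  rw [steinSolution_eq, steinSolution_eq, neg_sub_neg, ← integral_sub (hi ξ) (hi (x ::ₘ ξ)),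
    ← Real.norm_eq_abs]
  refine norm_integral_le_of_norm_le (integrableOn_exp_neg_mul (sub_pos.2 hb₁))
    ((ae_restrict_mem measurableSet_Ioi).mono fun t ht => ?_)
  rw [sub_sub_sub_cancel_right, Real.norm_eq_abs, abs_sub_comm]
  exact abs_expect_cons_sub_le ha hb₀ hb₁ hβ hf hB0 hB hf1 (le_of_lt ht) ξ x

lemma integrable_steinSolution_cons (ha : 0 < a) (hb₀ : 0 ≤ b) (hb₁ : b < 1) (hβ : 0 ≤ β)
    {f : Config Γ → ℝ} (hf : Measurable f) {B : ℝ} (hB0 : 0 ≤ B) (hB : ∀ ξ, |f ξ| ≤ B)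
    (hf1 : ∀ (ξ : Config Γ) (x : Γ), |f (x ::ₘ ξ) - f ξ| ≤ 1) (ξ : Config Γ) :
    Integrable (fun x => steinSolution a b β μ f (x ::ₘ ξ)) μ := by
  refine Integrable.of_bound
    ((measurable_steinSolution hf).comp (measurable_cons_left ξ)).aestronglyMeasurable
    (|steinSolution a b β μ f ξ| + ∫ t in Set.Ioi (0 : ℝ), Real.exp (-((1 - b) * t)))
    (Filter.Eventually.of_forall fun x => ?_)
  have h1 := abs_steinSolution_cons_sub_le (μ := μ) ha hb₀ hb₁ hβ hf hB0 hB hf1 ξ x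
  have h2 := abs_sub_abs_le_abs_sub (steinSolution a b β μ f (x ::ₘ ξ)) (steinSolution a b β μ f ξ)
  rw [Real.norm_eq_abs]
  linarith

/-- The Stein equation. -/
lemma generator_steinSolution (ha : 0 < a) (hb₀ : 0 ≤ b) (hb₁ : b < 1) (hβ : 0 ≤ β)
    {f : Config Γ → ℝ} (hf : Measurable f) {B : ℝ} (hB0 : 0 ≤ B) (hB : ∀ ξ, |f ξ| ≤ B)
    (hf1 : ∀ (ξ : Config Γ) (x : Γ), |f (x ::ₘ ξ) - f ξ| ≤ 1) (ξ : Config Γ) :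
    generator a b β μ (steinSolution a b β μ f) ξ = f ξ - ∫ η, f η ∂pbdPointLaw a b β μ := by
  rw [← integral_sub_rate_mul_eq_generator ha hb₀ hβ (measurable_steinSolution hf)
    (integrable_steinSolution_cons ha hb₀ hb₁ hβ hf hB0 hB hf1 ξ)]
  have hWm : Measurable fun ξ : Config Γ =>
      (ξ.card : ℝ) + ∫ η : Config Γ, (η.card : ℝ) ∂pbdPointLaw a b β μ :=
    ((measurable_of_countable (fun n : ℕ => (n : ℝ))).comp measurable_card).add_const _
  have h1 := poisson_equation measurable_systemRateKernel hf hB0 hB (sub_pos.2 hb₁)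
    (fun t ht ξ => abs_expect_sub_integral_le (μ := μ) ha hb₀ hb₁ hβ hf hB0 hB hf1 ht ξ) ξ
    (integrable_systemRateKernel hWm (by simp))
  simp only [steinSolution_eq, integral_neg]
  linarith

lemma steinWellDefined (hΓ : ∀ x y : Γ, dist x y ≤ 1) (ha : 0 < a) (hb₀ : 0 ≤ b) (hb₁ : b < 1)
    (hβ : 0 ≤ β) {f : Config Γ → ℝ} (hf : f ∈ testFunctions Γ) (ξ : Config Γ) :
    SteinWellDefined a b β μ f ξ := by
  have : Nonempty Γ := nonempty_of_isProbabilityMeasure μ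
  have := isProbabilityMeasure_pbdPointLaw (μ := μ) ha hb₀ hb₁ hβ
  have hm := measurable_testFunction hf
  have hB := testFunctions_abs_le hΓ hf
  refine ⟨Integrable.of_bound hm.aestronglyMeasurable _ (Filter.Eventually.of_forall hB),
    fun t ht => integrable_jumpLaw measurable_systemRateKernel hm hB ht ξ, ?_⟩
  exact (integrableOn_expect_sub_integral ha hb₀ hb₁ hβ hm (by positivity) hB
    (fun η x => testFunctions_sub_le_one hΓ hf _ _) ξ).congr_fun
    (fun t ht => (steinIntegrand_eq f ξ (le_of_lt ht)).symm) measurableSet_Ioi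

lemma abs_steinSolution_cons_sub_cons_le (hΓ : ∀ x y : Γ, dist x y ≤ 1) (ha : 0 < a) (hb₀ : 0 ≤ b)
    (hb₁ : b < 1) (hβ : 0 ≤ β) {f : Config Γ → ℝ} (hf : f ∈ testFunctions Γ)
    {A B : ℝ} (hA : 0 ≤ A) (hB : 0 ≤ B)
    (hAB : ∀ n : ℕ, 1 / ((n : ℝ) + 1) ≤
      (a + b * ((n : ℝ) + 1)) * (A / (((n : ℝ) + 1) * ((n : ℝ) + 2))) + B)
    (ξ : Config Γ) (x y : Γ) :
    |steinSolution a b β μ f (x ::ₘ ξ) - steinSolution a b β μ f (y ::ₘ ξ)| ≤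
      A / ((ξ.card : ℝ) + 1) + B := by
  have : Nonempty Γ := nonempty_of_isProbabilityMeasure μ
  have hm := measurable_testFunction hf
  have hfB := testFunctions_abs_le hΓ hf
  have hB0 : 0 ≤ |f 0| + 1 := by positivity
  have hf1 : ∀ (ξ : Config Γ) (x : Γ), |f (x ::ₘ ξ) - f ξ| ≤ 1 :=
    fun η x => testFunctions_sub_le_one hΓ hf _ _
  refine abs_cons_sub_cons_le ha hb₀ hb₁ hβ
    (integrable_steinSolution_cons ha hb₀ hb₁ hβ hm hB0 hfB hf1)
    (abs_steinSolution_cons_sub_le ha hb₀ hb₁ hβ hm hB0 hfB hf1)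
    (generator_steinSolution ha hb₀ hb₁ hβ hm hB0 hfB hf1) (fun ξ x y => ?_) hA hB hAB ξ x y
  rw [sub_sub_sub_cancel_right]
  exact testFunctions_cons_cons hΓ hf ξ x y

/-- The supersolution condition for (A, B) = (1/2, 1/a). After dropping b, completing the square in
a shows that the slack is nonnegative. -/
lemma one_div_succ_le_half_add (ha : 0 < a) (hb₀ : 0 ≤ b) (n : ℕ) : 1 / ((n : ℝ) + 1) ≤
    (a + b * ((n : ℝ) + 1)) * (1 / 2 / (((n : ℝ) + 1) * ((n : ℝ) + 2))) + 1 / a := by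
  have hn : (0 : ℝ) ≤ n := Nat.cast_nonneg n
  have h1 : a * (1 / 2 / (((n : ℝ) + 1) * ((n : ℝ) + 2))) ≤
      (a + b * ((n : ℝ) + 1)) * (1 / 2 / (((n : ℝ) + 1) * ((n : ℝ) + 2))) := by
    gcongr
    have : 0 ≤ b * ((n : ℝ) + 1) := by positivity
    linarith
  have h2 : a * (1 / 2 / (((n : ℝ) + 1) * ((n : ℝ) + 2))) + 1 / a - 1 / ((n : ℝ) + 1) =
      ((a - (n + 2)) ^ 2 + n * (n + 2)) / (2 * a * ((n + 1) * (n + 2))) := by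
    field_simp
    ring
  have h3 : 0 ≤ ((a - (n + 2)) ^ 2 + n * (n + 2)) / (2 * a * ((n + 1) * (n + 2))) := by positivity
  linarith

/-- The supersolution condition for (A, B) = (1/(a ∧ b), 0), from a + b(n + 1) ≥ (a ∧ b)(n + 2). -/
lemma one_div_succ_le_min (ha : 0 < a) (hb : 0 < b) (n : ℕ) : 1 / ((n : ℝ) + 1) ≤
    (a + b * ((n : ℝ) + 1)) * (1 / min a b / (((n : ℝ) + 1) * ((n : ℝ) + 2))) + 0 := by
  have hc : 0 < min a b := lt_min ha hb
  have h1 : min a b * (n + 2) ≤ a + b * ((n : ℝ) + 1) := by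
    have h2 := min_le_left a b
    have h3 : min a b * ((n : ℝ) + 1) ≤ b * (n + 1) := by
      gcongr
      exact min_le_right a b
    linarith
  calc 1 / ((n : ℝ) + 1) =
      min a b * (n + 2) * (1 / min a b / (((n : ℝ) + 1) * ((n : ℝ) + 2))) := by field_simp
    _ ≤ (a + b * ((n : ℝ) + 1)) * (1 / min a b / (((n : ℝ) + 1) * ((n : ℝ) + 2))) := by gcongr
    _ = _ := (add_zero _).symm

lemma steinC_le (hΓ : ∀ x y : Γ, dist x y ≤ 1) (ha : 0 < a) (hb₀ : 0 ≤ b) (hb₁ : b < 1)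
    (hβ : 0 ≤ β) (n : ℕ) : steinC a b β μ n ≤
      min 1 (min (ENNReal.ofReal (1 / (2 * ((n : ℝ) + 1)) + 1 / a))
        (ENNReal.ofReal (min a b * ((n : ℝ) + 1)))⁻¹) := by
  refine iSup₂_le fun f hf => iSup₂_le fun ξ hξ => iSup₂_le fun x y => ?_
  have key := fun {A B : ℝ} (hA : 0 ≤ A) (hB : 0 ≤ B) hAB =>
    abs_steinSolution_cons_sub_cons_le (μ := μ) hΓ ha hb₀ hb₁ hβ hf hA hB hAB ξ x y
  rw [hξ] at key
  refine le_min ?_ (le_min ?_ ?_)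
  · rw [← ENNReal.ofReal_one]
    refine ENNReal.ofReal_le_ofReal ((key le_rfl zero_le_one fun k => ?_).trans (by simp))
    rw [zero_div, mul_zero, zero_add, div_le_one (by positivity)]
    linarith [(Nat.cast_nonneg k : (0 : ℝ) ≤ k)]
  · refine ENNReal.ofReal_le_ofReal
      ((key (by norm_num) (by positivity) (one_div_succ_le_half_add ha hb₀)).trans_eq ?_)
    rw [div_div]
  -- For b = 0 the minimum vanishes and its inverse in `ℝ≥0∞` is ∞.
  · rcases hb₀.eq_or_lt with rfl | hb
    · simp [min_eq_right ha.le]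
    · have hc : 0 < min a b := lt_min ha hb
      rw [← ENNReal.ofReal_inv_of_pos (by positivity)]
      refine ENNReal.ofReal_le_ofReal
        ((key (by positivity) le_rfl (one_div_succ_le_min ha hb)).trans_eq ?_)
      rw [add_zero, div_div, one_div]

lemma secondDiffSup_steinSolution_le (hΓ : ∀ x y : Γ, dist x y ≤ 1) (ha : 0 < a) (hb₀ : 0 ≤ b)
    (hb₁ : b < 1) (hβ : 0 ≤ β) {f : Config Γ → ℝ} (hf : f ∈ testFunctions Γ) (ξ : Config Γ) :
    secondDiffSup (steinSolution a b β μ f) ξ ≤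
      ENNReal.ofReal (2 / ((ξ.card : ℝ) + 1) + 5 / a) := by
  refine iSup₂_le fun x y => ENNReal.ofReal_le_ofReal ?_
  have : Nonempty Γ := nonempty_of_isProbabilityMeasure μ
  have := isProbabilityMeasure_pbdPointLaw (μ := μ) ha hb₀ hb₁ hβ
  have hm := measurable_testFunction hf
  have hfB := testFunctions_abs_le hΓ hf
  have hB0 : 0 ≤ |f 0| + 1 := by positivity
  have hf1 : ∀ (ξ : Config Γ) (x : Γ), |f (x ::ₘ ξ) - f ξ| ≤ 1 :=
    fun η x => testFunctions_sub_le_one hΓ hf _ _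
  have hfi : Integrable f (pbdPointLaw a b β μ) :=
    Integrable.of_bound hm.aestronglyMeasurable _ (Filter.Eventually.of_forall hfB)
  have hi := integrable_steinSolution_cons (μ := μ) ha hb₀ hb₁ hβ hm hB0 hfB hf1
  have hL := abs_steinSolution_cons_sub_le (μ := μ) ha hb₀ hb₁ hβ hm hB0 hfB hf1
  have hgen := generator_steinSolution (μ := μ) ha hb₀ hb₁ hβ hm hB0 hfB hf1
  have hv := abs_steinSolution_cons_sub_cons_le (μ := μ) hΓ ha hb₀ hb₁ hβ hf
    (by norm_num : (0 : ℝ) ≤ 1 / 2) (by positivity) (one_div_succ_le_half_add ha hb₀)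
  set h := steinSolution a b β μ f
  set c := ∫ η, f η ∂pbdPointLaw a b β μ with hc
  have hlow : ∀ η, (⨅ η, f η) ≤ f η :=
    ciInf_le ⟨-(|f 0| + 1), by rintro _ ⟨η, rfl⟩; exact (abs_le.1 (hfB η)).1⟩
  have hupp : ∀ η, f η ≤ (⨅ η, f η) + 1 := by
    intro η
    rw [← sub_le_iff_le_add]
    refine le_ciInf fun ζ => ?_
    linarith [(abs_le.1 (testFunctions_sub_le_one hΓ hf η ζ)).2]
  have hclow : (⨅ η, f η) ≤ c := by
    have := integral_mono (integrable_const (μ := pbdPointLaw a b β μ) (⨅ η, f η)) hfi hlow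
    simpa using this
  have hcupp : c ≤ (⨅ η, f η) + 1 := by
    have := integral_mono hfi (integrable_const (μ := pbdPointLaw a b β μ) ((⨅ η, f η) + 1)) hupp
    simpa using this
  -- Since f oscillates by at most 1 and c is its mean, f - c takes values in [l, l + 1] with l ≤ 0
  -- ≤ l + 1. For -h the corresponding interval starts at -(l + 1).
  have h1 := secondDiff_le ha hb₀ hb₁ hβ hL hi hgen (l := (⨅ η, f η) - c) (by linarith)
    (fun η => by linarith [hlow η]) (fun η => by linarith [hupp η]) (by norm_num) (by positivity)
    hv ξ x y
  have h2 := secondDiff_le (h := -h) (φ := fun η => -(f η - c)) ha hb₀ hb₁ hβ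
    (fun η z => by rw [Pi.neg_apply, Pi.neg_apply, neg_sub_neg, abs_sub_comm]; exact hL η z)
    (fun η => (hi η).neg) (fun η => by rw [generator_neg, hgen])
    (l := -((⨅ η, f η) - c + 1)) (by linarith)
    (fun η => by linarith [hupp η]) (fun η => by linarith [hlow η])
    (by norm_num : (0 : ℝ) ≤ 1 / 2) (by positivity : 0 ≤ 1 / a)
    (fun η z w => by rw [Pi.neg_apply, Pi.neg_apply, neg_sub_neg, abs_sub_comm]; exact hv η z w)
    ξ x y
  have h3 : secondDiff (-h) ξ x y = -secondDiff h ξ x y := by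
    simp only [secondDiff, Pi.neg_apply]; ring
  have h4 : 1 / a + 4 * (1 / 2 / ((ξ.card : ℝ) + 1) + 1 / a) = 2 / ((ξ.card : ℝ) + 1) + 5 / a := by
    ring
  rw [h4] at h1 h2
  rw [h3] at h2
  exact abs_le.2 ⟨by linarith, h1⟩

end SteinSolution

end

end PBDP

theorem theorem2p1 {Γ : Type*} [MetricSpace Γ] [CompactSpace Γ] [MeasurableSpace Γ] [BorelSpace Γ]
    (hΓ : ∀ x y : Γ, dist x y ≤ 1) (μ : Measure Γ) [IsProbabilityMeasure μ]
    (a b β : ℝ) (ha : 0 < a) (hb₀ : 0 ≤ b) (hb₁ : b < 1) (hβ : 0 ≤ β) :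
    -- the underlying objects are well defined
    PBDP.IsInvariantDistribution a b β (PBDP.pbdDistribution a b β) ∧
    (∀ f ∈ PBDP.testFunctions Γ, ∀ ξ : PBDP.Config Γ, PBDP.SteinWellDefined a b β μ f ξ) ∧
    -- (i), where the last term is `∞` if `b = 0`
    (∀ n : ℕ, PBDP.steinC a b β μ n ≤
      min 1 (min (ENNReal.ofReal (1 / (2 * ((n : ℝ) + 1)) + 1 / a))
        (ENNReal.ofReal (min a b * ((n : ℝ) + 1)))⁻¹)) ∧
    -- (ii)
    (∀ f ∈ PBDP.testFunctions Γ, ∀ ξ : PBDP.Config Γ,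
      PBDP.secondDiffSup (PBDP.steinSolution a b β μ f) ξ ≤
        ENNReal.ofReal (2 / ((ξ.card : ℝ) + 1) + 5 / a)) := by
  exact ⟨PBDP.isInvariantDistribution_pbdDistribution ha hb₀ hb₁ hβ,
    fun f hf ξ => PBDP.steinWellDefined hΓ ha hb₀ hb₁ hβ hf ξ,
    PBDP.steinC_le hΓ ha hb₀ hb₁ hβ,
    fun f hf ξ => PBDP.secondDiffSup_steinSolution_le hΓ ha hb₀ hb₁ hβ hf ξ⟩
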